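/- For a finite set $P\subset\mathbb R^2$, the onion $\mathrm{onion}(P)$ is the list of its convex layers, outermost first: it is empty if $P=\emptyset$; otherwise its first layer is the convex polygon $\mathrm{ch}(P)$ (possibly degenerated to a segment or to a point), given by its vertices, i.e. the extreme points of the convex hull of $P$, and the remaining layers are the onion of $P$ minus these vertices. Model of computation. A program is a finite system of mutually recursive first-order functions. It works on data built from null pointers, real numbers and immutable two-field memory cells (pointer machine with exact real arithmetic); the only numerical constants in a program are integers. Every executed elementary operation (variable access, allocation of a cell, access to a field, test whether a datum is a cell, $+,-,\times,\div$ and comparison of two real numbers, local binding, function call) takes one time step. Representation. An onion is stored as a linked list of its layers, outermost first. Each layer is stored as a height-balanced (AVL) leaf-oriented binary search tree, whose leaves are, from left to right, the vertices of the layer in counterclockwise order starting at the lexicographically smallest one; every inner node stores its height, the first and the last leaf below it, and its two subtrees. Theorem. There are a program $M$ and a constant $C$ such that the following holds for all finite sets $P,Q\subset\mathbb R^2$ whose convex hulls are disjoint. Given any stored representations of $\mathrm{onion}(P)$ and $\mathrm{onion}(Q)$, the program $M$ halts with a stored representation of $\mathrm{onion}(P\cup Q)$ as its output. If $n=|P|+|Q|\ge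 2$, then it needs at most $C\,k^2\log_2 n$ steps, where $k$ is the number of layers of $\mathrm{onion}(P\cup Q)$. That is, the running time is $O(k^2\log n)$. -/

import Mathlib

namespace OnionUnion

/-! ### Onions of planar point sets -/

/-- The plane. -/
abbrev Pt : Type := ℝ × ℝ

open Classical in
/-- The vertices of the convex hull of the finite point set `P`. -/
noncomputable def hullVertices (P : Finset Pt) : Finset Pt :=
  P.filter (fun p => p ∈ (convexHull ℝ (P : Set Pt)).extremePoints ℝ)

theorem hullVertices_subset (P : Finset Pt) : hullVertices P ⊆ P := by
  classical exact Finset.filter_subset _ _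

theorem hullVertices_nonempty {P : Finset Pt} (hP : P.Nonempty) :
    (hullVertices P).Nonempty := by
  have hc : IsCompact (convexHull ℝ (P : Set Pt)) :=
    P.finite_toSet.isCompact_convexHull (𝕜 := ℝ)
  have hne : (convexHull ℝ (P : Set Pt)).Nonempty :=
    (convexHull_nonempty_iff (𝕜 := ℝ)).2 (by exact_mod_cast hP)
  obtain ⟨x, hx⟩ := hc.extremePoints_nonempty hne
  refine ⟨x, ?_⟩
  have hxP : x ∈ (P : Set Pt) := extremePoints_convexHull_subset hx
  simp only [hullVertices, Finset.mem_filter]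
  exact ⟨by exact_mod_cast hxP, hx⟩

theorem card_sdiff_hullVertices_lt {P : Finset Pt} (hP : P ≠ ∅) :
    (P \ hullVertices P).card < P.card := by
  obtain ⟨x, hx⟩ := hullVertices_nonempty (Finset.nonempty_iff_ne_empty.2 hP)
  refine Finset.card_lt_card ⟨Finset.sdiff_subset, fun h => ?_⟩
  exact (Finset.mem_sdiff.1 (h (hullVertices_subset P hx))).2 hx

/-- The onion (convex layers) of `P`, outermost layer first; every layer is a convex polygon,
given by its set of vertices. -/
noncomputable def onion (P : Finset Pt) : List (Finset Pt) :=
  if _h : P = ∅ then [] else hullVertices P :: onion (P \ hullVertices P)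
termination_by P.card
decreasing_by exact card_sdiff_hullVertices_lt _h

/-- Twice the signed area of the triangle `a b c`; positive iff `a`, `b`, `c` make a left turn. -/
def orient (a b c : Pt) : ℝ :=
  (b.1 - a.1) * (c.2 - a.2) - (b.2 - a.2) * (c.1 - a.1)

/-- `L` lists the vertices `V` of a convex polygon (possibly degenerated to a segment or to a
point) in counterclockwise order, starting at the lexicographically smallest vertex. -/
structure IsBoundaryList (V : Finset Pt) (L : List Pt) : Prop where
  nodup : L.Nodup
  mem_iff : ∀ p, p ∈ L ↔ p ∈ V
  ccw : ∀ a b c, [a, b, c].Sublist L → 0 < orient a b c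
  start : ∀ p ∈ L.head?, ∀ q ∈ V, toLex p ≤ toLex q

/-! ### Balanced search trees -/

/-- Leaf-oriented binary trees with points in the leaves. -/
inductive PTree : Type
  | leaf (p : Pt) : PTree
  | node (l r : PTree) : PTree

namespace PTree

/-- The points in the leaves, from left to right. -/
def toList : PTree → List Pt
  | leaf p => [p]
  | node l r => l.toList ++ r.toList

def height : PTree → ℕ
  | leaf _ => 0
  | node l r => max l.height r.height + 1

/-- The height-balance condition of AVL trees. -/
def Balanced : PTree → Prop
  | leaf _ => True
  | node l r => l.Balanced ∧ r.Balanced ∧ l.height ≤ r.height + 1 ∧ r.height ≤ l.height + 1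

/-- The leftmost leaf. -/
def first : PTree → Pt
  | leaf p => p
  | node l _ => l.first

/-- The rightmost leaf. -/
def last : PTree → Pt
  | leaf p => p
  | node _ r => r.last

end PTree

/-! ### The machine: first-order recursive programs on linked cells and real numbers -/

/-- Data: the null pointer, a real number, or (a pointer to) an immutable cell with two fields. -/
inductive Val : Type
  | nil : Val
  | num (x : ℝ) : Val
  | pair (a b : Val) : Val

/-- Expressions. Variables are de Bruijn indices into the environment. -/
inductive Expr : Type
  | var (i : ℕ) : Expr
  | nil : Expr
  | const (z : ℤ) : Expr
  | add (e₁ e₂ : Expr) : Expr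
  | sub (e₁ e₂ : Expr) : Expr
  | mul (e₁ e₂ : Expr) : Expr
  | div (e₁ e₂ : Expr) : Expr
  | pair (e₁ e₂ : Expr) : Expr
  | fst (e : Expr) : Expr
  | snd (e : Expr) : Expr
  /-- `ifPair e e₁ e₂`: if `e` is a pair, continue with `e₁`, otherwise with `e₂`. -/
  | ifPair (e e₁ e₂ : Expr) : Expr
  /-- `ifLt a b e₁ e₂`: if the number `a` is less than the number `b`, continue with `e₁`,
  otherwise with `e₂`. -/
  | ifLt (a b e₁ e₂ : Expr) : Expr
  /-- `bind e e₁`: evaluate `e`, and then `e₁` with the value of `e` as variable `0`. -/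
  | bind (e e₁ : Expr) : Expr
  /-- `call f e`: call the function with number `f` of the program on the value of `e`. -/
  | call (f : ℕ) (e : Expr) : Expr

/-- A program: the bodies of finitely many mutually recursive one-argument functions, and a main
expression. -/
structure Program where
  funs : List Expr
  main : Expr

/-- `Eval F env e v t`: with the function bodies `F`, the expression `e` evaluates in the
environment `env` to `v` in `t` steps. Every executed operation (variable access, allocation of a
cell, field access, arithmetic operation, comparison, binding, call) costs one step. -/
inductive Eval (F : List Expr) : List Val → Expr → Val → ℕ → Prop
  | var {env : List Val} {i : ℕ} {v : Val} :
      env[i]? = some v → Eval F env (.var i) v 1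
  | nil {env : List Val} : Eval F env .nil .nil 1
  | const {env : List Val} {z : ℤ} : Eval F env (.const z) (.num (z : ℝ)) 1
  | add {env : List Val} {e₁ e₂ : Expr} {x y : ℝ} {s t : ℕ} :
      Eval F env e₁ (.num x) s → Eval F env e₂ (.num y) t →
      Eval F env (.add e₁ e₂) (.num (x + y)) (s + t + 1)
  | sub {env : List Val} {e₁ e₂ : Expr} {x y : ℝ} {s t : ℕ} :
      Eval F env e₁ (.num x) s → Eval F env e₂ (.num y) t →
      Eval F env (.sub e₁ e₂) (.num (x - y)) (s + t + 1)
  | mul {env : List Val} {e₁ e₂ : Expr} {x y : ℝ} {s t : ℕ} :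
      Eval F env e₁ (.num x) s → Eval F env e₂ (.num y) t →
      Eval F env (.mul e₁ e₂) (.num (x * y)) (s + t + 1)
  | div {env : List Val} {e₁ e₂ : Expr} {x y : ℝ} {s t : ℕ} :
      Eval F env e₁ (.num x) s → Eval F env e₂ (.num y) t → y ≠ 0 →
      Eval F env (.div e₁ e₂) (.num (x / y)) (s + t + 1)
  | pair {env : List Val} {e₁ e₂ : Expr} {a b : Val} {s t : ℕ} :
      Eval F env e₁ a s → Eval F env e₂ b t →
      Eval F env (.pair e₁ e₂) (.pair a b) (s + t + 1)
  | fst {env : List Val} {e : Expr} {a b : Val} {s : ℕ} :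
      Eval F env e (.pair a b) s → Eval F env (.fst e) a (s + 1)
  | snd {env : List Val} {e : Expr} {a b : Val} {s : ℕ} :
      Eval F env e (.pair a b) s → Eval F env (.snd e) b (s + 1)
  | ifPair_pair {env : List Val} {e e₁ e₂ : Expr} {a b v : Val} {s t : ℕ} :
      Eval F env e (.pair a b) s → Eval F env e₁ v t →
      Eval F env (.ifPair e e₁ e₂) v (s + t + 1)
  | ifPair_nil {env : List Val} {e e₁ e₂ : Expr} {v : Val} {s t : ℕ} :
      Eval F env e .nil s → Eval F env e₂ v t →
      Eval F env (.ifPair e e₁ e₂) v (s + t + 1)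
  | ifPair_num {env : List Val} {e e₁ e₂ : Expr} {x : ℝ} {v : Val} {s t : ℕ} :
      Eval F env e (.num x) s → Eval F env e₂ v t →
      Eval F env (.ifPair e e₁ e₂) v (s + t + 1)
  | ifLt_true {env : List Val} {a b e₁ e₂ : Expr} {x y : ℝ} {v : Val} {r s t : ℕ} :
      Eval F env a (.num x) r → Eval F env b (.num y) s → x < y → Eval F env e₁ v t →
      Eval F env (.ifLt a b e₁ e₂) v (r + s + t + 1)
  | ifLt_false {env : List Val} {a b e₁ e₂ : Expr} {x y : ℝ} {v : Val} {r s t : ℕ} :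
      Eval F env a (.num x) r → Eval F env b (.num y) s → ¬ x < y → Eval F env e₂ v t →
      Eval F env (.ifLt a b e₁ e₂) v (r + s + t + 1)
  | bind {env : List Val} {e e₁ : Expr} {a v : Val} {s t : ℕ} :
      Eval F env e a s → Eval F (a :: env) e₁ v t →
      Eval F env (.bind e e₁) v (s + t + 1)
  | call {env : List Val} {f : ℕ} {e body : Expr} {a v : Val} {s t : ℕ} :
      Eval F env e a s → F[f]? = some body → Eval F [a] body v t →
      Eval F env (.call f e) v (s + t + 1)

/-- Evaluation is deterministic: the result and the number of steps are unique. -/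
theorem Eval.unique {F : List Expr} {env : List Val} {e : Expr} {v : Val} {t : ℕ}
    (h : Eval F env e v t) : ∀ {w : Val} {u : ℕ}, Eval F env e w u → v = w ∧ t = u := by
  induction h <;> intro w u h' <;> cases h' <;> grind

/-- On input `a`, the program halts with output `v` after exactly `t` steps. -/
def Program.Run (M : Program) (a v : Val) (t : ℕ) : Prop :=
  Eval M.funs [a] M.main v t

/-! ### Onions in memory -/

def encodePt (p : Pt) : Val := .pair (.num p.1) (.num p.2)

/-- A search tree in memory. An inner node stores its height, the smallest and the largest key
below it (as routing keys), and its two subtrees. -/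
noncomputable def PTree.encode : PTree → Val
  | .leaf p => .pair .nil (encodePt p)
  | .node l r =>
      .pair (.pair (.num ((PTree.node l r).height : ℝ))
              (.pair (encodePt (PTree.node l r).first) (encodePt (PTree.node l r).last)))
            (.pair l.encode r.encode)

/-- A linked list of search trees in memory. -/
noncomputable def encodeTrees : List PTree → Val
  | [] => .nil
  | T :: Ts => .pair T.encode (encodeTrees Ts)

/-- `v` is a representation of the onion of `P` in memory: the list of its layers, outermost
first, each of them a balanced search tree that holds the vertices of the layer in
counterclockwise order. -/
def RepresentsOnion (P : Finset Pt) (v : Val) : Prop :=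
  ∃ Ts : List PTree,
    List.Forall₂ (fun (T : PTree) (V : Finset Pt) => T.Balanced ∧ IsBoundaryList V T.toList)
      Ts (onion P) ∧
    v = encodeTrees Ts

end OnionUnion

namespace OnionUnion

/-! The outermost layer of two sets on different sides of a line consists of one path of each hull,
joined by the two common tangents. When these paths are taken off, each set is left with the
complementary path `C` of its old outer layer (possibly empty) and its untouched inner layers; let
`S` be the set of points in these inner layers. If `C` is nonempty, then it is part of the hull of
`C ∪ S`, and the rest of this hull is either a single edge that closes `C`, or a path on the hull of
`S` between the tangent points seen from the two ends of `C`. In the second case the unused part of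
the hull of `S` is again an open path around the next deeper layers, and the situation repeats one
layer deeper. This is `repair_spec`: an onion is restored with a bounded number of tree operations
per layer.

The union is then computed layer by layer (`union_spec`). Every layer of the result causes two
repairs. Each of them passes through at most as many layers as remain in the result, because the
number of layers is monotone in the set (`onion_length_mono`). With logarithmic cost for each
operation on a layer, the sum is quadratic in the number of layers, times a logarithm.

Layers are verified locally. `HullEdge P p q` requires all other points of `P` to be strictly to the
left of `p q` or on the line strictly between the ends. Such pairs survive the passage to subsets
that contain their ends (`HullEdge.mono`), and each end determines the other
(`HullEdge.left_unique`, `HullEdge.right_unique`). A cyclic list of successive hull edges already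
contains all vertices and is counterclockwise in the global sense (`Cyc.mem_of_isVertex`,
`Cyc.ccw`). New layers can therefore be glued from paths (`cyc_append`, `cyc_union`) by checking
consecutive pairs only.

The logarithmic operations are these. Balanced trees are joined and split (`join_spec`,
`splitBody_spec`), with orientation tests relative to the first leaf. A least vertex is found by
descent (`find_body_spec`) for every order that is locally a lexicographic comparison of affine
functions: along a convex polygon such an order cannot alternate (`Ccw.unimodal`), since the
diagonals of a convex quadrilateral cross. This yields extreme points in a direction and tangents
from a point. The common tangent of two chains is found by a simultaneous descent (`bridge_step`,
`BridgeHyp.step`): the slopes of the two middle edges and the heights of their lines over the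
separating line always exclude a half of one chain.

The tangent search needs a separating line, which is computed once from the outermost layers
(`separate_spec`). If no vertical line separates them, one set lies above the other. The vertical
gap between a lower and an upper chain, as a function of the slope, is a concave function; its
maximum is located by another simultaneous descent (`SepHyp.step`, `sepSearchBody_spec`), and a line
of this slope in the middle of the gap separates the sets. -/

/-! ### Evaluation with a step budget -/

/-- `e` evaluates to `v` within at most `t` steps. -/
def Ev (F : List Expr) (env : List Val) (e : Expr) (v : Val) (t : ℕ) : Prop :=
  ∃ s ≤ t, Eval F env e v s

/-- The number of nodes of an expression. -/
def Expr.size : Expr → ℕ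
  | .var _ => 1
  | .nil => 1
  | .const _ => 1
  | .add a b => a.size + b.size + 1
  | .sub a b => a.size + b.size + 1
  | .mul a b => a.size + b.size + 1
  | .div a b => a.size + b.size + 1
  | .pair a b => a.size + b.size + 1
  | .fst a => a.size + 1
  | .snd a => a.size + 1
  | .ifPair a b c => a.size + b.size + c.size + 1
  | .ifLt a b c d => a.size + b.size + c.size + d.size + 1
  | .bind a b => a.size + b.size + 1
  | .call _ a => a.size + 1

open Classical in
/-- Evaluation of expressions without function calls. -/
noncomputable def pev : List Val → Expr → Option Val
  | env, .var i => env[i]?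
  | _, .nil => some .nil
  | _, .const z => some (.num z)
  | env, .add a b => match pev env a, pev env b with
    | some (.num x), some (.num y) => some (.num (x + y))
    | _, _ => none
  | env, .sub a b => match pev env a, pev env b with
    | some (.num x), some (.num y) => some (.num (x - y))
    | _, _ => none
  | env, .mul a b => match pev env a, pev env b with
    | some (.num x), some (.num y) => some (.num (x * y))
    | _, _ => none
  | env, .div a b => match pev env a, pev env b with
    | some (.num x), some (.num y) => if y ≠ 0 then some (.num (x / y)) else none
    | _, _ => none
  | env, .pair a b => match pev env a, pev env b with
    | some x, some y => some (.pair x y)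
    | _, _ => none
  | env, .fst a => match pev env a with
    | some (.pair x _) => some x
    | _ => none
  | env, .snd a => match pev env a with
    | some (.pair _ y) => some y
    | _ => none
  | env, .ifPair a b c => match pev env a with
    | some (.pair _ _) => pev env b
    | some .nil => pev env c
    | some (.num _) => pev env c
    | none => none
  | env, .ifLt a b c d => match pev env a, pev env b with
    | some (.num x), some (.num y) => if x < y then pev env c else pev env d
    | _, _ => none
  | env, .bind a b => match pev env a with
    | some x => pev (x :: env) b
    | none => none
  | _, .call _ _ => none

theorem Ev.mono {F : List Expr} {env : List Val} {e : Expr} {v : Val} {s t : ℕ}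
    (h : Ev F env e v s) (hst : s ≤ t) : Ev F env e v t := by
  obtain ⟨r, hr, h⟩ := h
  exact ⟨r, hr.trans hst, h⟩

/-- Without calls nothing is repeated, so every node of the expression is executed at most once. All
straight-line pieces of the program are thereby evaluated by computing `pev`, with a step bound that
can be decided. -/
theorem Ev.of_pev {F : List Expr} {e : Expr} : ∀ {env : List Val} {v : Val},
    pev env e = some v → Ev F env e v e.size := by
  induction e with
  | var i => intro env v h; exact ⟨1, le_rfl, .var h⟩
  | nil => intro env v h; simp only [pev, Option.some.injEq] at h; subst h; exact ⟨1, le_rfl, .nil⟩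
  | const z =>
    intro env v h; simp only [pev, Option.some.injEq] at h; subst h; exact ⟨1, le_rfl, .const⟩
  | add a b iha ihb | sub a b iha ihb | mul a b iha ihb =>
    intro env v h
    simp only [pev] at h
    split at h
    · rename_i x y hx hy
      simp only [Option.some.injEq] at h; subst h
      obtain ⟨s, hs, ha⟩ := iha hx
      obtain ⟨t, ht, hb⟩ := ihb hy
      refine ⟨s + t + 1, by simp only [Expr.size]; omega, ?_⟩
      first
        | exact .add ha hb
        | exact .sub ha hb
        | exact .mul ha hb
    · simp at h
  | div a b iha ihb =>
    intro env v h
    simp only [pev] at h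
    split at h
    · rename_i x y hx hy
      split_ifs at h with h0
      simp only [Option.some.injEq] at h; subst h
      obtain ⟨s, hs, ha⟩ := iha hx
      obtain ⟨t, ht, hb⟩ := ihb hy
      exact ⟨s + t + 1, by simp only [Expr.size]; omega, .div ha hb h0⟩
    · simp at h
  | pair a b iha ihb =>
    intro env v h
    simp only [pev] at h
    split at h
    · rename_i x y hx hy
      simp only [Option.some.injEq] at h; subst h
      obtain ⟨s, hs, ha⟩ := iha hx
      obtain ⟨t, ht, hb⟩ := ihb hy
      exact ⟨s + t + 1, by simp only [Expr.size]; omega, .pair ha hb⟩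
    · simp at h
  | fst a iha =>
    intro env v h
    simp only [pev] at h
    split at h
    · rename_i x y hx
      simp only [Option.some.injEq] at h; subst h
      obtain ⟨s, hs, ha⟩ := iha hx
      exact ⟨s + 1, by simp only [Expr.size]; omega, .fst ha⟩
    · simp at h
  | snd a iha =>
    intro env v h
    simp only [pev] at h
    split at h
    · rename_i x y hx
      simp only [Option.some.injEq] at h; subst h
      obtain ⟨s, hs, ha⟩ := iha hx
      exact ⟨s + 1, by simp only [Expr.size]; omega, .snd ha⟩
    · simp at h
  | ifPair a b c iha ihb ihc =>
    intro env v h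
    simp only [pev] at h
    split at h
    · rename_i x y hx
      obtain ⟨s, hs, ha⟩ := iha hx
      obtain ⟨t, ht, hb⟩ := ihb h
      exact ⟨s + t + 1, by simp only [Expr.size]; omega, .ifPair_pair ha hb⟩
    · rename_i hx
      obtain ⟨s, hs, ha⟩ := iha hx
      obtain ⟨t, ht, hb⟩ := ihc h
      exact ⟨s + t + 1, by simp only [Expr.size]; omega, .ifPair_nil ha hb⟩
    · rename_i x hx
      obtain ⟨s, hs, ha⟩ := iha hx
      obtain ⟨t, ht, hb⟩ := ihc h
      exact ⟨s + t + 1, by simp only [Expr.size]; omega, .ifPair_num ha hb⟩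
    · simp at h
  | ifLt a b c d iha ihb ihc ihd =>
    intro env v h
    simp only [pev] at h
    split at h
    · rename_i x y hx hy
      obtain ⟨s, hs, ha⟩ := iha hx
      obtain ⟨t, ht, hb⟩ := ihb hy
      split_ifs at h with hlt
      · obtain ⟨r, hr, hc⟩ := ihc h
        exact ⟨s + t + r + 1, by simp only [Expr.size]; omega, .ifLt_true ha hb hlt hc⟩
      · obtain ⟨r, hr, hd⟩ := ihd h
        exact ⟨s + t + r + 1, by simp only [Expr.size]; omega, .ifLt_false ha hb hlt hd⟩
    · simp at h
  | bind a b iha ihb =>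
    intro env v h
    simp only [pev] at h
    split at h
    · rename_i x hx
      obtain ⟨s, hs, ha⟩ := iha hx
      obtain ⟨t, ht, hb⟩ := ihb h
      exact ⟨s + t + 1, by simp only [Expr.size]; omega, .bind ha hb⟩
    · simp at h
  | call f a _ => intro env v h; simp [pev] at h

section rules

variable {F : List Expr} {env : List Val}

theorem Ev.pure {e : Expr} {v : Val} {t : ℕ} (h : pev env e = some v) (ht : e.size ≤ t) :
    Ev F env e v t := (Ev.of_pev h).mono ht

theorem Ev.pair {e₁ e₂ : Expr} {a b : Val} {s t : ℕ} (h₁ : Ev F env e₁ a s)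
    (h₂ : Ev F env e₂ b t) : Ev F env (.pair e₁ e₂) (.pair a b) (s + t + 1) := by
  obtain ⟨s', hs, h₁⟩ := h₁
  obtain ⟨t', ht, h₂⟩ := h₂
  exact ⟨s' + t' + 1, by omega, .pair h₁ h₂⟩

theorem Ev.fst {e : Expr} {a b : Val} {s : ℕ} (h : Ev F env e (.pair a b) s) :
    Ev F env (.fst e) a (s + 1) := by
  obtain ⟨s', hs, h⟩ := h
  exact ⟨s' + 1, by omega, .fst h⟩

theorem Ev.bind {e e₁ : Expr} {a v : Val} {s t : ℕ} (h₁ : Ev F env e a s)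
    (h₂ : Ev F (a :: env) e₁ v t) : Ev F env (.bind e e₁) v (s + t + 1) := by
  obtain ⟨s', hs, h₁⟩ := h₁
  obtain ⟨t', ht, h₂⟩ := h₂
  exact ⟨s' + t' + 1, by omega, .bind h₁ h₂⟩

theorem Ev.call {f : ℕ} {e body : Expr} {a v : Val} {s t : ℕ} (h₁ : Ev F env e a s)
    (hf : F[f]? = some body) (h₂ : Ev F [a] body v t) :
    Ev F env (.call f e) v (s + t + 1) := by
  obtain ⟨s', hs, h₁⟩ := h₁
  obtain ⟨t', ht, h₂⟩ := h₂
  exact ⟨s' + t' + 1, by omega, .call h₁ hf h₂⟩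

theorem Ev.ifPair_pos {e e₁ e₂ : Expr} {a b v : Val} {s t : ℕ} (h₁ : Ev F env e (.pair a b) s)
    (h₂ : Ev F env e₁ v t) : Ev F env (.ifPair e e₁ e₂) v (s + t + 1) := by
  obtain ⟨s', hs, h₁⟩ := h₁
  obtain ⟨t', ht, h₂⟩ := h₂
  exact ⟨s' + t' + 1, by omega, .ifPair_pair h₁ h₂⟩

theorem Ev.ifPair_nil {e e₁ e₂ : Expr} {v : Val} {s t : ℕ} (h₁ : Ev F env e .nil s)
    (h₂ : Ev F env e₂ v t) : Ev F env (.ifPair e e₁ e₂) v (s + t + 1) := by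
  obtain ⟨s', hs, h₁⟩ := h₁
  obtain ⟨t', ht, h₂⟩ := h₂
  exact ⟨s' + t' + 1, by omega, .ifPair_nil h₁ h₂⟩

theorem Ev.ifLt_pos {a b e₁ e₂ : Expr} {x y : ℝ} {v : Val} {s t r : ℕ}
    (h₁ : Ev F env a (.num x) s) (h₂ : Ev F env b (.num y) t) (h : x < y)
    (h₃ : Ev F env e₁ v r) : Ev F env (.ifLt a b e₁ e₂) v (s + t + r + 1) := by
  obtain ⟨s', hs, h₁⟩ := h₁
  obtain ⟨t', ht, h₂⟩ := h₂
  obtain ⟨r', hr, h₃⟩ := h₃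
  exact ⟨s' + t' + r' + 1, by omega, .ifLt_true h₁ h₂ h h₃⟩

theorem Ev.ifLt_neg {a b e₁ e₂ : Expr} {x y : ℝ} {v : Val} {s t r : ℕ}
    (h₁ : Ev F env a (.num x) s) (h₂ : Ev F env b (.num y) t) (h : ¬ x < y)
    (h₃ : Ev F env e₂ v r) : Ev F env (.ifLt a b e₁ e₂) v (s + t + r + 1) := by
  obtain ⟨s', hs, h₁⟩ := h₁
  obtain ⟨t', ht, h₂⟩ := h₂
  obtain ⟨r', hr, h₃⟩ := h₃
  exact ⟨s' + t' + r' + 1, by omega, .ifLt_false h₁ h₂ h h₃⟩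

end rules

/-! ### The program -/

namespace Expr

/-- The height of a tree. -/
def ht (e : Expr) : Expr := .ifPair e.fst e.fst.fst (.const 0)

/-- The leftmost leaf of a tree. -/
def firstLeaf (e : Expr) : Expr := .ifPair e.fst e.fst.snd.fst e.snd

/-- The rightmost leaf of a tree. -/
def lastLeaf (e : Expr) : Expr := .ifPair e.fst e.fst.snd.snd e.snd

/-- The left subtree. -/
def left (e : Expr) : Expr := e.snd.fst

/-- The right subtree. -/
def right (e : Expr) : Expr := e.snd.snd

def mk2 (f : ℕ) (a b : Expr) : Expr := .call f (.pair a b)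

/-- Tests answer with a pair or with null, so that `ifPair` can branch on the answer. -/
def yes : Expr := .pair .nil .nil

def orientE (a b c : Expr) : Expr :=
  .sub (.mul (.sub b.fst a.fst) (.sub c.snd a.snd)) (.mul (.sub b.snd a.snd) (.sub c.fst a.fst))

def dotE (a b : Expr) : Expr := .add (.mul a.fst b.fst) (.mul a.snd b.snd)

def subE (a b : Expr) : Expr := .pair (.sub a.fst b.fst) (.sub a.snd b.snd)

def negE (a : Expr) : Expr := .pair (.sub (.const 0) a.fst) (.sub (.const 0) a.snd)

/-- The coordinates of `p` in the frame `u`. -/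
def rotE (u p : Expr) : Expr := .pair (dotE u p)
  (.sub (.mul u.fst p.snd) (.mul u.snd p.fst))

/-- The slope of the line through two points. -/
def slopeE (a b : Expr) : Expr := .div (.sub b.snd a.snd) (.sub b.fst a.fst)

end Expr

open OnionUnion.Expr

/-- Constructs an inner node from its two subtrees. -/
def mkBody : Expr :=
  .pair (.pair (.ifLt (ht (fst (var 0))) (ht (snd (var 0)))
      (.add (ht (snd (var 0))) (.const 1)) (.add (ht (fst (var 0))) (.const 1)))
    (.pair (firstLeaf (fst (var 0))) (lastLeaf (snd (var 0)))))
    (.pair (fst (var 0)) (snd (var 0)))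

/-- Joins two trees whose heights differ by at most two. -/
def balBody : Expr :=
  let l := fst (var 0)
  let r := snd (var 0)
  .ifLt (.add (ht r) (.const 1)) (ht l)
    (.ifLt (ht l.left) (ht l.right)
      (mk2 0 (mk2 0 l.left l.right.left) (mk2 0 l.right.right r))
      (mk2 0 l.left (mk2 0 l.right r)))
    (.ifLt (.add (ht l) (.const 1)) (ht r)
      (.ifLt (ht r.right) (ht r.left)
        (mk2 0 (mk2 0 l r.left.left) (mk2 0 r.left.right r.right))
        (mk2 0 (mk2 0 l r.left) r.right))
      (mk2 0 l r))

/-- Joins two trees. -/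
def joinBody : Expr :=
  let l := fst (var 0)
  let r := snd (var 0)
  .ifLt (.add (ht r) (.const 1)) (ht l)
    (mk2 1 l.left (mk2 2 l.right r))
    (.ifLt (.add (ht l) (.const 1)) (ht r)
      (mk2 1 (mk2 2 l r.left) r.right)
      (mk2 0 l r))

/-- Joins two possibly empty trees. -/
def catBody : Expr :=
  .ifPair (fst (var 0)) (.ifPair (snd (var 0)) (.call 2 (var 0)) (fst (var 0))) (snd (var 0))

/-- Splits a tree by a test of its leaves, with parameters. -/
def splitBody (self : ℕ) (test : Expr) : Expr :=
  .ifPair (fst (fst (var 0)))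
    (.bind (firstLeaf (right (fst (var 0))))
      (.ifPair test
        (.bind (mk2 self (right (fst (var 1))) (snd (var 1)))
          (.pair (mk2 2 (left (fst (var 2))) (fst (var 0))) (snd (var 0))))
        (.bind (mk2 self (left (fst (var 1))) (snd (var 1)))
          (.pair (fst (var 0)) (mk2 3 (snd (var 0)) (right (fst (var 2))))))))
    (.pair (fst (var 0)) .nil)

/-- The parameters are the first leaf `a` and a target `x`. On a convex polygon listed from `a`, a
vertex `p ≠ a` comes before `x` iff `a`, `p`, `x` make a left turn. -/
def beforeTest : Expr :=
  .ifLt (.const 0) (orientE (fst (snd (var 1))) (var 0) (snd (snd (var 1)))) yes .nil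

/-- The parameters are the first leaf `a` and the last vertex `y` to be kept; vertices after `y` are
strictly to the left of `a y`. For `a = y` all orientations vanish. This case is detected by the
squared distance, and then nothing but `a` is kept. -/
def afterTest : Expr :=
  .ifLt (.const 0) (dotE (subE (fst (snd (var 1))) (snd (snd (var 1))))
      (subE (fst (snd (var 1))) (snd (snd (var 1)))))
    (.ifLt (.const 0) (orientE (fst (snd (var 1))) (snd (snd (var 1))) (var 0)) .nil yes) .nil

/-- Decides whether `(α, β)` is lexicographically positive, with strict comparisons as the only
primitive. -/
def cmpBody (α β : Expr) : Expr :=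
  .ifLt (.const 0) α yes (.ifLt α (.const 0) .nil (.ifLt (.const 0) β yes .nil))

def cmpLexBody : Expr :=
  let p := fst (var 0)
  let q := fst (snd (var 0))
  let f := fst (snd (snd (var 0)))
  let g := snd (snd (snd (var 0)))
  cmpBody (dotE f (subE q p)) (dotE g (subE q p))

/-- The second component decides between points in the same direction from `x`: it is positive if
`q` is on the same side of `p` as `x`, so the more distant point comes first. -/
def cmpAngRBody : Expr :=
  let p := fst (var 0)
  let q := fst (snd (var 0))
  let x := snd (snd (var 0))
  cmpBody (orientE x p q) (dotE (subE q p) (subE x p))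

def cmpAngLBody : Expr :=
  let p := fst (var 0)
  let q := fst (snd (var 0))
  let x := snd (snd (var 0))
  cmpBody (orientE x q p) (dotE (subE q p) (subE x p))

/-- Finds the least leaf of a convex polygon for the order that is decided by `cmp`. -/
def findBody (self cmp : ℕ) : Expr :=
  let T := fst (var 0)
  let par := snd (var 0)
  let a := firstLeaf T.left
  let b := lastLeaf T.left
  let c := firstLeaf T.right
  let d := lastLeaf T.right
  let test := fun p q : Expr => Expr.call cmp (.pair p (.pair q par))
  .ifPair T.fst
    (.ifPair (test b c)
      (.ifPair (test b d) (mk2 self T.left par)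
        (.ifPair (test a d) (mk2 self T.left par) (mk2 self T.right par)))
      (.ifPair (test c a) (mk2 self T.right par)
        (.ifPair (test d a) (mk2 self T.right par) (mk2 self T.left par))))
    T.snd

/-- Rotates a polygon such that it starts at a given vertex. -/
def startAtBody : Expr :=
  let T := fst (var 0)
  let x := snd (var 0)
  .ifLt (.const 0) (dotE (subE (firstLeaf T) x) (subE (firstLeaf T) x))
    (.bind (mk2 4 T (.pair (firstLeaf T) x)) (mk2 3 (snd (var 0)) (fst (var 0)))) T

/-- Cuts a polygon into the path between two given vertices and the rest. -/
def cutBody : Expr :=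
  .bind (mk2 12 (fst (var 0)) (fst (snd (var 0)))) (mk2 5 (var 0) (snd (var 1)))

/-- Rotates a polygon such that it starts at the lexicographically smallest vertex. -/
def normalizeBody : Expr :=
  mk2 12 (var 0) (mk2 9 (var 0)
    (.pair (.pair (.const 1) (.const 0)) (.pair (.const 0) (.const 1))))

/-- The lower chain of a polygon in a given frame. -/
def chainBody : Expr :=
  let T := fst (var 0)
  let u := snd (var 0)
  .bind (mk2 12 T (mk2 9 T (.pair u (.pair (.sub (.const 0) u.snd) u.fst))))
    (let u := snd (var 1)
    .bind (mk2 9 (var 0) (.pair (negE u) (.pair (.sub (.const 0) u.snd) u.fst)))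
      (.fst (mk2 5 (var 1) (.pair (firstLeaf (var 1)) (var 0)))))

/-- The common tangent below two chains that are separated by a vertical line. -/
def bridgeBody : Expr :=
  let A := fst (var 0)
  let B := fst (snd (var 0))
  let u := fst (snd (snd (var 0)))
  .ifPair A.fst
    (.ifPair B.fst
      (.bind (rotE u (lastLeaf A.left))
      (.bind (rotE (fst (snd (snd (var 1)))) (firstLeaf (right (fst (var 1)))))
      (.bind (rotE (fst (snd (snd (var 2)))) (lastLeaf (left (fst (snd (var 2))))))
      (.bind (rotE (fst (snd (snd (var 3)))) (firstLeaf (right (fst (snd (var 3))))))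
      (.bind (slopeE (var 3) (var 2))
      (.bind (slopeE (var 2) (var 1))
        (let A := fst (var 6)
        let B := fst (snd (var 6))
        let uc := snd (snd (var 6))
        let α := Expr.add (snd (var 5)) (.mul (.sub uc.snd (fst (var 5))) (var 1))
        let β := Expr.add (snd (var 3)) (.mul (.sub uc.snd (fst (var 3))) (var 0))
        .ifLt (var 1) (var 0)
          (.ifLt α β (mk2 16 A.right (.pair B uc)) (mk2 16 A (.pair B.left uc)))
          (.ifLt β α (mk2 16 A.left (.pair B uc)) (mk2 16 A (.pair B.right uc))))))))))
      (.pair (mk2 11 A B.snd) B.snd))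
    (.pair A.snd (mk2 10 B A.snd))

/-- The maximum of an optional number and a number. -/
def raiseBody : Expr :=
  .ifPair (fst (var 0))
    (.ifLt (fst (fst (var 0))) (snd (var 0)) (.pair (snd (var 0)) .nil) (fst (var 0)))
    (.pair (snd (var 0)) .nil)

/-- The minimum of an optional number and a number. -/
def lowerBody : Expr :=
  .ifPair (fst (var 0))
    (.ifLt (snd (var 0)) (fst (fst (var 0))) (.pair (snd (var 0)) .nil) (fst (var 0)))
    (.pair (snd (var 0)) .nil)

/-- Decides whether a slope is below the interval from `lo` to `hi`, or inside with test `c`. -/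
def sideE (lo hi s c : Expr) : Expr :=
  let inner : Expr := .ifPair hi (.ifLt s hi.fst c .nil) c
  .ifPair lo (.ifLt lo.fst s inner yes) inner

/-- The slope of the direction in which the vertical gap between an upper chain and a lower
chain is attained. -/
def sepSearchBody : Expr :=
  let A := fst (var 0)
  let B := fst (snd (var 0))
  let lo := fst (snd (snd (var 0)))
  let hi := snd (snd (snd (var 0)))
  let sA := slopeE (lastLeaf A.left) (firstLeaf A.right)
  let sB := slopeE (lastLeaf B.left) (firstLeaf B.right)
  let α := fst (firstLeaf A.right)
  let β := fst (firstLeaf B.right)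
  let go := fun A B lo hi : Expr => Expr.call 19 (.pair A (.pair B (.pair lo hi)))
  .ifPair A.fst
    (.ifPair B.fst
      (.ifLt sA sB
        (.ifLt α β (go A.right B (mk2 17 lo sA) hi) (go A B.left lo (mk2 18 hi sB)))
        (.ifLt β α (go A.left B lo (mk2 18 hi sA)) (go A B.right (mk2 17 lo sB) hi)))
      (.ifPair (sideE lo hi sA (.ifLt α B.snd.fst yes .nil))
        (go A.right B (mk2 17 lo sA) hi) (go A.left B lo (mk2 18 hi sA))))
    (.ifPair B.fst
      (.ifPair (sideE lo hi sB (.ifLt β A.snd.fst .nil yes))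
        (go A B.right (mk2 17 lo sB) hi) (go A B.left lo (mk2 18 hi sB)))
      (.pair
        (.ifLt A.snd.fst B.snd.fst hi.fst
          (.ifPair lo lo.fst (.ifPair hi hi.fst (.const 0))))
        (.pair A.snd B.snd)))

/-- The vertical height of `p` over the line of slope `s` through the origin. -/
def gapE (s p : Expr) : Expr := .sub p.snd (.mul s p.fst)

def halfE (a b : Expr) : Expr := .div (.add a b) (.const 2)

/-- A separating line of two disjoint polygons. -/
def separateBody : Expr :=
  let ltr : Expr := .pair (.const 1) (.const 0)
  let rtl : Expr := .pair (.const (-1)) (.const 0)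
  let ord : Expr := .pair rtl (.pair (.const 0) (.const 1))
  .bind (mk2 9 (fst (var 0)) ord)
  (.bind (mk2 9 (snd (var 1)) ord)
    (let A := fst (var 2)
    let B := snd (var 2)
    .ifLt (fst (var 1)) (fst (firstLeaf B))
      (.pair ltr (halfE (fst (var 1)) (fst (firstLeaf B))))
      (.ifLt (fst (var 0)) (fst (firstLeaf A))
        (.pair rtl (.sub (.const 0) (halfE (fst (var 0)) (fst (firstLeaf A)))))
        (.bind (.call 19 (.pair (mk2 15 A ltr) (.pair (mk2 15 B rtl) (.pair .nil .nil))))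
          (let s := fst (var 0)
          let a := fst (snd (var 0))
          let b := snd (snd (var 0))
          .ifLt (gapE s b) (gapE s a)
            (.pair (.pair s (.const (-1))) (.sub (.const 0) (halfE (gapE s a) (gapE s b))))
            (let A := fst (var 3)
            let B := snd (var 3)
            .bind (.call 19 (.pair (mk2 15 B ltr) (.pair (mk2 15 A rtl) (.pair .nil .nil))))
              (.pair (.pair (.sub (.const 0) s) (.const 1)) (halfE (gapE s a) (gapE s b)))))))))

/-- Restores an onion whose outermost layer is a chain only. -/
def repairBody : Expr :=
  let C := fst (var 0)
  let rest := snd (var 0)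
  let next : Expr :=
    .bind (mk2 11 (fst (snd (var 1))) (firstLeaf (fst (var 1))))
    (.bind (mk2 13 (fst (snd (var 2))) (.pair (var 1) (var 0)))
      (.pair (.call 14 (mk2 3 (fst (var 3)) (fst (var 0))))
        (mk2 21 (snd (var 0)) (snd (snd (var 3))))))
  .ifPair C
    (.ifPair rest
      (.bind (mk2 10 rest.fst (lastLeaf C))
        (.ifPair (fst (fst (var 1)))
          (.ifLt (.const 0) (orientE (lastLeaf (fst (var 1))) (var 0) (firstLeaf (fst (var 1))))
            next (.pair (.call 14 (fst (var 1))) (snd (var 1))))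
          next))
      (.pair (.call 14 C) .nil))
    rest

/-- The union of two onions that are separated by a line. -/
def unionBody : Expr :=
  let us := fst (var 0)
  let vs := fst (snd (var 0))
  let u := fst (snd (snd (var 0)))
  .ifPair us
    (.ifPair vs
      (.bind (mk2 16 (mk2 15 us.fst u) (.pair (mk2 15 vs.fst u) (snd (snd (var 0)))))
      (let us := fst (var 1)
      let vs := fst (snd (var 1))
      let u := fst (snd (snd (var 1)))
      let c := snd (snd (snd (var 1)))
      .bind (mk2 16 (mk2 15 vs.fst (negE u)) (.pair (mk2 15 us.fst (negE u))
        (.pair (negE u) (.sub (.const 0) c))))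
      (let us := fst (var 2)
      .bind (mk2 13 us.fst (.pair (snd (var 0)) (fst (var 1))))
      (.bind (mk2 13 (fst (fst (snd (var 3)))) (.pair (snd (var 2)) (fst (var 1))))
      (let us := fst (var 4)
      let vs := fst (snd (var 4))
      .pair (.call 14 (mk2 3 (fst (var 1)) (fst (var 0))))
        (mk2 22 (mk2 21 (snd (var 1)) us.snd)
          (.pair (mk2 21 (snd (var 0)) vs.snd) (snd (snd (var 4))))))))))
      us)
    vs

/-- The functions of the program. -/
def prog : List Expr :=
  -- The positions are the call numbers: 0 to 3 build and join trees, 4 and 5 split, 6 to 8 compare,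
  -- 9 to 11 search with these comparisons, 12 to 14 rotate and cut polygons, 15 and 16 extract
  -- chains and find bridges, 17 to 20 separate, 21 repairs, 22 unites.
  [mkBody, balBody, joinBody, catBody, splitBody 4 beforeTest, splitBody 5 afterTest,
    cmpLexBody, cmpAngRBody, cmpAngLBody, findBody 9 6, findBody 10 7, findBody 11 8,
    startAtBody, cutBody, normalizeBody, chainBody, bridgeBody, raiseBody, lowerBody,
    sepSearchBody, separateBody, repairBody, unionBody]

/-- The program that computes the union of two onions. -/
def onionUnion : Program where
  funs := prog
  main := .ifPair (fst (var 0))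
    (.ifPair (snd (var 0))
      (.call 22 (.pair (fst (var 0)) (.pair (snd (var 0))
        (mk2 20 (fst (fst (var 0))) (fst (snd (var 0)))))))
      (fst (var 0)))
    (snd (var 0))

/-! ### Balanced trees -/

theorem PTree.toList_ne_nil (t : PTree) : t.toList ≠ [] := by
  induction t with
  | leaf p => simp [PTree.toList]
  | node l r ihl ihr => simp [PTree.toList, ihl]

theorem PTree.head_toList (t : PTree) : t.toList.head t.toList_ne_nil = t.first := by
  induction t with
  | leaf p => simp [PTree.toList, PTree.first]
  | node l r ihl ihr =>
    simp only [PTree.toList, PTree.first]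
    rw [List.head_append_of_ne_nil l.toList_ne_nil, ihl]

theorem PTree.getLast_toList (t : PTree) : t.toList.getLast t.toList_ne_nil = t.last := by
  induction t with
  | leaf p => simp [PTree.toList, PTree.last]
  | node l r ihl ihr =>
    simp only [PTree.toList, PTree.last]
    rw [List.getLast_append_of_ne_nil _ r.toList_ne_nil, ihr]

theorem PTree.head?_toList (t : PTree) : t.toList.head? = some t.first := by
  rw [← t.head_toList, List.head?_eq_some_head]

theorem PTree.toList_eq_cons (t : PTree) : ∃ l, t.toList = t.first :: l :=
  ⟨t.toList.tail, by rw [← t.head_toList, List.cons_head_tail]⟩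

theorem PTree.toList_eq_concat (t : PTree) : ∃ l, t.toList = l ++ [t.last] :=
  ⟨t.toList.dropLast, by rw [← t.getLast_toList, List.dropLast_append_getLast]⟩

theorem PTree.first_mem (t : PTree) : t.first ∈ t.toList := by
  rw [← t.head_toList]; exact List.head_mem _

theorem PTree.last_mem (t : PTree) : t.last ∈ t.toList := by
  rw [← t.getLast_toList]; exact List.getLast_mem _

/-- A weak form of the logarithmic height of AVL trees that avoids Fibonacci numbers. If the
subtrees have heights `k + 1` and `k` and `a` and `b` leaves, then `a ^ 2 ≥ 2 * 2 ^ k` and `b ^ 2 ≥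
2 ^ k` also give `a * b ≥ 2 ^ k`, which is more than enough for `(a + b) ^ 2 ≥ 4 * 2 ^ k`. -/
theorem PTree.two_pow_height_le {t : PTree} (h : t.Balanced) :
    2 ^ t.height ≤ t.toList.length ^ 2 := by
  induction t with
  | leaf p => simp [PTree.height, PTree.toList]
  | node l r ihl ihr =>
    obtain ⟨hl, hr, h1, h2⟩ := h
    have ihl := ihl hl
    have ihr := ihr hr
    simp only [PTree.height, PTree.toList, List.length_append]
    have key : ∀ a b h k : ℕ, 2 ^ h ≤ a ^ 2 → 2 ^ k ≤ b ^ 2 → k ≤ h → h ≤ k + 1 →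
        2 ^ (h + 1) ≤ (a + b) ^ 2 := by
      intro a b h k ha hb hkh hhk
      rcases Nat.eq_or_lt_of_le hkh with rfl | hlt
      · have : 2 ^ (k + 1) = 2 ^ k + 2 ^ k := by ring
        nlinarith [Nat.zero_le (a * b)]
      · obtain rfl : h = k + 1 := by omega
        have e1 : 2 ^ (k + 1) = 2 * 2 ^ k := by ring
        have e2 : 2 ^ (k + 1 + 1) = 4 * 2 ^ k := by ring
        have hab : 2 ^ k ≤ a * b := by
          by_contra! hc
          have : (a * b) ^ 2 < (2 ^ k) ^ 2 := Nat.pow_lt_pow_left hc (by norm_num)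
          have h3 : 2 ^ (k + 1) * 2 ^ k ≤ a ^ 2 * b ^ 2 := Nat.mul_le_mul ha hb
          nlinarith
        nlinarith
    rcases le_total l.height r.height with hle | hle
    · rw [max_eq_right hle, Nat.add_comm l.toList.length]
      exact key _ _ _ _ ihr ihl hle h2
    · rw [max_eq_left hle]
      exact key _ _ _ _ ihl ihr hle h1

theorem PTree.height_lt {t : PTree} (h : t.Balanced) {N : ℕ} (hN : t.toList.length ≤ N) :
    t.height < 2 * (Nat.log 2 N + 1) := by
  have h1 := PTree.two_pow_height_le h
  have h2 : N < 2 ^ (Nat.log 2 N + 1) := Nat.lt_pow_succ_log_self (by norm_num) N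
  have h3 : t.toList.length ^ 2 < (2 ^ (Nat.log 2 N + 1)) ^ 2 :=
    Nat.pow_lt_pow_left (hN.trans_lt h2) (by norm_num)
  rw [← pow_mul] at h3
  have := (Nat.pow_lt_pow_iff_right (a := 2) (by norm_num)).1 (h1.trans_lt h3)
  omega

/-! ### Access to trees in memory -/

section access

variable {env : List Val} {e : Expr} {t l r : PTree}

theorem pev_ht (h : pev env e = some t.encode) : pev env (ht e) = some (.num t.height) := by
  cases t <;> simp [ht, pev, h, PTree.encode, PTree.height]

theorem pev_firstLeaf (h : pev env e = some t.encode) :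
    pev env (firstLeaf e) = some (encodePt t.first) := by
  cases t <;> simp [firstLeaf, pev, h, PTree.encode, PTree.first]

theorem pev_lastLeaf (h : pev env e = some t.encode) :
    pev env (lastLeaf e) = some (encodePt t.last) := by
  cases t <;> simp [lastLeaf, pev, h, PTree.encode, PTree.last]

theorem pev_left (h : pev env e = some (PTree.node l r).encode) :
    pev env e.left = some l.encode := by
  simp [Expr.left, pev, h, PTree.encode]

theorem pev_right (h : pev env e = some (PTree.node l r).encode) :
    pev env e.right = some r.encode := by
  simp [Expr.right, pev, h, PTree.encode]

theorem pev_add {e₁ e₂ : Expr} {x y : ℝ} (h₁ : pev env e₁ = some (.num x))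
    (h₂ : pev env e₂ = some (.num y)) : pev env (.add e₁ e₂) = some (.num (x + y)) := by
  simp [pev, h₁, h₂]

theorem pev_pair {e₁ e₂ : Expr} {x y : Val} (h₁ : pev env e₁ = some x)
    (h₂ : pev env e₂ = some y) : pev env (.pair e₁ e₂) = some (.pair x y) := by
  simp [pev, h₁, h₂]

theorem pev_orientE {a b c : Expr} {p q s : Pt} (h₁ : pev env a = some (encodePt p))
    (h₂ : pev env b = some (encodePt q)) (h₃ : pev env c = some (encodePt s)) :
    pev env (orientE a b c) = some (.num (orient p q s)) := by
  simp [orientE, pev, h₁, h₂, h₃, encodePt, orient]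

theorem PTree.encode_eq_pair (t : PTree) : ∃ a b, t.encode = .pair a b := by
  cases t <;> simp [PTree.encode]

end access

/-! ### Concatenation -/

theorem mk_spec (l r : PTree) {env : List Val} {e₁ e₂ : Expr} {s₁ s₂ : ℕ}
    (h₁ : Ev prog env e₁ l.encode s₁) (h₂ : Ev prog env e₂ r.encode s₂) :
    Ev prog env (mk2 0 e₁ e₂) (PTree.node l r).encode (s₁ + s₂ + 100) := by
  have hh : pev [.pair l.encode r.encode] mkBody = some (PTree.node l r).encode := by
    have h1 : pev [.pair l.encode r.encode] (fst (var 0)) = some l.encode := rfl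
    have h2 : pev [.pair l.encode r.encode] (snd (var 0)) = some r.encode := rfl
    have h3 := pev_ht h1
    have h4 := pev_ht h2
    have h5 := pev_firstLeaf h1
    have h6 := pev_lastLeaf h2
    rw [mkBody]
    generalize hE1 : ht (fst (var 0)) = E1 at *
    generalize hE2 : ht (snd (var 0)) = E2 at *
    simp only [pev, h3, h4, h5, h6, PTree.encode, PTree.first, PTree.last]
    by_cases hlt : l.height < r.height
    · have : (l.height : ℝ) < r.height := by exact_mod_cast hlt
      simp [this, PTree.height, hlt.le]
    · have h' : ¬ (l.height : ℝ) < r.height := by exact_mod_cast hlt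
      simp [h', PTree.height, not_lt.1 hlt]
  exact (Ev.call (Ev.pair h₁ h₂) rfl (Ev.pure hh (t := 90) (by decide))).mono (by omega)

/-- A single or double AVL rotation. The exact height in the case without rotation is recorded
because `join_body_spec` needs it: a join must not be lower than its taller argument. -/
theorem bal_spec {l r : PTree} (hl : l.Balanced) (hr : r.Balanced)
    (h1 : l.height ≤ r.height + 2) (h2 : r.height ≤ l.height + 2) {env : List Val}
    {e₁ e₂ : Expr} {s₁ s₂ : ℕ} (he₁ : Ev prog env e₁ l.encode s₁)
    (he₂ : Ev prog env e₂ r.encode s₂) :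
    ∃ t : PTree, t.Balanced ∧ t.toList = l.toList ++ r.toList ∧
      max l.height r.height ≤ t.height ∧ t.height ≤ max l.height r.height + 1 ∧
      (l.height ≤ r.height + 1 → r.height ≤ l.height + 1 →
        t.height = max l.height r.height + 1) ∧
      Ev prog env (mk2 1 e₁ e₂) t.encode (s₁ + s₂ + 1000) := by
  suffices hs : ∃ t : PTree, t.Balanced ∧ t.toList = l.toList ++ r.toList ∧
      max l.height r.height ≤ t.height ∧ t.height ≤ max l.height r.height + 1 ∧
      (l.height ≤ r.height + 1 → r.height ≤ l.height + 1 →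
        t.height = max l.height r.height + 1) ∧
      Ev prog [.pair l.encode r.encode] balBody t.encode 900 by
    obtain ⟨t, g1, g2, g3, g4, g5, g6⟩ := hs
    exact ⟨t, g1, g2, g3, g4, g5, (Ev.call (Ev.pair he₁ he₂) rfl g6).mono (by omega)⟩
  have p1 : pev [.pair l.encode r.encode] (fst (var 0)) = some l.encode := rfl
  have p2 : pev [.pair l.encode r.encode] (snd (var 0)) = some r.encode := rfl
  have e1 : Ev prog [.pair l.encode r.encode] (fst (var 0)) l.encode 2 := Ev.pure p1 (by decide)
  have e2 : Ev prog [.pair l.encode r.encode] (snd (var 0)) r.encode 2 := Ev.pure p2 (by decide)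
  by_cases c1 : r.height + 1 < l.height
  · have c1' : (r.height : ℝ) + ((1 : ℤ) : ℝ) < l.height := by exact_mod_cast c1
    cases l with
    | leaf p => simp [PTree.height] at c1
    | node ll lr =>
      obtain ⟨hll, hlr, g1, g2⟩ := hl
      simp only [PTree.height] at *
      have el : Ev prog [.pair (PTree.node ll lr).encode r.encode] (left (fst (var 0)))
        ll.encode 4 := Ev.pure (pev_left p1) (by decide)
      have er : Ev prog [.pair (PTree.node ll lr).encode r.encode] (right (fst (var 0)))
        lr.encode 4 := Ev.pure (pev_right p1) (by decide)
      by_cases c2 : ll.height < lr.height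
      · have c2' : (ll.height : ℝ) < lr.height := by exact_mod_cast c2
        cases lr with
        | leaf p => simp [PTree.height] at c2
        | node a b =>
          obtain ⟨ha, hb, g3, g4⟩ := hlr
          simp only [PTree.height] at *
          have ea : Ev prog [.pair (PTree.node ll (PTree.node a b)).encode r.encode]
            (left (right (fst (var 0)))) a.encode 6 :=
              Ev.pure (pev_left (pev_right p1)) (by decide)
          have eb : Ev prog [.pair (PTree.node ll (PTree.node a b)).encode r.encode]
            (right (right (fst (var 0)))) b.encode 6 :=
              Ev.pure (pev_right (pev_right p1)) (by decide)
          refine ⟨.node (.node ll a) (.node b r), ?_, ?_, ?_, ?_, ?_, ?_⟩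
          · simp only [PTree.Balanced, PTree.height]
            refine ⟨⟨hll, ha, ?_, ?_⟩, ⟨hb, hr, ?_, ?_⟩, ?_, ?_⟩ <;> omega
          · simp [PTree.toList]
          · simp only [PTree.height]; omega
          · simp only [PTree.height]; omega
          · simp only [PTree.height]; omega
          · exact (Ev.ifLt_pos (Ev.pure (pev_add (pev_ht p2) rfl) (t := 20) (by decide))
              (Ev.pure (pev_ht p1) (t := 20) (by decide)) c1'
              (Ev.ifLt_pos (Ev.pure (pev_ht (pev_left p1)) (t := 40) (by decide))
                (Ev.pure (pev_ht (pev_right p1)) (t := 40) (by decide)) c2'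
                (mk_spec _ _ (mk_spec _ _ el ea) (mk_spec _ _ eb e2)))).mono (by norm_num)
      · have c2' : ¬ (ll.height : ℝ) < lr.height := by exact_mod_cast c2
        refine ⟨.node ll (.node lr r), ?_, ?_, ?_, ?_, ?_, ?_⟩
        · simp only [PTree.Balanced, PTree.height]
          refine ⟨hll, ⟨hlr, hr, ?_, ?_⟩, ?_, ?_⟩ <;> omega
        · simp [PTree.toList]
        · simp only [PTree.height]; omega
        · simp only [PTree.height]; omega
        · simp only [PTree.height]; omega
        · exact (Ev.ifLt_pos (Ev.pure (pev_add (pev_ht p2) rfl) (t := 20) (by decide))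
            (Ev.pure (pev_ht p1) (t := 20) (by decide)) c1'
            (Ev.ifLt_neg (Ev.pure (pev_ht (pev_left p1)) (t := 40) (by decide))
              (Ev.pure (pev_ht (pev_right p1)) (t := 40) (by decide)) c2'
              (mk_spec _ _ el (mk_spec _ _ er e2)))).mono (by norm_num)
  have c1' : ¬ (r.height : ℝ) + ((1 : ℤ) : ℝ) < l.height := by exact_mod_cast c1
  by_cases c2 : l.height + 1 < r.height
  · have c2' : (l.height : ℝ) + ((1 : ℤ) : ℝ) < r.height := by exact_mod_cast c2
    cases r with
    | leaf p => simp [PTree.height] at c2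
    | node rl rr =>
      obtain ⟨hrl, hrr, g1, g2⟩ := hr
      simp only [PTree.height] at *
      have el : Ev prog [.pair l.encode (PTree.node rl rr).encode] (left (snd (var 0)))
        rl.encode 4 := Ev.pure (pev_left p2) (by decide)
      have er : Ev prog [.pair l.encode (PTree.node rl rr).encode] (right (snd (var 0)))
        rr.encode 4 := Ev.pure (pev_right p2) (by decide)
      by_cases c3 : rr.height < rl.height
      · have c3' : (rr.height : ℝ) < rl.height := by exact_mod_cast c3
        cases rl with
        | leaf p => simp [PTree.height] at c3
        | node a b =>
          obtain ⟨ha, hb, g3, g4⟩ := hrl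
          simp only [PTree.height] at *
          have ea : Ev prog [.pair l.encode (PTree.node (PTree.node a b) rr).encode]
            (left (left (snd (var 0)))) a.encode 6 :=
              Ev.pure (pev_left (pev_left p2)) (by decide)
          have eb : Ev prog [.pair l.encode (PTree.node (PTree.node a b) rr).encode]
            (right (left (snd (var 0)))) b.encode 6 :=
              Ev.pure (pev_right (pev_left p2)) (by decide)
          refine ⟨.node (.node l a) (.node b rr), ?_, ?_, ?_, ?_, ?_, ?_⟩
          · simp only [PTree.Balanced, PTree.height]
            refine ⟨⟨hl, ha, ?_, ?_⟩, ⟨hb, hrr, ?_, ?_⟩, ?_, ?_⟩ <;> omega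
          · simp [PTree.toList]
          · simp only [PTree.height]; omega
          · simp only [PTree.height]; omega
          · simp only [PTree.height]; omega
          · exact (Ev.ifLt_neg (Ev.pure (pev_add (pev_ht p2) rfl) (t := 20) (by decide))
              (Ev.pure (pev_ht p1) (t := 20) (by decide)) c1'
              (Ev.ifLt_pos (Ev.pure (pev_add (pev_ht p1) rfl) (t := 20) (by decide))
              (Ev.pure (pev_ht p2) (t := 20) (by decide)) c2'
              (Ev.ifLt_pos (Ev.pure (pev_ht (pev_right p2)) (t := 40) (by decide))
                (Ev.pure (pev_ht (pev_left p2)) (t := 40) (by decide)) c3'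
                (mk_spec _ _ (mk_spec _ _ e1 ea) (mk_spec _ _ eb er))))).mono (by norm_num)
      · have c3' : ¬ (rr.height : ℝ) < rl.height := by exact_mod_cast c3
        refine ⟨.node (.node l rl) rr, ?_, ?_, ?_, ?_, ?_, ?_⟩
        · simp only [PTree.Balanced, PTree.height]
          refine ⟨⟨hl, hrl, ?_, ?_⟩, hrr, ?_, ?_⟩ <;> omega
        · simp [PTree.toList]
        · simp only [PTree.height]; omega
        · simp only [PTree.height]; omega
        · simp only [PTree.height]; omega
        · exact (Ev.ifLt_neg (Ev.pure (pev_add (pev_ht p2) rfl) (t := 20) (by decide))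
            (Ev.pure (pev_ht p1) (t := 20) (by decide)) c1'
            (Ev.ifLt_pos (Ev.pure (pev_add (pev_ht p1) rfl) (t := 20) (by decide))
              (Ev.pure (pev_ht p2) (t := 20) (by decide)) c2'
            (Ev.ifLt_neg (Ev.pure (pev_ht (pev_right p2)) (t := 40) (by decide))
              (Ev.pure (pev_ht (pev_left p2)) (t := 40) (by decide)) c3'
              (mk_spec _ _ (mk_spec _ _ e1 el) er)))).mono (by norm_num)
  have c2' : ¬ (l.height : ℝ) + ((1 : ℤ) : ℝ) < r.height := by exact_mod_cast c2
  refine ⟨.node l r, ⟨hl, hr, not_lt.1 c1, not_lt.1 c2⟩, rfl, ?_, ?_, fun _ _ => rfl, ?_⟩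
  · simp only [PTree.height]; omega
  · simp only [PTree.height]; omega
  · exact (Ev.ifLt_neg (Ev.pure (pev_add (pev_ht p2) rfl) (t := 20) (by decide))
      (Ev.pure (pev_ht p1) (t := 20) (by decide)) c1'
      (Ev.ifLt_neg (Ev.pure (pev_add (pev_ht p1) rfl) (t := 20) (by decide))
        (Ev.pure (pev_ht p2) (t := 20) (by decide)) c2'
        (mk_spec _ _ e1 e2))).mono (by norm_num)

/-- The recursion descends the inner spine of the taller tree until the heights fit. On the way back
the joined subtree has grown by at most one, so a single call of the balancing step suffices on each
level. Only the difference of the heights is paid for, which makes splitting logarithmic. -/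
theorem join_body_spec (n : ℕ) : ∀ {l r : PTree}, l.height + r.height ≤ n → l.Balanced →
    r.Balanced → ∃ t : PTree, t.Balanced ∧ t.toList = l.toList ++ r.toList ∧
      max l.height r.height ≤ t.height ∧ t.height ≤ max l.height r.height + 1 ∧
      Ev prog [.pair l.encode r.encode] joinBody t.encode
        (2000 * (l.height - r.height + (r.height - l.height)) + 2000) := by
  induction n with
  | zero =>
    intro l r hn hl hr
    have c1 : ¬ (r.height : ℝ) + ((1 : ℤ) : ℝ) < l.height := by
      have : ¬ r.height + 1 < l.height := by omega
      exact_mod_cast this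
    have c2 : ¬ (l.height : ℝ) + ((1 : ℤ) : ℝ) < r.height := by
      have : ¬ l.height + 1 < r.height := by omega
      exact_mod_cast this
    have p1 : pev [.pair l.encode r.encode] (fst (var 0)) = some l.encode := rfl
    have p2 : pev [.pair l.encode r.encode] (snd (var 0)) = some r.encode := rfl
    refine ⟨.node l r, ⟨hl, hr, by lia, by lia⟩, rfl, ?_, ?_, ?_⟩
    · simp only [PTree.height]; omega
    · simp only [PTree.height]; omega
    · exact (Ev.ifLt_neg (Ev.pure (pev_add (pev_ht p2) rfl) (t := 20) (by decide))
        (Ev.pure (pev_ht p1) (t := 20) (by decide)) c1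
        (Ev.ifLt_neg (Ev.pure (pev_add (pev_ht p1) rfl) (t := 20) (by decide))
          (Ev.pure (pev_ht p2) (t := 20) (by decide)) c2
          (mk_spec _ _ (Ev.pure p1 le_rfl) (Ev.pure p2 le_rfl)))).mono (by simp [Expr.size])
  | succ n ih =>
    intro l r hn hl hr
    have p1 : pev [.pair l.encode r.encode] (fst (var 0)) = some l.encode := rfl
    have p2 : pev [.pair l.encode r.encode] (snd (var 0)) = some r.encode := rfl
    by_cases c1 : r.height + 1 < l.height
    · have c1' : (r.height : ℝ) + ((1 : ℤ) : ℝ) < l.height := by exact_mod_cast c1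
      cases l with
      | leaf p => simp [PTree.height] at c1
      | node ll lr =>
        obtain ⟨hll, hlr, g1, g2⟩ := hl
        simp only [PTree.height] at *
        obtain ⟨t, ht, htl, k1, k2, k3⟩ := @ih lr r (by omega) hlr hr
        have el : Ev prog [.pair (PTree.node ll lr).encode r.encode] (left (fst (var 0)))
          ll.encode 4 := Ev.pure (pev_left p1) (by decide)
        have er : Ev prog [.pair (PTree.node ll lr).encode r.encode] (right (fst (var 0)))
          lr.encode 4 := Ev.pure (pev_right p1) (by decide)
        obtain ⟨t', ht', htl', m1, m2, m3, m4⟩ := bal_spec hll ht (by omega) (by omega) el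
          (Ev.call (f := 2) (Ev.pair er (Ev.pure p2 (t := 4) (by decide))) rfl k3)
        refine ⟨t', ht', ?_, ?_, ?_, ?_⟩
        · rw [htl', htl]; simp [PTree.toList]
        · omega
        · omega
        · exact (Ev.ifLt_pos (Ev.pure (pev_add (pev_ht p2) rfl) (t := 20) (by decide))
            (Ev.pure (pev_ht p1) (t := 20) (by decide)) c1' m4).mono (by omega)
    have c1' : ¬ (r.height : ℝ) + ((1 : ℤ) : ℝ) < l.height := by exact_mod_cast c1
    by_cases c2 : l.height + 1 < r.height
    · have c2' : (l.height : ℝ) + ((1 : ℤ) : ℝ) < r.height := by exact_mod_cast c2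
      cases r with
      | leaf p => simp [PTree.height] at c2
      | node rl rr =>
        obtain ⟨hrl, hrr, g1, g2⟩ := hr
        simp only [PTree.height] at *
        obtain ⟨t, ht, htl, k1, k2, k3⟩ := @ih l rl (by omega) hl hrl
        have el : Ev prog [.pair l.encode (PTree.node rl rr).encode] (left (snd (var 0)))
          rl.encode 4 := Ev.pure (pev_left p2) (by decide)
        have er : Ev prog [.pair l.encode (PTree.node rl rr).encode] (right (snd (var 0)))
          rr.encode 4 := Ev.pure (pev_right p2) (by decide)
        obtain ⟨t', ht', htl', m1, m2, m3, m4⟩ := bal_spec ht hrr (by omega) (by omega)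
          (Ev.call (f := 2) (Ev.pair (Ev.pure p1 (t := 4) (by decide)) el) rfl k3) er
        refine ⟨t', ht', ?_, ?_, ?_, ?_⟩
        · rw [htl', htl]; simp [PTree.toList]
        · omega
        · omega
        · exact (Ev.ifLt_neg (Ev.pure (pev_add (pev_ht p2) rfl) (t := 20) (by decide))
            (Ev.pure (pev_ht p1) (t := 20) (by decide)) c1'
            (Ev.ifLt_pos (Ev.pure (pev_add (pev_ht p1) rfl) (t := 20) (by decide))
            (Ev.pure (pev_ht p2) (t := 20) (by decide)) c2' m4)).mono (by omega)
    have c2' : ¬ (l.height : ℝ) + ((1 : ℤ) : ℝ) < r.height := by exact_mod_cast c2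
    refine ⟨.node l r, ⟨hl, hr, not_lt.1 c1, not_lt.1 c2⟩, rfl, ?_, ?_, ?_⟩
    · simp only [PTree.height]; omega
    · simp only [PTree.height]; omega
    · exact (Ev.ifLt_neg (Ev.pure (pev_add (pev_ht p2) rfl) (t := 20) (by decide))
        (Ev.pure (pev_ht p1) (t := 20) (by decide)) c1'
        (Ev.ifLt_neg (Ev.pure (pev_add (pev_ht p1) rfl) (t := 20) (by decide))
          (Ev.pure (pev_ht p2) (t := 20) (by decide)) c2'
          (mk_spec _ _ (Ev.pure p1 le_rfl) (Ev.pure p2 le_rfl)))).mono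
            (by simp [Expr.size])

theorem join_spec {l r : PTree} (hl : l.Balanced) (hr : r.Balanced) :
    ∃ t : PTree, t.Balanced ∧ t.toList = l.toList ++ r.toList ∧
      max l.height r.height ≤ t.height ∧ t.height ≤ max l.height r.height + 1 ∧
      Ev prog [.pair l.encode r.encode] joinBody t.encode
        (2000 * (l.height - r.height + (r.height - l.height)) + 2000) :=
  join_body_spec _ le_rfl hl hr

/-- `v` is a balanced tree with list of leaves `L` and height `h`, or null if `L` is empty. -/
def RepH (L : List Pt) (v : Val) (h : ℕ) : Prop :=
  (L = [] ∧ v = .nil ∧ h = 0) ∨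
    ∃ t : PTree, t.Balanced ∧ t.toList = L ∧ v = t.encode ∧ t.height = h

theorem RepH.of_tree {t : PTree} (ht : t.Balanced) : RepH t.toList t.encode t.height :=
  Or.inr ⟨t, ht, rfl, rfl, rfl⟩

/-- Joining to an empty tree is kept apart: the difference of the heights may be large there, but
the second argument is returned at constant cost. The analysis of splitting depends on this. -/
theorem catBody_spec {L₁ L₂ : List Pt} {v₁ v₂ : Val} {h₁ h₂ : ℕ} (H₁ : RepH L₁ v₁ h₁)
    (H₂ : RepH L₂ v₂ h₂) : ∃ v h, RepH (L₁ ++ L₂) v h ∧ max h₁ h₂ ≤ h ∧ h ≤ max h₁ h₂ + 1 ∧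
      (L₁ = [] → h = h₂) ∧
      Ev prog [.pair v₁ v₂] catBody v
        ((if L₁ = [] then 0 else 2000 * (h₁ - h₂ + (h₂ - h₁))) + 2100) := by
  rcases H₁ with ⟨rfl, rfl, rfl⟩ | ⟨t₁, hb₁, rfl, rfl, rfl⟩
  · refine ⟨v₂, h₂, by simpa using H₂, by simp, by simp, fun _ => rfl, ?_⟩
    exact (Ev.ifPair_nil (Ev.pure (v := .nil) rfl (t := 2) (by decide))
      (Ev.pure (v := v₂) rfl (t := 2) (by decide))).mono (by omega)
  obtain ⟨a₁, b₁, e₁⟩ := t₁.encode_eq_pair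
  rw [if_neg t₁.toList_ne_nil]
  rcases H₂ with ⟨rfl, rfl, rfl⟩ | ⟨t₂, hb₂, rfl, rfl, rfl⟩
  · refine ⟨t₁.encode, t₁.height, by simpa using RepH.of_tree hb₁, by simp, by simp,
      fun h => absurd h t₁.toList_ne_nil, ?_⟩
    rw [e₁]
    exact (Ev.ifPair_pos (Ev.pure rfl (t := 2) (by decide))
      (Ev.ifPair_nil (Ev.pure rfl (t := 2) (by decide))
        (Ev.pure rfl (t := 2) (by decide)))).mono (by omega)
  obtain ⟨a₂, b₂, e₂⟩ := t₂.encode_eq_pair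
  obtain ⟨t, ht, htl, k1, k2, k3⟩ := join_spec hb₁ hb₂
  refine ⟨t.encode, t.height, ?_, k1, k2, fun h => absurd h t₁.toList_ne_nil, ?_⟩
  · rw [← htl]; exact RepH.of_tree ht
  · rw [e₁, e₂] at k3 ⊢
    exact (Ev.ifPair_pos (Ev.pure rfl (t := 2) (by decide))
      (Ev.ifPair_pos (Ev.pure rfl (t := 2) (by decide))
        (Ev.call (Ev.pure rfl (t := 2) (by decide)) rfl k3))).mono (by omega)

/-! ### Splitting -/

/-- The flag that is returned by tests. -/
def flag : Bool → Val
  | true => .pair .nil .nil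
  | false => .nil

/-- Splitting a tree by a test `f` of its leaves which is decided by the expression `test`. -/
theorem splitBody_spec {self : ℕ} {test : Expr} (hself : prog[self]? = some (splitBody self test))
    (hsize : test.size ≤ 500) {par : Val} (f : Pt → Bool)
    (hf : ∀ (p : Pt) (w : Val), pev [encodePt p, .pair w par] test = some (flag (f p)))
    {t : PTree} (ht : t.Balanced) : ∀ {a : Pt} {M K : List Pt}, t.toList = a :: (M ++ K) →
      (∀ x ∈ M, f x = true) → (∀ x ∈ K, f x = false) →
    ∃ (t₁ : PTree) (v₂ : Val) (h₂ : ℕ), t₁.Balanced ∧ t₁.toList = a :: M ∧ RepH K v₂ h₂ ∧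
      t₁.height ≤ t.height ∧ h₂ ≤ t.height ∧
      Ev prog [.pair t.encode par] (splitBody self test) (.pair t₁.encode v₂)
        (20000 * t.height + 2000 * (t₁.height + h₂) + 1000) := by
  have hf' : ∀ (p : Pt) (w : Val), Ev prog [encodePt p, .pair w par] test (flag (f p)) 500 :=
    fun p w => Ev.pure (hf p w) hsize
  induction t with
  | leaf p =>
    intro a M K h hM hK
    simp only [PTree.toList, List.cons.injEq, List.nil_eq, List.append_eq_nil_iff] at h
    obtain ⟨rfl, rfl, rfl⟩ := h
    refine ⟨.leaf p, .nil, 0, trivial, rfl, Or.inl ⟨rfl, rfl, rfl⟩, le_rfl, by simp, ?_⟩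
    exact (Ev.ifPair_nil (Ev.pure (v := .nil) rfl (t := 4) (by decide))
      (Ev.pure (v := .pair (PTree.leaf p).encode .nil) rfl (t := 10) (by decide))).mono (by omega)
  | node l r ihl ihr =>
    intro a M K h hM hK
    obtain ⟨hl, hr, g1, g2⟩ := ht
    obtain ⟨l', hl'⟩ := l.toList_eq_cons
    obtain ⟨r', hr'⟩ := r.toList_eq_cons
    simp only [PTree.toList, hl', hr', List.cons_append, List.cons.injEq] at h
    obtain ⟨h1, h⟩ := h
    simp only [PTree.height]
    have p0 : pev [.pair (PTree.node l r).encode par] (fst (var 0)) =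
      some (PTree.node l r).encode := rfl
    have hnode : Ev prog [.pair (PTree.node l r).encode par] (fst (fst (var 0)))
        (.pair (.num ((PTree.node l r).height : ℝ)) (.pair (encodePt (PTree.node l r).first)
          (encodePt (PTree.node l r).last))) 3 := Ev.pure rfl (by decide)
    have hfl : Ev prog [.pair (PTree.node l r).encode par] (firstLeaf (right (fst (var 0))))
        (encodePt r.first) 50 := Ev.pure (pev_firstLeaf (pev_right p0)) (by decide)
    have hT := hf' r.first (PTree.node l r).encode
    -- Along the list the test switches at most once, from true to false, so its value at the first
    -- leaf of the right subtree tells on which side the cut is. The first leaf `a` of the whole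
    -- tree is never tested; the geometric tests would be degenerate there.
    cases hfr : f r.first with
    | true =>
      have hr1 : ∃ M', M = l' ++ r.first :: M' ∧ r' = M' ++ K := by
        rcases List.append_eq_append_iff.1 h with ⟨as, h2, h3⟩ | ⟨bs, h2, h3⟩
        · cases as with
          | nil =>
            simp only [List.nil_append] at h3
            have := hK r.first (by rw [← h3]; simp)
            simp [hfr] at this
          | cons x as =>
            simp only [List.cons_append, List.cons.injEq] at h3
            exact ⟨as, by rw [h2, h3.1], h3.2⟩
        · have := hK r.first (by rw [h3]; simp)
          simp [hfr] at this
      obtain ⟨M', rfl, h4⟩ := hr1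
      obtain ⟨t₁, v₂, h₂, k1, k2, k3, k4, k5, k6⟩ := ihr hr (a := r.first) (M := M') (K := K)
        (by rw [hr', h4]) (fun x hx => hM x (by simp [hx])) hK
      obtain ⟨t, m1, m2, m3, m4, m5⟩ := join_spec hl k1
      refine ⟨t, v₂, h₂, m1, by rw [m2, hl', k2, h1]; simp, k3, by omega, by omega, ?_⟩
      rw [hfr] at hT
      have e1 : Ev prog [encodePt r.first, .pair (PTree.node l r).encode par]
          (mk2 self (right (fst (var 1))) (snd (var 1))) (.pair t₁.encode v₂) _ :=
        Ev.call (Ev.pure (v := .pair r.encode par) rfl (t := 20) (by simp [Expr.size, Expr.right]))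
          hself k6
      have e2 : Ev prog [.pair t₁.encode v₂, encodePt r.first, .pair (PTree.node l r).encode par]
          (mk2 2 (left (fst (var 2))) (fst (var 0))) t.encode _ :=
        Ev.call (Ev.pure (v := .pair l.encode t₁.encode) rfl (t := 20) (by decide)) rfl m5
      -- The heights of the two results act as a potential: the cost of a join is the difference of
      -- two heights, which is the increase of the potential up to a constant, since the height of a
      -- part never exceeds that of its source. The constants are covered by the term in `t.height`.
      exact (Ev.ifPair_pos hnode (Ev.bind hfl (Ev.ifPair_pos hT (Ev.bind e1 (Ev.pair e2
        (Ev.pure (v := v₂) rfl (t := 20) (by decide))))))).mono (by omega)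
    | false =>
      have hr1 : ∃ K', K = K' ++ r.first :: r' ∧ l' = M ++ K' := by
        rcases List.append_eq_append_iff.1 h with ⟨as, h2, h3⟩ | ⟨bs, h2, h3⟩
        · cases as with
          | nil =>
            simp only [List.nil_append] at h3
            exact ⟨[], by simp [h3], by simpa using h2.symm⟩
          | cons x as =>
            simp only [List.cons_append, List.cons.injEq] at h3
            have := hM r.first (by rw [h2, h3.1]; simp)
            simp [hfr] at this
        · exact ⟨bs, h3, h2⟩
      obtain ⟨K', rfl, h4⟩ := hr1
      obtain ⟨t₁, v₂, h₂, k1, k2, k3, k4, k5, k6⟩ := ihl hl (a := a) (M := M) (K := K')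
        (by rw [hl', h4, h1]) hM (fun x hx => hK x (by simp [hx]))
      obtain ⟨v, h', m1, m2, m3, m4, m5⟩ := catBody_spec k3 (RepH.of_tree hr)
      refine ⟨t₁, v, h', k1, k2, by rw [← hr']; exact m1, by omega, by omega, ?_⟩
      rw [hfr] at hT
      have e1 : Ev prog [encodePt r.first, .pair (PTree.node l r).encode par]
          (mk2 self (left (fst (var 1))) (snd (var 1))) (.pair t₁.encode v₂) _ :=
        Ev.call (Ev.pure (v := .pair l.encode par) rfl (t := 20) (by simp [Expr.size, Expr.left]))
          hself k6
      have e2 : Ev prog [.pair t₁.encode v₂, encodePt r.first, .pair (PTree.node l r).encode par]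
          (mk2 3 (snd (var 0)) (right (fst (var 2)))) v _ :=
        Ev.call (Ev.pure (v := .pair v₂ r.encode) rfl (t := 20) (by decide)) rfl m5
      refine (Ev.ifPair_pos hnode (Ev.bind hfl (Ev.ifPair_nil hT (Ev.bind e1 (Ev.pair
        (Ev.pure (v := t₁.encode) rfl (t := 20) (by decide)) e2))))).mono ?_
      -- For empty `K'` the height of the remainder jumps from zero to that of `r`, but nothing is
      -- joined.
      split_ifs with hK'
      · omega
      · omega

/-- `v` is a balanced tree with list of leaves `L`, or null if `L` is empty. -/
def Rep (L : List Pt) (v : Val) : Prop := ∃ h, RepH L v h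

/-- A bound for the heights of trees with at most `N` leaves, up to a factor of two. -/
def lam (N : ℕ) : ℕ := Nat.log 2 N + 1

theorem one_le_lam (N : ℕ) : 1 ≤ lam N := by simp [lam]

theorem RepH.lt {L : List Pt} {v : Val} {h N : ℕ} (H : RepH L v h) (hN : L.length ≤ N) :
    h < 2 * lam N := by
  rcases H with ⟨_, _, rfl⟩ | ⟨t, hb, rfl, _, rfl⟩
  · have := one_le_lam N; omega
  · exact PTree.height_lt hb hN

theorem Rep.exists_tree {L : List Pt} {v : Val} (H : Rep L v) (hL : L ≠ []) :
    ∃ t : PTree, t.Balanced ∧ t.toList = L ∧ v = t.encode := by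
  obtain ⟨h, ⟨rfl, _⟩ | ⟨t, hb, h1, h2, _⟩⟩ := H
  · exact absurd rfl hL
  · exact ⟨t, hb, h1, h2⟩

theorem PTree.rep {t : PTree} (ht : t.Balanced) : Rep t.toList t.encode := ⟨_, RepH.of_tree ht⟩

section

variable {env : List Val} {N : ℕ}

theorem cat_spec {L₁ L₂ : List Pt} {v₁ v₂ : Val} (H₁ : Rep L₁ v₁) (H₂ : Rep L₂ v₂)
    (hN : (L₁ ++ L₂).length ≤ N) {e₁ e₂ : Expr} {s₁ s₂ : ℕ} (he₁ : Ev prog env e₁ v₁ s₁)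
    (he₂ : Ev prog env e₂ v₂ s₂) :
    ∃ v, Rep (L₁ ++ L₂) v ∧ Ev prog env (mk2 3 e₁ e₂) v (s₁ + s₂ + 8000 * lam N) := by
  obtain ⟨h₁, H₁⟩ := H₁
  obtain ⟨h₂, H₂⟩ := H₂
  simp only [List.length_append] at hN
  have g1 := H₁.lt (N := N) (by omega)
  have g2 := H₂.lt (N := N) (by omega)
  have g3 := one_le_lam N
  obtain ⟨v, h, k1, k2, k3, k4, k5⟩ := catBody_spec H₁ H₂
  refine ⟨v, ⟨h, k1⟩, (Ev.call (f := 3) (Ev.pair he₁ he₂) rfl k5).mono ?_⟩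
  split_ifs <;> omega

end

/-! ### Convex polygons -/

/-- Any three points of the list make a left turn. -/
def Ccw (L : List Pt) : Prop := ∀ a b c, [a, b, c].Sublist L → 0 < orient a b c

theorem orient_rotate (a b c : Pt) : orient b c a = orient a b c := by
  simp only [orient]; ring

theorem orient_swap (a b c : Pt) : orient a c b = -orient a b c := by
  simp only [orient]; ring

theorem orient_self_left (a b : Pt) : orient a a b = 0 := by simp only [orient]; ring

theorem orient_self_right (a b : Pt) : orient a b b = 0 := by simp only [orient]; ring

theorem orient_self_outer (a b : Pt) : orient a b a = 0 := by simp only [orient]; ring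

theorem Ccw.sublist {L L' : List Pt} (h : Ccw L) (hL : L'.Sublist L) : Ccw L' :=
  fun a b c hs => h a b c (hs.trans hL)

/-- Moving a block from the front to the back rotates every triple cyclically, and orientation is
invariant under that. -/
theorem Ccw.append_comm {L₁ L₂ : List Pt} (h : Ccw (L₁ ++ L₂)) : Ccw (L₂ ++ L₁) := by
  intro a b c hs
  obtain ⟨l₁, l₂, h1, h2, h3⟩ := List.sublist_append_iff.1 hs
  rcases l₁ with _ | ⟨x, _ | ⟨y, _ | ⟨z, l₁⟩⟩⟩
  · simp only [List.nil_append] at h1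
    exact h a b c ((h1 ▸ h3).trans (List.sublist_append_left _ _))
  · simp only [List.cons_append, List.nil_append, List.cons.injEq] at h1
    obtain ⟨rfl, rfl⟩ := h1
    rw [← orient_rotate]
    exact h b c a (h3.append h2)
  · simp only [List.cons_append, List.nil_append, List.cons.injEq] at h1
    obtain ⟨rfl, rfl, rfl⟩ := h1
    rw [← orient_rotate, ← orient_rotate]
    exact h c a b (h3.append h2)
  · simp only [List.cons_append, List.cons.injEq, List.nil_eq, List.append_eq_nil_iff] at h1
    obtain ⟨rfl, rfl, rfl, rfl, rfl⟩ := h1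
    exact h a b c (h2.trans (List.sublist_append_right _ _))

theorem Ccw.isRotated {L L' : List Pt} (h : Ccw L) (hr : L ~r L') : Ccw L' := by
  obtain ⟨n, rfl⟩ := hr
  rw [List.rotate_eq_drop_append_take_mod]
  apply Ccw.append_comm
  rwa [List.take_append_drop]

theorem isRotated_append_comm {α : Type*} (l l' : List α) : (l ++ l') ~r (l' ++ l) :=
  List.isRotated_append

theorem dot_self_pos {a b : Pt} (h : a ≠ b) :
    0 < (a.1 - b.1) * (a.1 - b.1) + (a.2 - b.2) * (a.2 - b.2) := by
  by_contra! hc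
  apply h
  have h1 := mul_self_nonneg (a.1 - b.1)
  have h2 := mul_self_nonneg (a.2 - b.2)
  have e1 : (a.1 - b.1) * (a.1 - b.1) = 0 := by linarith
  have e2 : (a.2 - b.2) * (a.2 - b.2) = 0 := by linarith
  exact Prod.ext (sub_eq_zero.1 (mul_self_eq_zero.1 e1)) (sub_eq_zero.1 (mul_self_eq_zero.1 e2))

section

variable {env : List Val} {N : ℕ}

theorem pev_dist {e₁ e₂ : Expr} {a b : Pt} (h₁ : pev env e₁ = some (encodePt a))
    (h₂ : pev env e₂ = some (encodePt b)) : pev env (dotE (subE e₁ e₂) (subE e₁ e₂)) =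
      some (.num ((a.1 - b.1) * (a.1 - b.1) + (a.2 - b.2) * (a.2 - b.2))) := by
  simp [dotE, subE, pev, h₁, h₂, encodePt]

open Classical in
theorem splitBefore_spec {a x : Pt} {M K : List Pt} {v : Val} (H : Rep (a :: (M ++ x :: K)) v)
    (hc : Ccw (a :: (M ++ x :: K))) (hN : (a :: (M ++ x :: K)).length ≤ N)
    {e₁ e₂ : Expr} {s₁ s₂ : ℕ} (he₁ : Ev prog env e₁ v s₁)
    (he₂ : Ev prog env e₂ (.pair (encodePt a) (encodePt x)) s₂) :
    ∃ v₁ v₂, Rep (a :: M) v₁ ∧ Rep (x :: K) v₂ ∧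
      Ev prog env (mk2 4 e₁ e₂) (.pair v₁ v₂) (s₁ + s₂ + 60000 * lam N) := by
  obtain ⟨t, hb, htl, rfl⟩ := H.exists_tree (by simp)
  obtain ⟨t₁, v₂, h₂, k1, k2, k3, k4, k5, k6⟩ := splitBody_spec (self := 4) (test := beforeTest)
    rfl (by decide) (par := .pair (encodePt a) (encodePt x))
    (fun p => decide (0 < orient a p x))
    (fun p w => by
      have := pev_orientE (env := [encodePt p, .pair w (.pair (encodePt a) (encodePt x))])
        (a := fst (snd (var 1))) (b := var 0) (c := snd (snd (var 1)))
        (p := a) (q := p) (s := x) rfl rfl rfl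
      by_cases hp : 0 < orient a p x <;>
        simp [beforeTest, pev, this, hp, flag, yes])
    hb htl
    (fun p hp => by
      simp only [decide_eq_true_eq]
      exact hc a p x (List.Sublist.cons_cons a
        ((List.singleton_sublist.2 hp).append (by simp))))
    (fun p hp => by
      simp only [decide_eq_false_iff_not]
      rcases List.mem_cons.1 hp with rfl | hp
      · simp [orient_self_right]
      · have := hc a x p (List.Sublist.cons_cons a (((List.singleton_sublist.2 hp).cons_cons
          x).trans (List.sublist_append_right _ _)))
        rw [orient_swap] at this
        linarith)
  refine ⟨_, v₂, k2 ▸ PTree.rep k1, ⟨_, k3⟩,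
    (Ev.call (f := 4) (Ev.pair he₁ he₂) rfl k6).mono ?_⟩
  have g1 : t.height < 2 * lam N := PTree.height_lt hb (by rw [htl]; exact hN)
  have g2 := one_le_lam N
  omega

open Classical in
theorem splitAfter_spec {a y : Pt} {M K : List Pt} {v : Val} (H : Rep (a :: M ++ K) v)
    (hy : (a :: M).getLast (by simp) = y) (hnd : (a :: M ++ K).Nodup)
    (hc : Ccw (a :: M ++ K)) (hN : (a :: M ++ K).length ≤ N)
    {e₁ e₂ : Expr} {s₁ s₂ : ℕ} (he₁ : Ev prog env e₁ v s₁)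
    (he₂ : Ev prog env e₂ (.pair (encodePt a) (encodePt y)) s₂) :
    ∃ v₁ v₂, Rep (a :: M) v₁ ∧ Rep K v₂ ∧
      Ev prog env (mk2 5 e₁ e₂) (.pair v₁ v₂) (s₁ + s₂ + 60000 * lam N) := by
  obtain ⟨t, hb, htl, rfl⟩ := H.exists_tree (by simp)
  have hMy : M = [] ∧ y = a ∨ ∃ M', M = M' ++ [y] ∧ y ≠ a := by
    rcases List.eq_nil_or_concat M with rfl | ⟨M', b, rfl⟩
    · left; simpa [eq_comm] using hy
    · right
      have hby : b = y := by simpa using hy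
      subst hby
      refine ⟨M', List.concat_eq_append, ?_⟩
      rintro rfl
      simp at hnd
  obtain ⟨t₁, v₂, h₂, k1, k2, k3, k4, k5, k6⟩ := splitBody_spec (self := 5) (test := afterTest)
    rfl (by decide) (par := .pair (encodePt a) (encodePt y))
    (fun p => decide (a ≠ y ∧ ¬ 0 < orient a y p))
    (fun p w => by
      have h1 := pev_orientE (env := [encodePt p, .pair w (.pair (encodePt a) (encodePt y))])
        (a := fst (snd (var 1))) (c := var 0) (b := snd (snd (var 1)))
        (p := a) (q := y) (s := p) rfl rfl rfl
      have h2 := pev_dist (env := [encodePt p, .pair w (.pair (encodePt a) (encodePt y))])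
        (e₁ := fst (snd (var 1))) (e₂ := snd (snd (var 1))) (a := a) (b := y) rfl rfl
      rw [afterTest]
      by_cases hay : a = y
      · subst hay
        generalize dotE _ _ = E at h2
        simp [pev, h2, flag]
      · have := dot_self_pos hay
        generalize dotE _ _ = E at h2
        by_cases hp : 0 < orient a y p <;> simp [pev, h1, h2, hp, flag, yes, hay, this])
    hb (a := a) (M := M) (K := K) (by simpa using htl)
    (fun p hp => by
      simp only [decide_eq_true_eq]
      rcases hMy with ⟨rfl, _⟩ | ⟨M', rfl, hya⟩
      · simp at hp
      refine ⟨hya.symm, ?_⟩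
      rcases List.mem_append.1 hp with hp | hp
      · have := hc a p y (List.Sublist.cons_cons a
          (((List.singleton_sublist.2 hp).append (List.Sublist.refl [y])).trans
            (List.sublist_append_left _ _)))
        rw [orient_swap] at this
        linarith
      · simp only [List.mem_singleton] at hp
        simp [hp, orient_self_right])
    (fun p hp => by
      simp only [decide_eq_false_iff_not, not_and, not_not]
      intro hay
      rcases hMy with ⟨rfl, h⟩ | ⟨M', rfl, hya⟩
      · exact absurd h.symm hay
      · exact hc a y p (List.Sublist.cons_cons a
          ((List.sublist_append_right M' [y]).append (List.singleton_sublist.2 hp))))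
  refine ⟨_, v₂, k2 ▸ PTree.rep k1, ⟨_, k3⟩,
    (Ev.call (f := 5) (Ev.pair he₁ he₂) rfl k6).mono ?_⟩
  have g1 : t.height < 2 * lam N := PTree.height_lt hb (by rw [htl]; exact hN)
  have g2 := one_le_lam N
  omega

theorem startAt_spec {x : Pt} {L : List Pt} {v : Val} (H : Rep L v) (hx : x ∈ L)
    (hc : Ccw L) (hN : L.length ≤ N)
    {e₁ e₂ : Expr} {s₁ s₂ : ℕ} (he₁ : Ev prog env e₁ v s₁)
    (he₂ : Ev prog env e₂ (encodePt x) s₂) :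
    ∃ K w, (x :: K) ~r L ∧ Rep (x :: K) w ∧
      Ev prog env (mk2 12 e₁ e₂) w (s₁ + s₂ + 80000 * lam N) := by
  obtain ⟨t, hb, htl, rfl⟩ := H.exists_tree (List.ne_nil_of_mem hx)
  obtain ⟨L', hL'⟩ := t.toList_eq_cons
  have g2 := one_le_lam N
  have p1 : pev [.pair t.encode (encodePt x)] (fst (var 0)) = some t.encode := rfl
  have hd := pev_dist (env := [.pair t.encode (encodePt x)]) (e₁ := firstLeaf (fst (var 0)))
    (e₂ := snd (var 0)) (pev_firstLeaf p1) (b := x) rfl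
  by_cases hfx : t.first = x
  · refine ⟨L', t.encode, ?_, ?_, ?_⟩
    · rw [← htl, hL', hfx]
    · rw [← hfx, ← hL']; exact PTree.rep hb
    · refine (Ev.call (f := 12) (Ev.pair he₁ he₂) rfl (Ev.ifLt_neg
        (Ev.pure (v := .num ((0 : ℤ) : ℝ)) rfl (t := 1) (by decide)) (Ev.pure hd le_rfl) ?_
        (Ev.pure p1 le_rfl))).mono ?_
      · simp [hfx]
      · simp [Expr.size, dotE, subE, firstLeaf]; omega
  · have hx' : x ∈ L' := by
      rw [← htl, hL'] at hx
      rcases List.mem_cons.1 hx with h | h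
      · exact absurd h.symm hfx
      · exact h
    obtain ⟨M, K, rfl⟩ := List.append_of_mem hx'
    rw [← htl, hL'] at hc hN
    obtain ⟨v₁, v₂, r1, r2, r3⟩ := splitBefore_spec (env := [.pair t.encode (encodePt x)])
      (hL' ▸ PTree.rep hb) hc hN (Ev.pure p1 (t := 10) (by decide))
      (Ev.pure (pev_pair (e₂ := snd (var 0)) (pev_firstLeaf p1) rfl) (t := 50) (by decide))
    obtain ⟨w, q1, q2⟩ := cat_spec (N := N)
      (env := [.pair v₁ v₂, .pair t.encode (encodePt x)]) (e₁ := snd (var 0)) (e₂ := fst (var 0))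
      r2 r1 (by simp at hN ⊢; omega) (Ev.pure rfl (t := 10) (by decide))
      (Ev.pure rfl (t := 10) (by decide))
    refine ⟨K ++ t.first :: M, w, ?_, by simpa using q1, ?_⟩
    · rw [← htl, hL']
      simpa using isRotated_append_comm (x :: K) (t.first :: M)
    · refine (Ev.call (f := 12) (Ev.pair he₁ he₂) rfl (Ev.ifLt_pos
        (Ev.pure (v := .num ((0 : ℤ) : ℝ)) rfl (t := 1) (by decide)) (Ev.pure hd le_rfl) ?_
        (Ev.bind r3 q2))).mono ?_
      · simpa using dot_self_pos hfx
      · simp [Expr.size, dotE, subE, firstLeaf]; omega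

theorem cut_spec {x y : Pt} {L : List Pt} {v : Val} (H : Rep L v) (hx : x ∈ L) (hy : y ∈ L)
    (hnd : L.Nodup) (hc : Ccw L) (hN : L.length ≤ N)
    {e₁ e₂ : Expr} {s₁ s₂ : ℕ} (he₁ : Ev prog env e₁ v s₁)
    (he₂ : Ev prog env e₂ (.pair (encodePt x) (encodePt y)) s₂) :
    ∃ M K w₁ w₂, (x :: M ++ K) ~r L ∧ (x :: M).getLast (by simp) = y ∧ Rep (x :: M) w₁ ∧
      Rep K w₂ ∧ Ev prog env (mk2 13 e₁ e₂) (.pair w₁ w₂) (s₁ + s₂ + 150000 * lam N) := by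
  have g2 := one_le_lam N
  obtain ⟨K, w, k1, k2, k3⟩ := startAt_spec
    (env := [.pair v (.pair (encodePt x) (encodePt y))]) (e₁ := fst (var 0))
    (e₂ := fst (snd (var 0))) H hx hc hN (Ev.pure rfl (t := 10) (by decide))
    (Ev.pure rfl (t := 10) (by decide))
  have hsp : ∃ M K', K = M ++ K' ∧ (x :: M).getLast (by simp) = y := by
    rcases List.mem_cons.1 (k1.mem_iff.2 hy) with rfl | h
    · exact ⟨[], K, rfl, rfl⟩
    · obtain ⟨M, K', rfl⟩ := List.append_of_mem h
      exact ⟨M ++ [y], K', by simp, by simp⟩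
  obtain ⟨M, K', rfl, hl⟩ := hsp
  have hl' : (x :: (M ++ K')).length ≤ N := by rw [k1.perm.length_eq]; exact hN
  obtain ⟨w₁, w₂, q1, q2, q3⟩ := splitAfter_spec (N := N) (a := x) (M := M) (K := K')
    (env := [w, .pair v (.pair (encodePt x) (encodePt y))]) (e₁ := var 0) (e₂ := snd (var 1))
    (by simpa using k2) hl (by simpa using k1.nodup_iff.2 hnd)
    (by simpa using hc.isRotated k1.symm) (by simpa using hl')
    (Ev.pure rfl (t := 10) (by decide)) (Ev.pure rfl (t := 10) (by decide))
  exact ⟨M, K', w₁, w₂, by simpa using k1, hl, q1, q2,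
    (Ev.call (f := 13) (Ev.pair he₁ he₂) rfl (Ev.bind k3 q3)).mono (by omega)⟩

end

/-! ### Finding the least vertex of a convex polygon -/

/-- The keys of the points on the list do not alternate. -/
def Unimodal (key : Pt → ℝ ×ₗ ℝ) (L : List Pt) : Prop :=
  ∀ a b c d, [a, b, c, d].Sublist L →
    ¬ (key a < key b ∧ key a < key d ∧ key c < key b ∧ key c < key d) ∧
    ¬ (key b < key a ∧ key b < key c ∧ key d < key a ∧ key d < key c)

theorem PTree.sublist_first_last {t : PTree} {x : Pt} (hx : x ∈ t.toList) (h1 : x ≠ t.first)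
    (h2 : x ≠ t.last) : [t.first, x, t.last].Sublist t.toList := by
  obtain ⟨l, hl⟩ := t.toList_eq_cons
  have hxl : x ∈ l := by
    rw [hl] at hx
    exact (List.mem_cons.1 hx).resolve_left h1
  rw [hl]
  refine List.Sublist.cons_cons _ ?_
  have hne : l ≠ [] := List.ne_nil_of_mem hxl
  have hlast : l.getLast hne = t.last := by
    rw [← t.getLast_toList]
    simp only [hl, List.getLast_cons hne]
  rw [← List.dropLast_append_getLast hne, hlast] at hxl ⊢
  rcases List.mem_append.1 hxl with h | h
  · exact (List.singleton_sublist.2 h).append (List.Sublist.refl _)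
  · exact absurd (by simpa using h) h2

-- The ends `a`, `b` of the left and `c`, `d` of the right subtree are compared until one half can
-- be excluded. In each case, if the excluded half contained a point below all points of the chosen
-- half, then this point and three of the four ends would alternate in the cyclic order, against
-- unimodality.
open Classical in
theorem find_body_spec {self cmp : ℕ} {body : Expr} (hself : prog[self]? = some (findBody self cmp))
    (hcmp : prog[cmp]? = some body) {par : Val} (key : Pt → ℝ ×ₗ ℝ) {t : PTree} :
    (∀ p ∈ t.toList, ∀ q ∈ t.toList, Ev prog [.pair (encodePt p) (.pair (encodePt q) par)] body
      (flag (decide (key p < key q))) 500) →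
    (∀ p ∈ t.toList, ∀ q ∈ t.toList, key p = key q → p = q) → t.toList.Nodup →
    Unimodal key t.toList →
    ∃ m ∈ t.toList, (∀ q ∈ t.toList, key m ≤ key q) ∧
      Ev prog [.pair t.encode par] (findBody self cmp) (encodePt m) (5000 * t.height + 1000) := by
  induction t with
  | leaf p =>
    intro _ _ _ _
    refine ⟨p, by simp [PTree.toList], by simp [PTree.toList], ?_⟩
    exact (Ev.ifPair_nil (Ev.pure (v := .nil) rfl (t := 4) (by decide))
      (Ev.pure (v := encodePt p) rfl (t := 10) (by decide))).mono (by omega)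
  | node l r ihl ihr =>
    intro hcm hinj hnd huni
    simp only [PTree.toList] at hcm hinj hnd huni
    obtain ⟨ml, hml, hlm, el⟩ := ihl
      (fun p hp q hq => hcm p (by simp [hp]) q (by simp [hq]))
      (fun p hp q hq => hinj p (by simp [hp]) q (by simp [hq]))
      (hnd.sublist (List.sublist_append_left _ _))
      (fun a b c d h => huni a b c d (h.trans (List.sublist_append_left _ _)))
    obtain ⟨mr, hmr, hrm, er⟩ := ihr
      (fun p hp q hq => hcm p (by simp [hp]) q (by simp [hq]))
      (fun p hp q hq => hinj p (by simp [hp]) q (by simp [hq]))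
      (hnd.sublist (List.sublist_append_right _ _))
      (fun a b c d h => huni a b c d (h.trans (List.sublist_append_right _ _)))
    have hlt : ∀ p ∈ l.toList, ∀ q ∈ r.toList, ¬ key p < key q → key q < key p := by
      intro p hp q hq h
      refine lt_of_le_of_ne (not_lt.1 h) fun he => ?_
      have := hinj p (by simp [hp]) q (by simp [hq]) he.symm
      subst this
      exact (List.disjoint_of_nodup_append hnd) hp hq
    have hlt' : ∀ p ∈ l.toList, ∀ q ∈ r.toList, ¬ key q < key p → key p < key q := by
      intro p hp q hq h
      refine lt_of_le_of_ne (not_lt.1 h) fun he => ?_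
      have := hinj p (by simp [hp]) q (by simp [hq]) he
      subst this
      exact (List.disjoint_of_nodup_append hnd) hp hq
    have ha := l.first_mem
    have hb := l.last_mem
    have hc := r.first_mem
    have hd := r.last_mem
    have hleft : ∀ x ∈ r.toList, key x < key l.first → x ≠ r.first → x ≠ r.last →
        key l.first < key r.first → key l.first < key r.last → False := by
      intro x hx h1 h2 h3 h4 h5
      exact (huni l.first r.first x r.last ((List.singleton_sublist.2 ha).append
        (PTree.sublist_first_last hx h2 h3))).1 ⟨h4, h5, h1.trans h4, h1.trans h5⟩
    have hright : ∀ x ∈ l.toList, x ≠ l.first → x ≠ l.last → ∀ z ∈ r.toList,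
        key x < key z → key z < key l.first → key z < key l.last → False := by
      intro x hx h2 h3 z hz h4 h5 h6
      exact (huni l.first x l.last z ((PTree.sublist_first_last hx h2 h3).append
        (List.singleton_sublist.2 hz))).2 ⟨h4.trans h5, h4.trans h6, h5, h6⟩
    have p0 : pev [.pair (PTree.node l r).encode par] (fst (var 0)) =
      some (PTree.node l r).encode := rfl
    have hnode : Ev prog [.pair (PTree.node l r).encode par] (fst (fst (var 0)))
        (.pair (.num ((PTree.node l r).height : ℝ)) (.pair (encodePt (PTree.node l r).first)
          (encodePt (PTree.node l r).last))) 3 := Ev.pure rfl (by decide)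
    have qa := pev_firstLeaf (pev_left p0)
    have qb := pev_lastLeaf (pev_left p0)
    have qc := pev_firstLeaf (pev_right p0)
    have qd := pev_lastLeaf (pev_right p0)
    have qp : pev [.pair (PTree.node l r).encode par] (snd (var 0)) = some par := rfl
    have test : ∀ {e₁ e₂ : Expr} {p q : Pt}, p ∈ l.toList ++ r.toList → q ∈ l.toList ++ r.toList →
        e₁.size ≤ 50 → e₂.size ≤ 50 →
        pev [.pair (PTree.node l r).encode par] e₁ = some (encodePt p) →
        pev [.pair (PTree.node l r).encode par] e₂ = some (encodePt q) →
        Ev prog [.pair (PTree.node l r).encode par]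
          (.call cmp (.pair e₁ (.pair e₂ (snd (var 0))))) (flag (decide (key p < key q))) 650 := by
      intro e₁ e₂ p q hp hq s1 s2 h1 h2
      exact (Ev.call (Ev.pure (pev_pair h1 (pev_pair h2 qp)) (t := 120)
        (by simp only [Expr.size]; omega)) hcmp (hcm p hp q hq)).mono (by omega)
    have goL : Ev prog [.pair (PTree.node l r).encode par]
        (mk2 self (left (fst (var 0))) (snd (var 0))) (encodePt ml) (5000 * l.height + 1050) :=
      (Ev.call (Ev.pure (pev_pair (pev_left p0) qp) (t := 20)
        (by simp [Expr.size, Expr.left])) hself el).mono (by omega)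
    have goR : Ev prog [.pair (PTree.node l r).encode par]
        (mk2 self (right (fst (var 0))) (snd (var 0))) (encodePt mr) (5000 * r.height + 1050) :=
      (Ev.call (Ev.pure (pev_pair (pev_right p0) qp) (t := 20)
        (by simp [Expr.size, Expr.right])) hself er).mono (by omega)
    have finL : (∀ x ∈ r.toList, ¬ key x < key ml) → ∃ m ∈ (PTree.node l r).toList,
        m = ml ∧ ∀ q ∈ (PTree.node l r).toList, key m ≤ key q := by
      intro h
      refine ⟨ml, by simp [PTree.toList, hml], rfl, fun q hq => ?_⟩
      rcases List.mem_append.1 hq with hq | hq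
      · exact hlm q hq
      · exact not_lt.1 (h q hq)
    have finR : (∀ x ∈ l.toList, ¬ key x < key mr) → ∃ m ∈ (PTree.node l r).toList,
        m = mr ∧ ∀ q ∈ (PTree.node l r).toList, key m ≤ key q := by
      intro h
      refine ⟨mr, by simp [PTree.toList, hmr], rfl, fun q hq => ?_⟩
      rcases List.mem_append.1 hq with hq | hq
      · exact not_lt.1 (h q hq)
      · exact hrm q hq
    have tbc := test (p := l.last) (q := r.first) (by simp [hb]) (by simp [hc]) (by decide)
      (by decide) qb qc
    have tbd := test (p := l.last) (q := r.last) (by simp [hb]) (by simp [hd]) (by decide)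
      (by decide) qb qd
    have tad := test (p := l.first) (q := r.last) (by simp [ha]) (by simp [hd]) (by decide)
      (by decide) qa qd
    have tca := test (p := r.first) (q := l.first) (by simp [hc]) (by simp [ha]) (by decide)
      (by decide) qc qa
    have tda := test (p := r.last) (q := l.first) (by simp [hd]) (by simp [ha]) (by decide)
      (by decide) qd qa
    have hle1 : l.height ≤ max l.height r.height := le_max_left _ _
    have hle2 : r.height ≤ max l.height r.height := le_max_right _ _
    simp only [PTree.height]
    by_cases bc : key l.last < key r.first
    · rw [decide_eq_true bc] at tbc
      by_cases bd : key l.last < key r.last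
      · rw [decide_eq_true bd] at tbd
        obtain ⟨m, k1, rfl, k2⟩ := finL (fun x hx h => by
          have h1 := h.trans_le (hlm _ hb)
          refine (huni l.last r.first x r.last ((List.singleton_sublist.2 hb).append
            (PTree.sublist_first_last hx ?_ ?_))).1 ⟨bc, bd, h1.trans bc, h1.trans bd⟩
          · rintro rfl; exact lt_asymm h1 bc
          · rintro rfl; exact lt_asymm h1 bd)
        exact ⟨_, k1, k2, (Ev.ifPair_pos hnode (Ev.ifPair_pos tbc
          (Ev.ifPair_pos tbd goL))).mono (by omega)⟩
      rw [decide_eq_false bd] at tbd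
      have db := hlt _ hb _ hd bd
      by_cases ad : key l.first < key r.last
      · rw [decide_eq_true ad] at tad
        obtain ⟨m, k1, rfl, k2⟩ := finL (fun x hx h => by
          have h1 := h.trans_le (hlm _ ha)
          refine hleft x hx h1 ?_ ?_ (ad.trans (db.trans bc)) ad
          · rintro rfl; exact lt_asymm h1 (ad.trans (db.trans bc))
          · rintro rfl; exact lt_asymm h1 ad)
        exact ⟨_, k1, k2, (Ev.ifPair_pos hnode (Ev.ifPair_pos tbc
          (Ev.ifPair_nil tbd (Ev.ifPair_pos tad goL)))).mono (by omega)⟩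
      · rw [decide_eq_false ad] at tad
        have da := hlt _ ha _ hd ad
        obtain ⟨m, k1, rfl, k2⟩ := finR (fun x hx h => by
          have h1 := h.trans_le (hrm _ hd)
          refine hright x hx ?_ ?_ _ hd h1 da db
          · rintro rfl; exact lt_asymm h1 da
          · rintro rfl; exact lt_asymm h1 db)
        exact ⟨_, k1, k2, (Ev.ifPair_pos hnode (Ev.ifPair_pos tbc
          (Ev.ifPair_nil tbd (Ev.ifPair_nil tad goR)))).mono (by omega)⟩
    · rw [decide_eq_false bc] at tbc
      have cb := hlt _ hb _ hc bc
      by_cases ca : key r.first < key l.first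
      · rw [decide_eq_true ca] at tca
        obtain ⟨m, k1, rfl, k2⟩ := finR (fun x hx h => by
          have h1 := h.trans_le (hrm _ hc)
          refine hright x hx ?_ ?_ _ hc h1 ca cb
          · rintro rfl; exact lt_asymm h1 ca
          · rintro rfl; exact lt_asymm h1 cb)
        exact ⟨_, k1, k2, (Ev.ifPair_pos hnode (Ev.ifPair_nil tbc
          (Ev.ifPair_pos tca goR))).mono (by omega)⟩
      rw [decide_eq_false ca] at tca
      have ac := hlt' _ ha _ hc ca
      by_cases da : key r.last < key l.first
      · rw [decide_eq_true da] at tda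
        obtain ⟨m, k1, rfl, k2⟩ := finR (fun x hx h => by
          have h1 := h.trans_le (hrm _ hd)
          have db := da.trans (ac.trans cb)
          refine hright x hx ?_ ?_ _ hd h1 da db
          · rintro rfl; exact lt_asymm h1 da
          · rintro rfl; exact lt_asymm h1 db)
        exact ⟨_, k1, k2, (Ev.ifPair_pos hnode (Ev.ifPair_nil tbc
          (Ev.ifPair_nil tca (Ev.ifPair_pos tda goR)))).mono (by omega)⟩
      · rw [decide_eq_false da] at tda
        have ad := hlt' _ ha _ hd da
        obtain ⟨m, k1, rfl, k2⟩ := finL (fun x hx h => by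
          have h1 := h.trans_le (hlm _ ha)
          refine hleft x hx h1 ?_ ?_ ac ad
          · rintro rfl; exact lt_asymm h1 ac
          · rintro rfl; exact lt_asymm h1 ad)
        exact ⟨_, k1, k2, (Ev.ifPair_pos hnode (Ev.ifPair_nil tbc
          (Ev.ifPair_nil tca (Ev.ifPair_nil tda goL)))).mono (by omega)⟩

/-! ### Vertices -/

def dot (p q : Pt) : ℝ := p.1 * q.1 + p.2 * q.2

theorem orient_combo {s t : ℝ} (hst : s + t = 1) (p q x y : Pt) :
    orient p q (s • x + t • y) = s * orient p q x + t * orient p q y := by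
  obtain rfl : t = 1 - s := by linarith
  simp only [orient, Prod.fst_add, Prod.snd_add, Prod.smul_fst, Prod.smul_snd, smul_eq_mul]
  ring

theorem dot_combo (s t : ℝ) (u x y : Pt) :
    dot u (s • x + t • y) = s * dot u x + t * dot u y := by
  simp only [dot, Prod.fst_add, Prod.snd_add, Prod.smul_fst, Prod.smul_snd, smul_eq_mul]
  ring

theorem dot_sub (u x y : Pt) : dot u (x - y) = dot u x - dot u y := by
  simp only [dot, Prod.fst_sub, Prod.snd_sub]; ring

/-- There is a line with `p` on one side and all other points of `P` on the other side. -/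
def IsVertex (P : Finset Pt) (p : Pt) : Prop :=
  p ∈ P ∧ ∃ u : Pt, ∀ q ∈ P, q ≠ p → dot u p < dot u q

theorem IsVertex.mono {P Q : Finset Pt} {p : Pt} (h : IsVertex Q p) (hPQ : P ⊆ Q) (hp : p ∈ P) :
    IsVertex P p := by
  obtain ⟨_, u, hu⟩ := h
  exact ⟨hp, u, fun q hq => hu q (hPQ hq)⟩

theorem exists_dot_eq (f : Pt →L[ℝ] ℝ) : ∃ u : Pt, ∀ x, f x = dot u x := by
  refine ⟨(f (1, 0), f (0, 1)), fun x => ?_⟩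
  have : x = x.1 • ((1, 0) : Pt) + x.2 • ((0, 1) : Pt) := by ext <;> simp
  conv_lhs => rw [this]
  rw [map_add, map_smul, map_smul]
  simp [dot, mul_comm]

/-- A point of `P` outside of the convex hull of the others is a vertex. -/
theorem IsVertex.of_notMem_convexHull {P : Finset Pt} {p : Pt} (hp : p ∈ P) {S : Set Pt}
    (hS : ∀ q ∈ P, q ≠ p → q ∈ S) (hfin : S.Finite) (h : p ∉ convexHull ℝ S) : IsVertex P p := by
  obtain ⟨f, c, h1, h2⟩ := geometric_hahn_banach_point_closed (convex_convexHull ℝ S)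
    (hfin.isClosed_convexHull ℝ) h
  obtain ⟨u, hu⟩ := exists_dot_eq f
  refine ⟨hp, u, fun q hq hqp => ?_⟩
  rw [← hu, ← hu]
  exact h1.trans (h2 q (subset_convexHull ℝ S (hS q hq hqp)))

/-- Extreme points of a polygon are exposed. An extreme point is outside of the hull of the other
points, hence strictly separable from it. Conversely, an open halfplane together with the point `p`
on its boundary line is convex and contains the whole hull, and `p` is interior to no segment in
this set. -/
theorem mem_hullVertices {P : Finset Pt} {p : Pt} : p ∈ hullVertices P ↔ IsVertex P p := by
  classical
  simp only [hullVertices, Finset.mem_filter]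
  constructor
  · rintro ⟨hp, hext⟩
    refine IsVertex.of_notMem_convexHull (S := (P : Set Pt) \ {p}) hp
      (fun q hq hqp => ⟨hq, by simpa using hqp⟩) (P.finite_toSet.subset Set.sdiff_subset) fun h => ?_
    have heq : convexHull ℝ (P : Set Pt) = convexHull ℝ ((P : Set Pt) \ {p}) := by
      refine subset_antisymm (convexHull_min (fun q hq => ?_) (convex_convexHull ℝ _))
        (convexHull_mono Set.sdiff_subset)
      by_cases hqp : q = p
      · rw [hqp]; exact h
      · exact subset_convexHull ℝ _ ⟨hq, by simpa using hqp⟩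
    rw [heq] at hext
    exact (extremePoints_convexHull_subset hext).2 rfl
  · rintro ⟨hp, u, hu⟩
    refine ⟨hp, subset_convexHull ℝ _ (by exact_mod_cast hp), ?_⟩
    have hK : Convex ℝ {z : Pt | dot u p < dot u z ∨ z = p} := by
      intro x hx y hy a b ha hb hab
      simp only [Set.mem_ofPred_eq] at *
      rcases ha.eq_or_lt with rfl | ha
      · have hb1 : b = 1 := by linarith
        simpa [hb1] using hy
      rcases hb.eq_or_lt with rfl | hb
      · have hb1 : a = 1 := by linarith
        simpa [hb1] using hx
      have e : dot u p = a * dot u p + b * dot u p := by rw [← add_mul, hab, one_mul]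
      rcases hx with hx | rfl
      · left
        rw [dot_combo, e]
        rcases hy with hy | rfl <;> nlinarith
      · rcases hy with hy | rfl
        · left
          rw [dot_combo, e]
          nlinarith
        · right
          rw [← add_smul, hab, one_smul]
    have hsub : convexHull ℝ (P : Set Pt) ⊆ {z : Pt | dot u p < dot u z ∨ z = p} := by
      refine convexHull_min (fun q hq => ?_) hK
      by_cases hqp : q = p
      · exact Or.inr hqp
      · exact Or.inl (hu q hq hqp)
    rintro x hx y hy ⟨a, b, ha, hb, hab, he⟩
    have h1 := hsub hx
    have h2 := hsub hy
    simp only [Set.mem_ofPred_eq] at h1 h2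
    have e : a * dot u x + b * dot u y = dot u p := by rw [← dot_combo, he]
    have e' : dot u p = a * dot u p + b * dot u p := by rw [← add_mul, hab, one_mul]
    rcases h1 with h1 | rfl
    · rcases h2 with h2 | rfl <;> exfalso <;> nlinarith
    · rfl

/-- The Krein–Milman theorem; the closure is superfluous for a finite set. -/
theorem subset_convexHull_hullVertices (P : Finset Pt) :
    (P : Set Pt) ⊆ convexHull ℝ (hullVertices P : Set Pt) := by
  classical
  have hc : IsCompact (convexHull ℝ (P : Set Pt)) :=
    P.finite_toSet.isCompact_convexHull (𝕜 := ℝ)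
  have h1 := closure_convexHull_extremePoints hc (convex_convexHull ℝ _)
  have h2 : (convexHull ℝ (P : Set Pt)).extremePoints ℝ = hullVertices P := by
    ext x
    simp only [hullVertices, Finset.coe_filter, Set.mem_ofPred_eq]
    exact ⟨fun h => ⟨by exact_mod_cast extremePoints_convexHull_subset h, h⟩, fun h => h.2⟩
  rw [h2, ((hullVertices P).finite_toSet.isClosed_convexHull ℝ).closure_eq] at h1
  rw [h1]
  exact subset_convexHull ℝ _

/-! ### Edges of the convex hull -/

/-- `p q` is an edge of the convex hull of `P`, in counterclockwise direction (with `p = q` iff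
`P` is the single point `p`). -/
def HullEdge (P : Finset Pt) (p q : Pt) : Prop :=
  p ∈ P ∧ q ∈ P ∧ ∀ x ∈ P, x ≠ p → x ≠ q →
    0 < orient p q x ∨ (orient p q x = 0 ∧ 0 < dot (q - p) (x - p) ∧ 0 < dot (p - q) (x - q))

theorem HullEdge.mono {P Q : Finset Pt} {p q : Pt} (h : HullEdge Q p q) (hPQ : P ⊆ Q)
    (hp : p ∈ P) (hq : q ∈ P) : HullEdge P p q :=
  ⟨hp, hq, fun x hx => h.2.2 x (hPQ hx)⟩

theorem HullEdge.orient_nonneg {P : Finset Pt} {p q x : Pt} (h : HullEdge P p q) (hx : x ∈ P) :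
    0 ≤ orient p q x := by
  by_cases h1 : x = p
  · rw [h1, orient_self_outer]
  by_cases h2 : x = q
  · rw [h2, orient_self_right]
  rcases h.2.2 x hx h1 h2 with h | h
  · exact h.le
  · exact h.1.ge

theorem HullEdge.eq_of_self {P : Finset Pt} {p x : Pt} (h : HullEdge P p p) (hx : x ∈ P) :
    x = p := by
  by_contra hne
  rcases h.2.2 x hx hne hne with h | ⟨_, h, _⟩
  · rw [orient_self_left] at h; exact lt_irrefl _ h
  · simp [dot] at h

theorem dot_pos_or {p q x : Pt} (hpq : p ≠ q) (h : orient p q x = 0)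
    (h1 : dot (q - p) (x - p) = 0) : x = p := by
  have := dot_self_pos hpq
  simp only [orient, dot, Prod.fst_sub, Prod.snd_sub] at h h1
  have e1 : ((p.1 - q.1) * (p.1 - q.1) + (p.2 - q.2) * (p.2 - q.2)) * (x.1 - p.1) = 0 := by
    linear_combination (q.1 - p.1) * h1 - (q.2 - p.2) * h
  have e2 : ((p.1 - q.1) * (p.1 - q.1) + (p.2 - q.2) * (p.2 - q.2)) * (x.2 - p.2) = 0 := by
    linear_combination (q.2 - p.2) * h1 + (q.1 - p.1) * h
  rcases mul_eq_zero.1 e1 with e1 | e1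
  · linarith
  rcases mul_eq_zero.1 e2 with e2 | e2
  · linarith
  exact Prod.ext (by linarith) (by linarith)

/-- Halfplanes with half of the boundary line are convex. -/
theorem convex_lexPos (f g : Pt → ℝ)
    (hf : ∀ (s t : ℝ) (x y : Pt), s + t = 1 → f (s • x + t • y) = s * f x + t * f y)
    (hg : ∀ (s t : ℝ) (x y : Pt), s + t = 1 → g (s • x + t • y) = s * g x + t * g y) :
    Convex ℝ {z : Pt | 0 < f z ∨ (f z = 0 ∧ 0 < g z)} := by
  intro x hx y hy a b ha hb hab
  simp only [Set.mem_ofPred_eq] at *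
  rw [hf a b x y hab, hg a b x y hab]
  rcases ha.eq_or_lt with rfl | ha
  · have hb1 : b = 1 := by linarith
    simpa [hb1] using hy
  rcases hb.eq_or_lt with rfl | hb
  · have hb1 : a = 1 := by linarith
    simpa [hb1] using hx
  rcases hx with hx | ⟨hx, hx'⟩
  · left
    rcases hy with hy | ⟨hy, hy'⟩
    · positivity
    · rw [hy]; simp; positivity
  · rcases hy with hy | ⟨hy, hy'⟩
    · left; rw [hx]; simp; positivity
    · right; rw [hx, hy]; exact ⟨by simp, by positivity⟩

theorem affine_orient (p q : Pt) (s t : ℝ) (x y : Pt) (h : s + t = 1) :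
    orient p q (s • x + t • y) = s * orient p q x + t * orient p q y := orient_combo h p q x y

theorem affine_dot (v p : Pt) (s t : ℝ) (x y : Pt) (h : s + t = 1) :
    dot v (s • x + t • y - p) = s * dot v (x - p) + t * dot v (y - p) := by
  obtain rfl : t = 1 - s := by linarith
  rw [dot_sub, dot_combo, dot_sub, dot_sub]
  ring

/-- All points but `p` are in the open halfplane to the left of the edge or on the open ray from `p`
through `q`. The union of these two is convex and does not contain `p`. -/
theorem HullEdge.isVertex_left {P : Finset Pt} {p q : Pt} (h : HullEdge P p q) :
    IsVertex P p := by
  by_cases hpq : p = q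
  · subst hpq
    exact ⟨h.1, 0, fun x hx hxp => absurd (h.eq_of_self hx) hxp⟩
  refine IsVertex.of_notMem_convexHull h.1 (S := (P : Set Pt) \ {p})
    (fun x hx hxp => ⟨hx, by simpa using hxp⟩) (P.finite_toSet.subset Set.sdiff_subset) fun hc => ?_
  have hsub := convexHull_min (s := (P : Set Pt) \ {p}) (fun x hx => ?_)
    (convex_lexPos (orient p q) (fun z => dot (q - p) (z - p)) (affine_orient p q)
      (affine_dot (q - p) p))
  · have := hsub hc
    simp [orient_self_outer, dot] at this
  · by_cases hxq : x = q
    · subst hxq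
      right
      refine ⟨orient_self_right _ _, ?_⟩
      have := dot_self_pos hpq
      simp only [dot, Prod.fst_sub, Prod.snd_sub]
      linarith
    · rcases h.2.2 x hx.1 hx.2 hxq with h | h
      · exact Or.inl h
      · exact Or.inr ⟨h.1, h.2.1⟩

theorem HullEdge.isVertex_right {P : Finset Pt} {p q : Pt} (h : HullEdge P p q) :
    IsVertex P q := by
  by_cases hpq : p = q
  · subst hpq; exact h.isVertex_left
  refine IsVertex.of_notMem_convexHull h.2.1 (S := (P : Set Pt) \ {q})
    (fun x hx hxp => ⟨hx, by simpa using hxp⟩) (P.finite_toSet.subset Set.sdiff_subset) fun hc => ?_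
  have hsub := convexHull_min (s := (P : Set Pt) \ {q}) (fun x hx => ?_)
    (convex_lexPos (orient p q) (fun z => dot (p - q) (z - q)) (affine_orient p q)
      (affine_dot (p - q) q))
  · have := hsub hc
    simp [orient_self_right, dot] at this
  · by_cases hxq : x = p
    · subst hxq
      right
      refine ⟨orient_self_outer _ _, ?_⟩
      have := dot_self_pos hpq
      simp only [dot, Prod.fst_sub, Prod.snd_sub]
      linarith
    · rcases h.2.2 x hx.1 hxq hx.2 with h | h
      · exact Or.inl h
      · exact Or.inr ⟨h.1, h.2.2⟩

/-- A vertex is not in the interior of an edge. -/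
theorem IsVertex.not_between {P : Finset Pt} {p q x : Pt} (hx : IsVertex P x) (hp : p ∈ P)
    (hq : q ∈ P) (hxp : x ≠ p) (hxq : x ≠ q) (h : orient p q x = 0)
    (h1 : 0 < dot (q - p) (x - p)) (h2 : 0 < dot (p - q) (x - q)) : False := by
  obtain ⟨_, u, hu⟩ := hx
  have a1 := hu p hp hxp.symm
  have a2 := hu q hq hxq.symm
  simp only [orient, dot, Prod.fst_sub, Prod.snd_sub] at *
  have key : ((q.1 - p.1) * (x.1 - p.1) + (q.2 - p.2) * (x.2 - p.2)) *
      (u.1 * q.1 + u.2 * q.2 - (u.1 * x.1 + u.2 * x.2)) +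
      ((p.1 - q.1) * (x.1 - q.1) + (p.2 - q.2) * (x.2 - q.2)) *
      (u.1 * p.1 + u.2 * p.2 - (u.1 * x.1 + u.2 * x.2)) = 0 := by
    linear_combination (u.2 * (p.1 - q.1) - u.1 * (p.2 - q.2)) * h
  have b1 := mul_pos h1 (sub_pos.2 a2)
  have b2 := mul_pos h2 (sub_pos.2 a1)
  linarith

theorem HullEdge.orient_pos {P : Finset Pt} {p q x : Pt} (h : HullEdge P p q) (hx : IsVertex P x)
    (hxp : x ≠ p) (hxq : x ≠ q) : 0 < orient p q x := by
  rcases h.2.2 x hx.1 hxp hxq with h1 | ⟨h1, h2, h3⟩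
  · exact h1
  · exact (hx.not_between h.1 h.2.1 hxp hxq h1 h2 h3).elim

/-- Of two different successors, each would be strictly to the left of the edge to the other one. -/
theorem HullEdge.right_unique {P : Finset Pt} {p q q' : Pt} (h : HullEdge P p q)
    (h' : HullEdge P p q') : q = q' := by
  by_contra hne
  by_cases h1 : p = q
  · subst h1
    exact hne (h.eq_of_self h'.2.1).symm
  by_cases h2 : p = q'
  · subst h2
    exact hne (h'.eq_of_self h.2.1)
  have a := h.orient_pos h'.isVertex_right (Ne.symm h2) (Ne.symm hne)
  have b := h'.orient_pos h.isVertex_right (Ne.symm h1) hne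
  rw [orient_swap] at a
  linarith

theorem HullEdge.left_unique {P : Finset Pt} {p p' q : Pt} (h : HullEdge P p q)
    (h' : HullEdge P p' q) : p = p' := by
  by_contra hne
  by_cases h1 : p = q
  · subst h1
    exact hne (h.eq_of_self h'.1).symm
  by_cases h2 : p' = q
  · subst h2
    exact hne (h'.eq_of_self h.1)
  have a := h.orient_pos h'.isVertex_left (Ne.symm hne) h2
  have b := h'.orient_pos h.isVertex_left hne h1
  have e : orient p q p' = - orient p' q p := by simp only [orient]; ring
  linarith

/-! ### Angular orders -/

/-- Twice the signed area of the parallelogram of two vectors. -/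
def cross (p q : Pt) : ℝ := p.1 * q.2 - p.2 * q.1

/-- For points in front of `x` in direction `u`, the angle is a monotone function of the slope in
the frame `u`; `σ = 1` gives the counterclockwise and `σ = -1` the clockwise order. The negated
distance along `u` places farther points first, so that the least point in a tangent direction is
the end of the edge and not an interior point. The program does not know `u`: it decides this order
with `orient` and `dot` alone. -/
noncomputable def angKey (σ : ℝ) (u x p : Pt) : ℝ ×ₗ ℝ :=
  toLex (σ * (cross u (p - x) / dot u (p - x)), -dot u (p - x))

theorem toLex_lt_toLex' {a b c d : ℝ} :
    (toLex (a, b) : ℝ ×ₗ ℝ) < toLex (c, d) ↔ a < c ∨ (a = c ∧ b < d) := by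
  rw [Prod.Lex.toLex_lt_toLex]

/-- After clearing denominators, this identity turns the comparison of two slopes in the frame `u`
into an orientation test without `u`. -/
theorem lagrange_orient (u x p q : Pt) :
    dot u (p - x) * cross u (q - x) - cross u (p - x) * dot u (q - x) =
      dot u u * orient x p q := by
  simp only [dot, cross, orient, Prod.fst_sub, Prod.snd_sub]; ring

theorem dot_self_pos_of_ne {u p x : Pt} (h : dot u x < dot u p) : 0 < dot u u := by
  have h0 : u ≠ 0 := by rintro rfl; simp [dot] at h
  have := dot_self_pos h0
  simpa [dot] using this

theorem collinear_dot {u x p q : Pt} (h : orient x p q = 0) :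
    dot u (p - x) * dot (q - p) (x - p) = (dot u (p - x) - dot u (q - x)) * dot (p - x) (p - x) := by
  simp only [dot, orient, Prod.fst_sub, Prod.snd_sub] at *
  linear_combination (u.1 * (x.2 - p.2) - u.2 * (x.1 - p.1)) * h

section

variable {u x p q : Pt}

theorem slope_lt_iff (hp : dot u x < dot u p) (hq : dot u x < dot u q) :
    cross u (p - x) / dot u (p - x) < cross u (q - x) / dot u (q - x) ↔ 0 < orient x p q := by
  have hp' : 0 < dot u (p - x) := by rw [dot_sub]; linarith
  have hq' : 0 < dot u (q - x) := by rw [dot_sub]; linarith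
  have hu := dot_self_pos_of_ne hp
  rw [div_lt_div_iff₀ hp' hq', ← mul_pos_iff_of_pos_left hu, ← lagrange_orient]
  constructor <;> intro h <;> linarith

theorem slope_eq_iff (hp : dot u x < dot u p) (hq : dot u x < dot u q) :
    cross u (p - x) / dot u (p - x) = cross u (q - x) / dot u (q - x) ↔ orient x p q = 0 := by
  have hp' : 0 < dot u (p - x) := by rw [dot_sub]; linarith
  have hq' : 0 < dot u (q - x) := by rw [dot_sub]; linarith
  have hu := dot_self_pos_of_ne hp
  rw [div_eq_div_iff hp'.ne' hq'.ne']
  have e := lagrange_orient u x p q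
  constructor
  · intro h
    have : dot u u * orient x p q = 0 := by rw [← e]; linarith
    exact (mul_eq_zero.1 this).resolve_left hu.ne'
  · intro h
    rw [h] at e
    linarith

theorem dist_lt_iff (hp : dot u x < dot u p) (h : orient x p q = 0) :
    dot u (q - x) < dot u (p - x) ↔ 0 < dot (q - p) (x - p) := by
  have hp' : 0 < dot u (p - x) := by rw [dot_sub]; linarith
  have hne : p ≠ x := by rintro rfl; exact lt_irrefl _ hp
  have hpp : 0 < dot (p - x) (p - x) := by simpa [dot] using dot_self_pos hne
  rw [← mul_pos_iff_of_pos_left hp', collinear_dot h]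
  constructor
  · intro h; exact mul_pos (by linarith) hpp
  · intro h
    have := pos_of_mul_pos_left h hpp.le
    linarith

/-- The counterclockwise order of directions as seen from `x`; more distant points first. -/
theorem angKey_one_lt_iff (hp : dot u x < dot u p) (hq : dot u x < dot u q) :
    angKey 1 u x p < angKey 1 u x q ↔
      0 < orient x p q ∨ (orient x p q = 0 ∧ 0 < dot (q - p) (x - p)) := by
  rw [angKey, angKey, toLex_lt_toLex', one_mul, one_mul, slope_lt_iff hp hq, slope_eq_iff hp hq]
  refine or_congr Iff.rfl (and_congr_right fun h => ?_)
  rw [neg_lt_neg_iff, dist_lt_iff hp h]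

/-- The clockwise order of directions as seen from `x`; more distant points first. -/
theorem angKey_neg_one_lt_iff (hp : dot u x < dot u p) (hq : dot u x < dot u q) :
    angKey (-1) u x p < angKey (-1) u x q ↔
      0 < orient x q p ∨ (orient x q p = 0 ∧ 0 < dot (q - p) (x - p)) := by
  rw [angKey, angKey, toLex_lt_toLex', neg_one_mul, neg_one_mul, neg_lt_neg_iff,
    slope_lt_iff hq hp, neg_inj, eq_comm, slope_eq_iff hq hp]
  refine or_congr Iff.rfl (and_congr_right fun h => ?_)
  have h' : orient x p q = 0 := by rw [orient_swap, h, neg_zero]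
  rw [neg_lt_neg_iff, dist_lt_iff hp h']

theorem angKey_inj {σ : ℝ} (hσ : σ ≠ 0) (hp : dot u x < dot u p) (hq : dot u x < dot u q)
    (h : angKey σ u x p = angKey σ u x q) : p = q := by
  have h1 : σ * (cross u (p - x) / dot u (p - x)) = σ * (cross u (q - x) / dot u (q - x)) :=
    congrArg (fun z : ℝ ×ₗ ℝ => (ofLex z).1) h
  have h2 : -dot u (p - x) = -dot u (q - x) := congrArg (fun z : ℝ ×ₗ ℝ => (ofLex z).2) h
  have h3 := (slope_eq_iff hp hq).1 (mul_left_cancel₀ hσ h1)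
  have hne : p ≠ x := by rintro rfl; exact lt_irrefl _ hp
  refine (dot_pos_or hne ?_ ?_).symm
  · rw [show orient p x q = -orient x p q by simp only [orient]; ring, h3, neg_zero]
  · have e := collinear_dot (u := u) h3
    rw [show dot u (p - x) - dot u (q - x) = 0 by linarith, zero_mul] at e
    have hp' : 0 < dot u (p - x) := by rw [dot_sub]; linarith
    have := (mul_eq_zero.1 e).resolve_left hp'.ne'
    simp only [dot] at *; linarith

/-- The direction of a point that is collinear with `x` and `p`. -/
theorem same_side (hp : dot u x < dot u p) (hq : dot u x < dot u q) (h : orient x p q = 0) :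
    0 < dot (p - x) (q - x) := by
  have hp' : 0 < dot u (p - x) := by rw [dot_sub]; linarith
  have hq' : 0 < dot u (q - x) := by rw [dot_sub]; linarith
  have hne : p ≠ x := by rintro rfl; exact lt_irrefl _ hp
  have hpp : 0 < dot (p - x) (p - x) := by simpa [dot] using dot_self_pos hne
  have e : dot u (p - x) * dot (p - x) (q - x) = dot u (q - x) * dot (p - x) (p - x) := by
    simp only [dot, orient, Prod.fst_sub, Prod.snd_sub] at *
    linear_combination (u.1 * (p.2 - x.2) - u.2 * (p.1 - x.1)) * h
  exact pos_of_mul_pos_right (a := dot u (p - x)) (by rw [e]; positivity) hp'.le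

end

/-- The edge from a vertex `x` leads to the first point in the angular order. -/
theorem HullEdge.of_angKey_min {P : Finset Pt} {u x q : Pt} (hx : x ∈ P) (hq : q ∈ P)
    (hqx : q ≠ x) (hu : ∀ p ∈ P, p ≠ x → dot u x < dot u p)
    (hmin : ∀ p ∈ P, p ≠ x → angKey 1 u x q ≤ angKey 1 u x p) : HullEdge P x q := by
  refine ⟨hx, hq, fun p hp hpx hpq => ?_⟩
  have h1 := hu p hp hpx
  have h2 := hu q hq hqx
  have h3 := (hmin p hp hpx).lt_of_ne fun h => hpq (angKey_inj one_ne_zero h2 h1 h).symm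
  rcases (angKey_one_lt_iff h2 h1).1 h3 with h | ⟨h, h'⟩
  · exact Or.inl h
  · exact Or.inr ⟨h, same_side h2 h1 h, by simpa only [dot, mul_comm] using h'⟩

theorem HullEdge.of_angKey_min' {P : Finset Pt} {u x q : Pt} (hx : x ∈ P) (hq : q ∈ P)
    (hqx : q ≠ x) (hu : ∀ p ∈ P, p ≠ x → dot u x < dot u p)
    (hmin : ∀ p ∈ P, p ≠ x → angKey (-1) u x q ≤ angKey (-1) u x p) : HullEdge P q x := by
  refine ⟨hq, hx, fun p hp hpq hpx => ?_⟩
  have h1 := hu p hp hpx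
  have h2 := hu q hq hqx
  have h3 := (hmin p hp hpx).lt_of_ne fun h => hpq (angKey_inj (by norm_num) h2 h1 h).symm
  have e : orient q x p = orient x p q := (orient_rotate q x p).symm
  rw [e]
  rcases (angKey_neg_one_lt_iff h2 h1).1 h3 with h | ⟨h, h'⟩
  · exact Or.inl h
  · exact Or.inr ⟨h, by simpa only [dot, mul_comm] using h',
      same_side h2 h1 (by rw [orient_swap, h, neg_zero])⟩

theorem IsVertex.exists_next {P : Finset Pt} {x : Pt} (h : IsVertex P x) :
    ∃ q, HullEdge P x q := by
  classical
  obtain ⟨hx, u, hu⟩ := h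
  by_cases hne : (P.erase x).Nonempty
  · obtain ⟨q, hq, hmin⟩ := Finset.exists_min_image (P.erase x) (angKey 1 u x) hne
    rw [Finset.mem_erase] at hq
    exact ⟨q, HullEdge.of_angKey_min hx hq.2 hq.1 hu
      fun p hp hpx => hmin p (Finset.mem_erase.2 ⟨hpx, hp⟩)⟩
  · refine ⟨x, hx, hx, fun p hp hpx => ?_⟩
    exact absurd ⟨p, Finset.mem_erase.2 ⟨hpx, hp⟩⟩ hne

theorem IsVertex.exists_prev {P : Finset Pt} {x : Pt} (h : IsVertex P x) :
    ∃ q, HullEdge P q x := by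
  classical
  obtain ⟨hx, u, hu⟩ := h
  by_cases hne : (P.erase x).Nonempty
  · obtain ⟨q, hq, hmin⟩ := Finset.exists_min_image (P.erase x) (angKey (-1) u x) hne
    rw [Finset.mem_erase] at hq
    exact ⟨q, HullEdge.of_angKey_min' hx hq.2 hq.1 hu
      fun p hp hpx => hmin p (Finset.mem_erase.2 ⟨hpx, hp⟩)⟩
  · refine ⟨x, hx, hx, fun p hp hpx => ?_⟩
    exact absurd ⟨p, Finset.mem_erase.2 ⟨hpx, hp⟩⟩ hne

/-- The end of the edge from `x` is less in the angular order than all other points. -/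
theorem HullEdge.angKey_lt {P : Finset Pt} {u x q p : Pt} (h : HullEdge P x q)
    (hu : ∀ p ∈ P, p ≠ x → dot u x < dot u p) (hp : p ∈ P) (hpx : p ≠ x) (hpq : p ≠ q) :
    angKey 1 u x q < angKey 1 u x p := by
  have hqx : q ≠ x := by rintro rfl; exact hpx (h.eq_of_self hp)
  rw [angKey_one_lt_iff (hu q h.2.1 hqx) (hu p hp hpx)]
  rcases h.2.2 p hp hpx hpq with h | h
  · exact Or.inl h
  · exact Or.inr ⟨h.1, by simpa only [dot, mul_comm] using h.2.2⟩

theorem HullEdge.angKey_lt' {P : Finset Pt} {u x q p : Pt} (h : HullEdge P q x)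
    (hu : ∀ p ∈ P, p ≠ x → dot u x < dot u p) (hp : p ∈ P) (hpx : p ≠ x) (hpq : p ≠ q) :
    angKey (-1) u x q < angKey (-1) u x p := by
  have hqx : q ≠ x := by rintro rfl; exact hpx (h.eq_of_self hp)
  rw [angKey_neg_one_lt_iff (hu q h.1 hqx) (hu p hp hpx)]
  have e : orient q x p = orient x p q := (orient_rotate q x p).symm
  rw [← e]
  rcases h.2.2 p hp hpq hpx with h | h
  · exact Or.inl h
  · exact Or.inr ⟨h.1, by simpa only [dot, mul_comm] using h.2.1⟩

/-! ### Convex polygons as cyclic lists -/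

/-- `L` lists the vertices of the convex hull of `P` in counterclockwise order. -/
def Cyc (P : Finset Pt) (L : List Pt) : Prop :=
  L ≠ [] ∧ L.Nodup ∧ Cycle.Chain (HullEdge P) (L : Cycle Pt)

theorem Cyc.isRotated {P : Finset Pt} {L L' : List Pt} (h : Cyc P L) (hr : L ~r L') : Cyc P L' := by
  obtain ⟨h1, h2, h3⟩ := h
  refine ⟨fun h => h1 ?_, hr.nodup_iff.1 h2, ?_⟩
  · subst h; exact List.isRotated_nil_iff.1 hr
  · rwa [← Cycle.coe_eq_coe.2 hr]

theorem cyc_cons {P : Finset Pt} {a : Pt} {l : List Pt} :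
    Cyc P (a :: l) ↔ (a :: l).Nodup ∧ List.IsChain (HullEdge P) (a :: (l ++ [a])) := by
  simp [Cyc, Cycle.chain_coe_cons]

theorem Cyc.exists_next_mem {P : Finset Pt} {L : List Pt} (h : Cyc P L) {p : Pt} (hp : p ∈ L) :
    ∃ q ∈ L, HullEdge P p q := by
  obtain ⟨l₁, l₂, rfl⟩ := List.append_of_mem hp
  have h' := h.isRotated (isRotated_append_comm l₁ (p :: l₂))
  rw [List.cons_append, cyc_cons] at h'
  obtain ⟨q, l, hq⟩ : ∃ q l, l₂ ++ l₁ ++ [p] = q :: l := by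
    cases h : l₂ ++ l₁ with
    | nil => exact ⟨p, [], rfl⟩
    | cons q l => exact ⟨q, l ++ [p], rfl⟩
  have hmem : q ∈ l₂ ++ l₁ ++ [p] := by rw [hq]; simp
  have h2 := h'.2
  rw [hq] at h2
  refine ⟨q, ?_, h2.rel⟩
  simp only [List.mem_append, List.mem_cons, List.not_mem_nil, or_false] at hmem ⊢
  tauto

theorem Cyc.isVertex {P : Finset Pt} {L : List Pt} (h : Cyc P L) {p : Pt} (hp : p ∈ L) :
    IsVertex P p := by
  obtain ⟨q, _, hq⟩ := h.exists_next_mem hp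
  exact hq.isVertex_left

theorem Cyc.exists_prev_mem {P : Finset Pt} {L : List Pt} (h : Cyc P L) {p : Pt} (hp : p ∈ L) :
    ∃ q ∈ L, HullEdge P q p := by
  obtain ⟨l₁, l₂, rfl⟩ := List.append_of_mem hp
  have h' := h.isRotated (isRotated_append_comm l₁ (p :: l₂))
  rw [List.cons_append, cyc_cons] at h'
  obtain ⟨_, h'⟩ := h'
  rcases List.eq_nil_or_concat (l₂ ++ l₁) with h0 | ⟨l, q, h0⟩
  · rw [h0] at h'
    exact ⟨p, by simp, h'.rel⟩
  · have hmem : q ∈ l₂ ++ l₁ := by rw [h0]; simp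
    rw [h0, List.concat_eq_append, List.append_assoc, ← List.cons_append] at h'
    refine ⟨q, ?_, (List.isChain_append.1 h').2.1.rel⟩
    simp only [List.mem_append, List.mem_cons] at hmem ⊢
    tauto

/-- Let `u` be a direction in which the vertex `x` is strictly least, and let `p` be least in this
direction among the listed points. The two edges at `p` confine `x` to the cone spanned by the
neighbours of `p`, on which `dot u` is at least `dot u p`. -/
theorem Cyc.mem_of_isVertex {P : Finset Pt} {L : List Pt} (h : Cyc P L) {x : Pt}
    (hx : IsVertex P x) : x ∈ L := by
  classical
  by_contra hxL
  obtain ⟨_, u, hu⟩ := id hx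
  obtain ⟨p, hp, hmin⟩ := Finset.exists_min_image L.toFinset (dot u)
    (by simpa [Finset.nonempty_iff_ne_empty] using h.1)
  simp only [List.mem_toFinset] at hp hmin
  obtain ⟨q, hq, hpq⟩ := h.exists_next_mem hp
  obtain ⟨w, hw, hwp⟩ := h.exists_prev_mem hp
  have hxp : x ≠ p := fun e => hxL (e ▸ hp)
  have hxq : x ≠ q := fun e => hxL (e ▸ hq)
  have hxw : x ≠ w := fun e => hxL (e ▸ hw)
  have o1 := hpq.orient_pos hx hxp hxq
  have o2 := hwp.orient_pos hx hxw hxp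
  by_cases hpq' : q = p
  · subst hpq'; exact hxp (hpq.eq_of_self hx.1)
  by_cases hwp' : w = p
  · subst hwp'; exact hxp (hwp.eq_of_self hx.1)
  by_cases hwq : w = q
  · subst hwq
    have e : orient w p x = -orient p w x := by simp only [orient]; ring
    linarith
  have o3 := hpq.orient_pos (h.isVertex hw) hwp' hwq
  have a1 := hmin q hq
  have a2 := hmin w hw
  have a3 := hu p (h.isVertex hp).1 (Ne.symm hxp)
  -- Cramer's rule: `x - p` as a combination of `q - p` and `w - p`, evaluated by `dot u`.
  have key : orient p q w * (dot u x - dot u p) =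
      orient w p x * (dot u q - dot u p) + orient p q x * (dot u w - dot u p) := by
    simp only [orient, dot]; ring
  have b1 := mul_nonneg o2.le (sub_nonneg.2 a1)
  have b2 := mul_nonneg o1.le (sub_nonneg.2 a2)
  have b3 := mul_pos o3 (sub_pos.2 a3)
  linarith

theorem Cyc.mem_iff {P : Finset Pt} {L : List Pt} (h : Cyc P L) {x : Pt} :
    x ∈ L ↔ x ∈ hullVertices P :=
  ⟨fun hx => mem_hullVertices.2 (h.isVertex hx),
    fun hx => h.mem_of_isVertex (mem_hullVertices.1 hx)⟩

/-- The Plücker relation of four directions at `a`. It makes the angular order around `a` transitive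
in the open halfplane to the left of `a t`. -/
theorem orient_plucker (a t x y z : Pt) : orient a t y * orient a x z =
    orient a t x * orient a y z + orient a x y * orient a t z := by
  simp only [orient]; ring

theorem orient_pairwise {P : Finset Pt} {a t : Pt} : ∀ {s : List Pt},
    List.IsChain (HullEdge P) s → (∀ x ∈ s, x ≠ a ∧ 0 < orient a t x) → IsVertex P a →
    s.Pairwise (fun x y => 0 < orient a x y)
  | [], _, _, _ => List.Pairwise.nil
  | [x], _, _, _ => List.pairwise_singleton _ _
  | x :: y :: s, hc, hs, ha => by
    have ih := orient_pairwise hc.tail (fun z hz => hs z (List.mem_cons_of_mem _ hz)) ha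
    have hxy : 0 < orient a x y := by
      rw [← orient_rotate]
      exact hc.rel.orient_pos ha (hs x (by simp)).1.symm (hs y (by simp)).1.symm
    refine List.pairwise_cons.2 ⟨fun z hz => ?_, ih⟩
    rcases List.mem_cons.1 hz with rfl | hz'
    · exact hxy
    have h1 := (List.pairwise_cons.1 ih).1 z hz'
    have h2 := orient_plucker a t x y z
    have h3 := (hs x (by simp)).2
    have h4 := (hs y (by simp)).2
    have h5 := (hs z (by simp [hz'])).2
    have h6 : 0 < orient a t y * orient a x z := by rw [h2]; positivity
    exact pos_of_mul_pos_right h6 h4.le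

theorem Cyc.isChain {P : Finset Pt} {L : List Pt} (h : Cyc P L) : List.IsChain (HullEdge P) L := by
  cases L with
  | nil => simp
  | cons a l =>
    have := (cyc_cons.1 h).2
    rw [← List.cons_append] at this
    exact (List.isChain_append.1 this).1

/-- Seen from `a`, consecutive points turn left because `a` is on the left of their edge. The edge
that starts at `a` has all later vertices strictly on its left, so by `orient_pairwise` the left
turns of consecutive points extend to all pairs. -/
theorem Cyc.ccw {P : Finset Pt} {L : List Pt} (h : Cyc P L) : Ccw L := by
  intro a b c hs
  obtain ⟨l₁, l₂, h1, h2, h3⟩ := List.cons_sublist_iff.1 hs |> fun ⟨r₁, r₂, e, m, s⟩ =>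
    (⟨r₁, r₂, e, m, s⟩ : ∃ r₁ r₂, L = r₁ ++ r₂ ∧ a ∈ r₁ ∧ [b, c].Sublist r₂)
  obtain ⟨k₁, k₂, rfl⟩ := List.append_of_mem h2
  subst h1
  have hc := h.isChain
  have hnd := h.2.1
  rw [List.append_assoc, List.cons_append] at hc hnd
  have hc' := (List.isChain_append.1 hc).2.1
  have hnd' := hnd.of_append_right
  have hs' : [b, c].Sublist (k₂ ++ l₂) := h3.trans (List.sublist_append_right _ _)
  have hv : ∀ x ∈ k₂ ++ l₂, IsVertex P x := by
    intro x hx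
    apply h.isVertex
    simp only [List.mem_append, List.mem_cons] at hx ⊢
    tauto
  have ha : IsVertex P a := h.isVertex (by simp)
  generalize k₂ ++ l₂ = t at *
  cases t with
  | nil => simp at hs'
  | cons t s =>
    have hrel : HullEdge P a t := hc'.rel
    have hpos : ∀ x ∈ s, x ≠ a ∧ 0 < orient a t x := by
      intro x hx
      have hxa : x ≠ a := by
        rintro rfl
        simp [hx] at hnd'
      refine ⟨hxa, hrel.orient_pos (hv x (by simp [hx])) hxa ?_⟩
      rintro rfl
      simp [hx] at hnd'
    have hp := orient_pairwise hc'.tail.tail hpos ha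
    have hp' : (t :: s).Pairwise (fun x y => 0 < orient a x y) :=
      List.pairwise_cons.2 ⟨fun x hx => (hpos x hx).2, hp⟩
    exact List.pairwise_iff_forall_sublist.1 hp' hs'

/-- An edge is determined by the position of the vertices. -/
theorem HullEdge.of_vertices {P : Finset Pt} {p q : Pt} (hp : IsVertex P p) (hq : IsVertex P q)
    (h : ∀ r, IsVertex P r → r ≠ p → r ≠ q → 0 < orient p q r)
    (hpq : p = q → ∀ r, IsVertex P r → r = p) : HullEdge P p q := by
  obtain ⟨q', hq'⟩ := hp.exists_next
  by_cases e : q = q'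
  · rw [e]; exact hq'
  exfalso
  by_cases e1 : q' = p
  · subst e1; exact e (hq'.eq_of_self hq.1)
  by_cases e2 : p = q
  · exact e1 (hpq e2 q' hq'.isVertex_right)
  have h1 := h q' hq'.isVertex_right e1 (Ne.symm e)
  have h2 := hq'.orient_pos hq (Ne.symm e2) e
  rw [orient_swap] at h2
  linarith

/-- Cyclic invariance of the orientation places every other vertex to the left of each consecutive
pair, and `HullEdge.of_vertices` extends this from the vertices to all points. The induction over
suffixes includes the closing pair, which returns to `a`. -/
theorem IsBoundaryList.isChain {P : Finset Pt} {a : Pt} {l : List Pt}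
    (h : IsBoundaryList (hullVertices P) (a :: l)) : ∀ (s l₁ : List Pt), a :: l = l₁ ++ s →
    s ≠ [] → List.IsChain (HullEdge P) (s ++ [a]) := by
  have hv : ∀ {x : Pt}, x ∈ a :: l ↔ IsVertex P x := by
    intro x; rw [h.mem_iff, mem_hullVertices]
  intro s
  induction s with
  | nil => intro _ _ h; exact absurd rfl h
  | cons x s ih =>
    intro l₁ hl _
    have hx : IsVertex P x := hv.1 (by rw [hl]; simp)
    cases s with
    | nil =>
      simp only [List.cons_append, List.nil_append, List.isChain_cons_cons,
        List.isChain_singleton, and_true]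
      refine HullEdge.of_vertices hx (hv.1 (by simp)) (fun r hr h1 h2 => ?_) (fun e r hr => ?_)
      · have hr' := hv.2 hr
        cases l₁ with
        | nil =>
          rw [hl] at hr'
          simp at hr'
          exact absurd hr' h1
        | cons b l₁ =>
          simp only [List.cons_append, List.cons.injEq] at hl
          obtain ⟨rfl, rfl⟩ := hl
          rw [← orient_rotate]
          refine h.ccw a r x (List.Sublist.cons_cons _ ?_)
          have : r ∈ l₁ := by
            simp only [List.mem_cons, List.mem_append, List.not_mem_nil, or_false] at hr'
            tauto
          exact (List.singleton_sublist.2 this).append (List.Sublist.refl _)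
      · have hr' := hv.2 hr
        cases l₁ with
        | nil => rw [hl] at hr'; simpa using hr'
        | cons b l₁ =>
          simp only [List.cons_append, List.cons.injEq] at hl
          obtain ⟨rfl, rfl⟩ := hl
          have := h.nodup
          simp [e] at this
    | cons y s =>
      have ih' := ih (l₁ ++ [x]) (by rw [hl]; simp) (by simp)
      simp only [List.cons_append, List.isChain_cons_cons] at ih' ⊢
      refine ⟨?_, ih'⟩
      have hnd := h.nodup
      rw [hl] at hnd
      refine HullEdge.of_vertices hx (hv.1 (by rw [hl]; simp)) (fun r hr h1 h2 => ?_)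
        (fun e r hr => ?_)
      · have hr' := hv.2 hr
        rw [hl] at hr'
        have hccw := h.ccw
        rw [hl] at hccw
        simp only [List.mem_append, List.mem_cons] at hr'
        rcases hr' with hr' | rfl | rfl | hr'
        · rw [orient_rotate]
          exact hccw r x y ((List.singleton_sublist.2 hr').append
            (by simp))
        · exact absurd rfl h1
        · exact absurd rfl h2
        · refine hccw x y r (List.Sublist.trans ?_ (List.sublist_append_right _ _))
          exact ((List.singleton_sublist.2 hr').cons_cons y).cons_cons x
      · subst e
        exfalso
        have := hnd.of_append_right
        simp at this

theorem IsBoundaryList.cyc {P : Finset Pt} {L : List Pt} (h : IsBoundaryList (hullVertices P) L)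
    (hL : L ≠ []) : Cyc P L := by
  cases L with
  | nil => exact absurd rfl hL
  | cons a l => exact cyc_cons.2 ⟨h.nodup, h.isChain (a :: l) [] rfl (by simp)⟩

theorem Cyc.isBoundaryList {P : Finset Pt} {L : List Pt} (h : Cyc P L)
    (hs : ∀ p ∈ L.head?, ∀ q ∈ L, toLex p ≤ toLex q) : IsBoundaryList (hullVertices P) L where
  nodup := h.2.1
  mem_iff _ := h.mem_iff
  ccw := h.ccw
  start p hp q hq := hs p hp q (h.mem_iff.2 hq)

/-- A closed halfplane that contains the vertices contains all points. -/
theorem Cyc.dot_le {P : Finset Pt} {L : List Pt} (h : Cyc P L) {u : Pt} {c : ℝ}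
    (hc : ∀ p ∈ L, c ≤ dot u p) {p : Pt} (hp : p ∈ P) : c ≤ dot u p := by
  have hK : Convex ℝ {z : Pt | c ≤ dot u z} := by
    intro x hx y hy a b ha hb hab
    simp only [Set.mem_ofPred_eq] at *
    rw [dot_combo]
    have : c = a * c + b * c := by rw [← add_mul, hab, one_mul]
    nlinarith
  exact convexHull_min (fun x hx => hc x (h.mem_iff.2 (by exact_mod_cast hx))) hK
    (subset_convexHull_hullVertices P (by exact_mod_cast hp))

theorem Cyc.length_le {P : Finset Pt} {L : List Pt} (h : Cyc P L) : L.length ≤ P.card := by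
  classical
  rw [← List.toFinset_card_of_nodup h.2.1]
  exact Finset.card_le_card fun x hx => (h.isVertex (List.mem_toFinset.1 hx)).1

/-- The edges of a subset that are followed from a vertex remain edges as long as the next
vertices belong to the subset. -/
theorem isChain_of_next_mem {S T : Finset Pt} (hST : S ⊆ T) : ∀ {l : List Pt} {y : Pt},
    List.IsChain (HullEdge S) (l ++ [y]) → (∀ p ∈ (l ++ [y]).head?, IsVertex T p) →
    (∀ p ∈ l, IsVertex T p → ∃ q ∈ S, HullEdge T p q) → List.IsChain (HullEdge T) (l ++ [y])
  | [], _, _, _, _ => by simp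
  | [x], y, hc, hv, hl => by
    simp only [List.cons_append, List.nil_append, List.isChain_cons_cons, List.isChain_singleton,
      and_true] at hc ⊢
    obtain ⟨q, hq, hxq⟩ := hl x (by simp) (hv x (by simp))
    have := hc.right_unique (hxq.mono hST hc.1 hq)
    rwa [this]
  | x :: z :: l, y, hc, hv, hl => by
    simp only [List.cons_append, List.isChain_cons_cons] at hc ⊢
    obtain ⟨q, hq, hxq⟩ := hl x (by simp) (hv x (by simp))
    have he := hc.1.right_unique (hxq.mono hST hc.1.1 hq)
    subst he
    refine ⟨hxq, ?_⟩
    have := isChain_of_next_mem hST (l := z :: l) (y := y) (by simpa using hc.2)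
      (by simpa using hxq.isVertex_right) (fun p hp => hl p (by simp [hp]))
    simpa using this

/-! ### Unimodality of convex polygons -/

/-- The diagonals of a convex quadrilateral cross, so a positive combination of `a` and `c` equals
one of `b` and `d`, with areas of triangles as weights. An affine function cannot be positive at
both ends of one diagonal and nonpositive at both ends of the other; lexicographic pairs are treated
one component at a time. Only the comparison with a fixed base point has to be affine, which admits
angular orders as well. -/
theorem Ccw.unimodal {L : List Pt} (hc : Ccw L) {key : Pt → ℝ ×ₗ ℝ} {α β : Pt → Pt → ℝ}
    (hα : ∀ p, ∃ k₀ k₁ k₂ : ℝ, ∀ q : Pt, α p q = k₀ + k₁ * q.1 + k₂ * q.2)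
    (hβ : ∀ p, ∃ k₀ k₁ k₂ : ℝ, ∀ q : Pt, β p q = k₀ + k₁ * q.1 + k₂ * q.2)
    (h : ∀ p ∈ L, ∀ q ∈ L, key p < key q ↔ 0 < α p q ∨ (α p q = 0 ∧ 0 < β p q)) :
    Unimodal key L := by
  have main : ∀ {t a c b d : Pt} {w₁ w₂ w₃ w₄ : ℝ}, t ∈ L → a ∈ L → c ∈ L → b ∈ L → d ∈ L →
      0 < w₁ → 0 < w₂ → 0 < w₃ → 0 < w₄ →
      (∀ k₀ k₁ k₂ : ℝ, w₁ * (k₀ + k₁ * a.1 + k₂ * a.2) + w₂ * (k₀ + k₁ * c.1 + k₂ * c.2) =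
        w₃ * (k₀ + k₁ * b.1 + k₂ * b.2) + w₄ * (k₀ + k₁ * d.1 + k₂ * d.2)) →
      ¬ key t < key a → ¬ key t < key c → key t < key b → key t < key d → False := by
    intro t a c b d w₁ w₂ w₃ w₄ ht ha hc hb hd h1 h2 h3 h4 hw ka kc kb kd
    rw [h t ht a ha, not_or, not_lt] at ka
    rw [h t ht c hc, not_or, not_lt] at kc
    rw [h t ht b hb] at kb
    rw [h t ht d hd] at kd
    obtain ⟨k₀, k₁, k₂, hk⟩ := hα t
    obtain ⟨m₀, m₁, m₂, hm⟩ := hβ t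
    have e1 := hw k₀ k₁ k₂
    have e2 := hw m₀ m₁ m₂
    rw [← hk, ← hk, ← hk, ← hk] at e1
    rw [← hm, ← hm, ← hm, ← hm] at e2
    have nb : 0 ≤ α t b := by rcases kb with h | h <;> linarith [h]
    have nd : 0 ≤ α t d := by rcases kd with h | h <;> linarith [h]
    have i1 := mul_nonneg h3.le nb
    have i2 := mul_nonneg h4.le nd
    have i3 := mul_nonneg h1.le (neg_nonneg.2 ka.1)
    have i4 := mul_nonneg h2.le (neg_nonneg.2 kc.1)
    have z1 : α t a = 0 := by
      have : w₁ * α t a = 0 := by linarith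
      exact (mul_eq_zero.1 this).resolve_left h1.ne'
    have z2 : α t c = 0 := by
      have : w₂ * α t c = 0 := by linarith
      exact (mul_eq_zero.1 this).resolve_left h2.ne'
    have z3 : α t b = 0 := by
      have : w₃ * α t b = 0 := by linarith
      exact (mul_eq_zero.1 this).resolve_left h3.ne'
    have z4 : α t d = 0 := by
      have : w₄ * α t d = 0 := by linarith
      exact (mul_eq_zero.1 this).resolve_left h4.ne'
    have b1 : β t a ≤ 0 := not_lt.1 fun hh => ka.2 ⟨z1, hh⟩
    have b2 : β t c ≤ 0 := not_lt.1 fun hh => kc.2 ⟨z2, hh⟩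
    have b3 : 0 < β t b := by
      rcases kb with h | h
      · linarith
      · exact h.2
    have b4 : 0 < β t d := by
      rcases kd with h | h
      · linarith
      · exact h.2
    have j1 := mul_pos h3 b3
    have j2 := mul_pos h4 b4
    have j3 := mul_nonneg h1.le (neg_nonneg.2 b1)
    have j4 := mul_nonneg h2.le (neg_nonneg.2 b2)
    linarith
  intro a b c d hs
  have hmem : ∀ x ∈ [a, b, c, d], x ∈ L := hs.subset
  have ha := hmem a (by simp)
  have hb := hmem b (by simp)
  have hcm := hmem c (by simp)
  have hd := hmem d (by simp)
  have o1 : 0 < orient a b c := hc a b c ((by simp : [a, b, c].Sublist [a, b, c, d]).trans hs)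
  have o2 : 0 < orient a b d := hc a b d ((by simp : [a, b, d].Sublist [a, b, c, d]).trans hs)
  have o3 : 0 < orient a c d := hc a c d ((by simp : [a, c, d].Sublist [a, b, c, d]).trans hs)
  have o4 : 0 < orient b c d := hc b c d ((by simp : [b, c, d].Sublist [a, b, c, d]).trans hs)
  have hw : ∀ k₀ k₁ k₂ : ℝ,
      orient b c d * (k₀ + k₁ * a.1 + k₂ * a.2) + orient a b d * (k₀ + k₁ * c.1 + k₂ * c.2) =
      orient a c d * (k₀ + k₁ * b.1 + k₂ * b.2) + orient a b c * (k₀ + k₁ * d.1 + k₂ * d.2) := by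
    intro k₀ k₁ k₂
    simp only [orient]; ring
  constructor
  · rintro ⟨h1, h2, h3, h4⟩
    -- The base point of the comparison is the greater one of the two low points; then neither of
    -- them is above the base, while both high points are.
    rcases le_total (key a) (key c) with hle | hle
    · exact main hcm ha hcm hb hd o4 o2 o3 o1 hw (not_lt.2 hle) (lt_irrefl _) h3 h4
    · exact main ha ha hcm hb hd o4 o2 o3 o1 hw (lt_irrefl _) (not_lt.2 hle) h1 h2
  · rintro ⟨h1, h2, h3, h4⟩
    have hw' := fun k₀ k₁ k₂ => (hw k₀ k₁ k₂).symm
    rcases le_total (key b) (key d) with hle | hle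
    · exact main hd hb hd ha hcm o3 o1 o4 o2 hw' (not_lt.2 hle) (lt_irrefl _) h3 h4
    · exact main hb hb hd ha hcm o3 o1 o4 o2 hw' (lt_irrefl _) (not_lt.2 hle) h1 h2

/-- Lexicographic comparison by two linear functionals. -/
def lexKey (f g p : Pt) : ℝ ×ₗ ℝ := toLex (dot f p, dot g p)

theorem lexKey_lt_iff {f g p q : Pt} : lexKey f g p < lexKey f g q ↔
    0 < dot f (q - p) ∨ (dot f (q - p) = 0 ∧ 0 < dot g (q - p)) := by
  rw [lexKey, lexKey, toLex_lt_toLex', dot_sub, dot_sub, sub_pos, sub_pos, sub_eq_zero,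
    eq_comm (a := dot f p)]

theorem lexKey_inj {f g p q : Pt} (hfg : cross f g ≠ 0) (h : lexKey f g p = lexKey f g q) :
    p = q := by
  have h1 : dot f p = dot f q := congrArg (fun z : ℝ ×ₗ ℝ => (ofLex z).1) h
  have h2 : dot g p = dot g q := congrArg (fun z : ℝ ×ₗ ℝ => (ofLex z).2) h
  simp only [dot] at h1 h2
  have e1 : cross f g * (p.1 - q.1) = 0 := by
    simp only [cross]; linear_combination g.2 * h1 - f.2 * h2
  have e2 : cross f g * (p.2 - q.2) = 0 := by
    simp only [cross]; linear_combination f.1 * h2 - g.1 * h1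
  exact Prod.ext (sub_eq_zero.1 ((mul_eq_zero.1 e1).resolve_left hfg))
    (sub_eq_zero.1 ((mul_eq_zero.1 e2).resolve_left hfg))

open Classical in
theorem pev_cmpBody {env : List Val} {α β : Expr} {a b : ℝ} (hα : pev env α = some (.num a))
    (hβ : pev env β = some (.num b)) :
    pev env (cmpBody α β) = some (flag (decide (0 < a ∨ (a = 0 ∧ 0 < b)))) := by
  by_cases h1 : 0 < a
  · simp [cmpBody, pev, hα, h1, yes, flag]
  by_cases h2 : a < 0
  · simp [cmpBody, pev, hα, h1, h2, flag, h2.ne]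
  have h3 : a = 0 := le_antisymm (not_lt.1 h1) (not_lt.1 h2)
  by_cases h4 : 0 < b <;> simp [cmpBody, pev, hα, hβ, h3, h4, yes, flag]

theorem affine_exists_dot (f p : Pt) :
    ∃ k₀ k₁ k₂ : ℝ, ∀ q : Pt, dot f (q - p) = k₀ + k₁ * q.1 + k₂ * q.2 :=
  ⟨-dot f p, f.1, f.2, fun q => by rw [dot_sub]; simp only [dot]; ring⟩

theorem affine_exists_dot' (p x : Pt) :
    ∃ k₀ k₁ k₂ : ℝ, ∀ q : Pt, dot (q - p) (x - p) = k₀ + k₁ * q.1 + k₂ * q.2 :=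
  ⟨-dot p (x - p), (x - p).1, (x - p).2, fun q => by
    simp only [dot, Prod.fst_sub, Prod.snd_sub]; ring⟩

theorem affine_exists_orient (x p : Pt) :
    ∃ k₀ k₁ k₂ : ℝ, ∀ q : Pt, orient x p q = k₀ + k₁ * q.1 + k₂ * q.2 :=
  ⟨-(p.1 - x.1) * x.2 + (p.2 - x.2) * x.1, -(p.2 - x.2), p.1 - x.1, fun q => by
    simp only [orient]; ring⟩

section

variable {env : List Val} {N : ℕ} {L : List Pt} {v : Val} {e₁ e₂ : Expr} {s₁ s₂ : ℕ}

theorem findLex_spec (H : Rep L v) (hL : L ≠ []) (hnd : L.Nodup) (hc : Ccw L) (hN : L.length ≤ N)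
    {f g : Pt} (hfg : cross f g ≠ 0) (he₁ : Ev prog env e₁ v s₁)
    (he₂ : Ev prog env e₂ (.pair (encodePt f) (encodePt g)) s₂) :
    ∃ m ∈ L, (∀ q ∈ L, lexKey f g m ≤ lexKey f g q) ∧
      Ev prog env (mk2 9 e₁ e₂) (encodePt m) (s₁ + s₂ + 12000 * lam N) := by
  classical
  obtain ⟨t, hb, rfl, rfl⟩ := H.exists_tree hL
  obtain ⟨m, h1, h2, h3⟩ := find_body_spec (self := 9) (cmp := 6) rfl rfl
    (par := .pair (encodePt f) (encodePt g)) (lexKey f g) (t := t)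
    (fun p _ q _ => by
      refine Ev.pure ?_ (by decide)
      rw [decide_eq_decide.2 (lexKey_lt_iff (f := f) (g := g) (p := p) (q := q))]
      exact pev_cmpBody rfl rfl)
    (fun p _ q _ h => lexKey_inj hfg h) hnd
    (hc.unimodal (affine_exists_dot f) (affine_exists_dot g) fun _ _ _ _ => lexKey_lt_iff)
  refine ⟨m, h1, h2, (Ev.call (f := 9) (Ev.pair he₁ he₂) rfl h3).mono ?_⟩
  have := PTree.height_lt hb hN
  rw [show Nat.log 2 N + 1 = lam N from rfl] at this
  have := one_le_lam N
  omega

theorem findAngR_spec (H : Rep L v) (hL : L ≠ []) (hnd : L.Nodup) (hc : Ccw L)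
    (hN : L.length ≤ N) {u x : Pt} (hu : ∀ p ∈ L, dot u x < dot u p)
    (he₁ : Ev prog env e₁ v s₁) (he₂ : Ev prog env e₂ (encodePt x) s₂) :
    ∃ m ∈ L, (∀ q ∈ L, angKey 1 u x m ≤ angKey 1 u x q) ∧
      Ev prog env (mk2 10 e₁ e₂) (encodePt m) (s₁ + s₂ + 12000 * lam N) := by
  classical
  obtain ⟨t, hb, rfl, rfl⟩ := H.exists_tree hL
  obtain ⟨m, h1, h2, h3⟩ := find_body_spec (self := 10) (cmp := 7) rfl rfl
    (par := encodePt x) (angKey 1 u x) (t := t)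
    (fun p hp q hq => by
      refine Ev.pure ?_ (by decide)
      rw [decide_eq_decide.2 (angKey_one_lt_iff (hu p hp) (hu q hq))]
      exact pev_cmpBody rfl rfl)
    (fun p hp q hq h => angKey_inj one_ne_zero (hu p hp) (hu q hq) h) hnd
    (hc.unimodal (affine_exists_orient x) (fun p => affine_exists_dot' p x)
      fun p hp q hq => angKey_one_lt_iff (hu p hp) (hu q hq))
  refine ⟨m, h1, h2, (Ev.call (f := 10) (Ev.pair he₁ he₂) rfl h3).mono ?_⟩
  have := PTree.height_lt hb hN
  rw [show Nat.log 2 N + 1 = lam N from rfl] at this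
  have := one_le_lam N
  omega

theorem findAngL_spec (H : Rep L v) (hL : L ≠ []) (hnd : L.Nodup) (hc : Ccw L)
    (hN : L.length ≤ N) {u x : Pt} (hu : ∀ p ∈ L, dot u x < dot u p)
    (he₁ : Ev prog env e₁ v s₁) (he₂ : Ev prog env e₂ (encodePt x) s₂) :
    ∃ m ∈ L, (∀ q ∈ L, angKey (-1) u x m ≤ angKey (-1) u x q) ∧
      Ev prog env (mk2 11 e₁ e₂) (encodePt m) (s₁ + s₂ + 12000 * lam N) := by
  classical
  obtain ⟨t, hb, rfl, rfl⟩ := H.exists_tree hL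
  have hα : ∀ p, ∃ k₀ k₁ k₂ : ℝ, ∀ q : Pt, orient x q p = k₀ + k₁ * q.1 + k₂ * q.2 := fun p => by
    obtain ⟨k₀, k₁, k₂, h⟩ := affine_exists_orient x p
    exact ⟨-k₀, -k₁, -k₂, fun q => by rw [orient_swap, h]; ring⟩
  obtain ⟨m, h1, h2, h3⟩ := find_body_spec (self := 11) (cmp := 8) rfl rfl
    (par := encodePt x) (angKey (-1) u x) (t := t)
    (fun p hp q hq => by
      refine Ev.pure ?_ (by decide)
      rw [decide_eq_decide.2 (angKey_neg_one_lt_iff (hu p hp) (hu q hq))]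
      exact pev_cmpBody rfl rfl)
    (fun p hp q hq h => angKey_inj (by norm_num) (hu p hp) (hu q hq) h) hnd
    (hc.unimodal (α := fun p q => orient x q p) hα (fun p => affine_exists_dot' p x)
      fun p hp q hq => angKey_neg_one_lt_iff (hu p hp) (hu q hq))
  refine ⟨m, h1, h2, (Ev.call (f := 11) (Ev.pair he₁ he₂) rfl h3).mono ?_⟩
  have := PTree.height_lt hb hN
  rw [show Nat.log 2 N + 1 = lam N from rfl] at this
  have := one_le_lam N
  omega

end

section

variable {env : List Val} {N : ℕ} {v : Val} {e₁ e₂ : Expr} {s₁ s₂ : ℕ}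

theorem normalize_spec {P : Finset Pt} {L : List Pt} (h : Cyc P L) (H : Rep L v)
    (hN : L.length ≤ N) (he : Ev prog env e₁ v s₁) :
    ∃ L' w, IsBoundaryList (hullVertices P) L' ∧ L' ≠ [] ∧ Rep L' w ∧
      Ev prog env (.call 14 e₁) w (s₁ + 100000 * lam N) := by
  have g2 := one_le_lam N
  obtain ⟨m, h1, h2, h3⟩ := findLex_spec (env := [v]) (e₁ := var 0)
    (e₂ := .pair (.pair (.const 1) (.const 0)) (.pair (.const 0) (.const 1)))
    H h.1 h.2.1 h.ccw hN (f := (((1 : ℤ) : ℝ), ((0 : ℤ) : ℝ)))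
    (g := (((0 : ℤ) : ℝ), ((1 : ℤ) : ℝ))) (by simp [cross])
    (Ev.pure rfl (t := 10) (by decide)) (Ev.pure rfl (t := 20) (by decide))
  obtain ⟨K, w, k1, k2, k3⟩ := startAt_spec (env := [v]) (e₁ := var 0) H h1 h.ccw hN
    (Ev.pure rfl (t := 10) (by decide)) h3
  refine ⟨m :: K, w, (h.isRotated k1.symm).isBoundaryList ?_, by simp, k2,
    (Ev.call (f := 14) he rfl k3).mono (by omega)⟩
  intro p hp q hq
  simp only [List.head?_cons, Option.mem_def, Option.some.injEq] at hp
  subst hp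
  have := h2 q (k1.mem_iff.1 hq)
  simpa [lexKey, dot] using this

end

/-! ### Frames -/

/-- The direction `u` rotated by a right angle. -/
def perp (u : Pt) : Pt := (-u.2, u.1)

theorem dot_perp (u p : Pt) : dot (perp u) p = cross u p := by simp only [dot, cross, perp]; ring

/-- The coordinates `(dot u, cross u)` are a rotation combined with a scaling, so all areas are
multiplied by `dot u u`. Since only signs matter, `u` is never normalized and no square root is
needed. -/
theorem frame_orient (u a b c : Pt) :
    (dot u b - dot u a) * (cross u c - cross u a) - (cross u b - cross u a) * (dot u c - dot u a) =
      dot u u * orient a b c := by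
  simp only [dot, cross, orient]; ring

theorem frame_ext {u p q : Pt} (hu : 0 < dot u u) (h1 : dot u p = dot u q)
    (h2 : cross u p = cross u q) : p = q := by
  refine lexKey_inj (f := u) (g := perp u) ?_ ?_
  · have : cross u (perp u) = dot u u := by simp only [dot, cross, perp]; ring
    rw [this]; exact hu.ne'
  · rw [lexKey, lexKey, dot_perp, dot_perp, h1, h2]

/-- The lower chain of the convex hull of `P` in the frame with first axis `u`. -/
structure LowerChain (P : Finset Pt) (u : Pt) (D : List Pt) : Prop where
  ne : D ≠ []
  isVertex : ∀ p ∈ D, IsVertex P p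
  mono : D.Pairwise (fun p q => dot u p < dot u q)
  chain : D.IsChain (HullEdge P)
  ccw : Ccw D
  first_le : ∀ p ∈ P, dot u (D.head ne) ≤ dot u p
  le_last : ∀ p ∈ P, dot u p ≤ dot u (D.getLast ne)
  single : ∀ a, D = [a] → ∀ p ∈ P, cross u a ≤ cross u p
  mem : ∀ a, IsVertex P a →
    (∃ s, ∀ q ∈ P, s * (dot u q - dot u a) ≤ cross u q - cross u a) → a ∈ D

theorem lex_le {f g m q : Pt} (h : lexKey f g m ≤ lexKey f g q) :
    dot f m ≤ dot f q ∧ (dot f m = dot f q → dot g m ≤ dot g q) := by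
  rw [← not_lt, lexKey_lt_iff, not_or, not_lt, dot_sub, dot_sub] at h
  refine ⟨by linarith [h.1], fun e => ?_⟩
  by_contra hc
  exact h.2 ⟨by linarith, by linarith⟩

/-- The path runs from the leftmost vertex `p₀` to the rightmost vertex `m`, with ties resolved to
the lowest one. If `q` followed `p` without being farther right, then the convex quadrilateral `p₀ p
q m` would have its extreme abscissas at the wrong corners. The cases `p = p₀` and `q = m` leave a
triangle or a vertical segment, for which the rule for ties is used. -/
theorem lowerChain_mono {L D : List Pt} {u p₀ m : Pt} (hu : 0 < dot u u) (hnd : L.Nodup)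
    (hc : Ccw L) (hsub : D.Sublist L)
    (hp₀ : ∀ q ∈ L, lexKey u (perp u) p₀ ≤ lexKey u (perp u) q)
    (hm : ∀ q ∈ L, lexKey (-u) (perp u) m ≤ lexKey (-u) (perp u) q)
    (hD : ∃ M, D = p₀ :: M) (hD' : ∃ M, D = M ++ [m]) :
    D.Pairwise (fun p q => dot u p < dot u q) := by
  rw [List.pairwise_iff_forall_sublist]
  intro p q hpq
  by_contra hlt
  rw [not_lt] at hlt
  have hneg : ∀ x, dot (-u) x = -dot u x := fun x => by simp [dot]; ring
  have memL : ∀ {x}, x ∈ [p, q] → x ∈ L := fun hx => hsub.subset (hpq.subset hx)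
  have hX0 : ∀ x ∈ L, dot u p₀ ≤ dot u x ∧ (dot u p₀ = dot u x → cross u p₀ ≤ cross u x) := by
    intro x hx
    have := lex_le (hp₀ x hx)
    rwa [dot_perp, dot_perp] at this
  have hXm : ∀ x ∈ L, dot u x ≤ dot u m ∧ (dot u x = dot u m → cross u m ≤ cross u x) := by
    intro x hx
    have := lex_le (hm x hx)
    rw [dot_perp, dot_perp, hneg, hneg] at this
    exact ⟨by linarith [this.1], fun e => this.2 (by linarith)⟩
  have hor : ∀ {a b c}, [a, b, c].Sublist D →
      0 < (dot u b - dot u a) * (cross u c - cross u a) -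
        (cross u b - cross u a) * (dot u c - dot u a) := by
    intro a b c h
    rw [frame_orient]
    exact mul_pos hu (hc a b c (h.trans hsub))
  have hpqne : p ≠ q := by
    rintro rfl
    have := hnd.sublist (hpq.trans hsub)
    simp at this
  have ip := hX0 p (memL (by simp))
  have iq := hX0 q (memL (by simp))
  have jp := hXm p (memL (by simp))
  have jq := hXm q (memL (by simp))
  obtain ⟨M, hM⟩ := hD
  obtain ⟨M', hM'⟩ := hD'
  by_cases hp : p = p₀
  · subst hp
    by_cases hq : q = m
    · subst hq
      have e : dot u p = dot u q := by linarith
      have h1 := iq.2 e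
      have h2 := jp.2 e
      exact hpqne (frame_ext hu e (by linarith))
    · have hs : [p, q, m].Sublist D := by
        have : [p, q].Sublist M' := by
          rw [hM'] at hpq
          obtain ⟨l₁, l₂, h1, h2, h3⟩ := List.sublist_append_iff.1 hpq
          rcases List.sublist_singleton.1 h3 with rfl | rfl
          · rw [List.append_nil] at h1; rwa [h1]
          · have h4 := congrArg List.getLast? h1
            simp at h4
            exact absurd h4 hq
        rw [hM']
        exact this.append (List.Sublist.refl [m])
      have h := hor hs
      have e : dot u q = dot u p := by linarith
      have h1 := iq.2 e.symm
      rw [e, sub_self, zero_mul, zero_sub] at h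
      nlinarith [mul_nonneg (sub_nonneg.2 h1) (sub_nonneg.2 jp.1)]
  · have hpM : [p, q].Sublist M := by
      rw [hM] at hpq
      rcases List.sublist_cons_iff.1 hpq with h | ⟨r, h1, h2⟩
      · exact h
      · simp only [List.cons.injEq] at h1
        exact absurd h1.1 hp
    have hs0 : [p₀, p, q].Sublist D := by rw [hM]; exact hpM.cons_cons _
    by_cases hq : q = m
    · subst hq
      have h := hor hs0
      have e : dot u p = dot u q := by linarith
      have h1 := jp.2 e
      rw [← e] at h
      nlinarith [mul_nonneg (sub_nonneg.2 h1) (sub_nonneg.2 ip.1)]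
    · have hs : [p₀, p, q, m].Sublist D := by
        have : [p₀, p, q].Sublist M' := by
          rw [hM'] at hs0
          obtain ⟨l₁, l₂, h1, h2, h3⟩ := List.sublist_append_iff.1 hs0
          rcases List.sublist_singleton.1 h3 with rfl | rfl
          · rw [List.append_nil] at h1; rwa [h1]
          · have h4 := congrArg List.getLast? h1
            simp at h4
            exact absurd h4 hq
        rw [hM']
        exact this.append (List.Sublist.refl [m])
      have o1 : 0 < orient p₀ p q := hc _ _ _
        (((by simp : [p₀, p, q].Sublist [p₀, p, q, m]).trans hs).trans hsub)
      have o2 : 0 < orient p₀ p m := hc _ _ _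
        (((by simp : [p₀, p, m].Sublist [p₀, p, q, m]).trans hs).trans hsub)
      have o3 : 0 < orient p₀ q m := hc _ _ _
        (((by simp : [p₀, q, m].Sublist [p₀, p, q, m]).trans hs).trans hsub)
      have o4 : 0 < orient p q m := hc _ _ _
        (((by simp : [p, q, m].Sublist [p₀, p, q, m]).trans hs).trans hsub)
      have key : orient p q m * (dot u p₀ - dot u q) =
          orient p₀ q m * (dot u p - dot u q) + orient p₀ p q * (dot u m - dot u q) := by
        simp only [orient, dot]; ring
      have i1 := mul_nonneg o4.le (sub_nonneg.2 iq.1)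
      have i2 := mul_nonneg o3.le (sub_nonneg.2 hlt)
      have i3 := mul_nonneg o1.le (sub_nonneg.2 jq.1)
      have z1 : orient p₀ p q * (dot u m - dot u q) = 0 := by linarith
      have z2 : orient p q m * (dot u q - dot u p₀) = 0 := by linarith
      have y1 := (mul_eq_zero.1 z1).resolve_left o1.ne'
      have y2 := (mul_eq_zero.1 z2).resolve_left o4.ne'
      have h := hor hs0
      have e1 : dot u q = dot u p₀ := by linarith
      have e2 : dot u p = dot u p₀ := by linarith
      rw [e1, e2] at h
      simp at h

/-- The substantial claim is that every vertex on a supporting line from below belongs to the chain.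
If the chain is a single point, then all points have the same abscissa and this point is the lowest.
-/
theorem Cyc.lowerChain {P : Finset Pt} {u p₀ : Pt} {M R : List Pt} (hu : 0 < dot u u)
    (h : Cyc P (p₀ :: M ++ R))
    (hp₀ : ∀ q ∈ p₀ :: M ++ R, lexKey u (perp u) p₀ ≤ lexKey u (perp u) q)
    (hm : ∀ q ∈ p₀ :: M ++ R, lexKey (-u) (perp u) ((p₀ :: M).getLast (by simp)) ≤
      lexKey (-u) (perp u) q) : LowerChain P u (p₀ :: M) := by
  have hneg : ∀ x, dot (-u) x = -dot u x := fun x => by simp [dot]; ring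
  have hX0 : ∀ x ∈ p₀ :: M ++ R,
      dot u p₀ ≤ dot u x ∧ (dot u p₀ = dot u x → cross u p₀ ≤ cross u x) := by
    intro x hx
    have := lex_le (hp₀ x hx)
    rwa [dot_perp, dot_perp] at this
  have hXm : ∀ x ∈ p₀ :: M ++ R, dot u x ≤ dot u ((p₀ :: M).getLast (by simp)) := by
    intro x hx
    have := lex_le (hm x hx)
    rw [hneg, hneg] at this
    linarith [this.1]
  have hlast : ∀ p ∈ P, dot u p ≤ dot u ((p₀ :: M).getLast (by simp)) := by
    intro p hp
    have := h.dot_le (u := -u) (c := -dot u ((p₀ :: M).getLast (by simp)))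
      (fun q hq => by rw [hneg]; linarith [hXm q hq]) hp
    rw [hneg] at this
    linarith
  have hfirst : ∀ p ∈ P, dot u p₀ ≤ dot u p :=
    fun p hp => h.dot_le (fun q hq => (hX0 q hq).1) hp
  refine ⟨by simp, fun p hp => h.isVertex (List.mem_append_left _ hp), ?_, ?_, ?_, hfirst, hlast,
    ?_, ?_⟩
  · exact lowerChain_mono hu h.2.1 h.ccw (List.sublist_append_left _ _) hp₀ hm ⟨M, rfl⟩
      ⟨_, (List.dropLast_append_getLast (by simp)).symm⟩
  · exact (List.isChain_append.1 h.isChain).1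
  · exact h.ccw.sublist (List.sublist_append_left _ _)
  · intro a ha p hp
    simp only [List.cons.injEq] at ha
    obtain ⟨rfl, rfl⟩ := ha
    rw [← dot_perp, ← dot_perp]
    refine h.dot_le (fun q hq => ?_) hp
    rw [dot_perp, dot_perp]
    exact (hX0 q hq).2 (le_antisymm (hX0 q hq).1 (by simpa using hXm q hq))
  · rintro a ha ⟨s, hs⟩
    have haL := h.mem_of_isVertex ha
    rcases List.mem_append.1 haL with haD | haR
    · exact haD
    exfalso
    have hP0 := (h.isVertex (p := p₀) (by simp)).1
    have s0 := hs p₀ hP0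
    have x0 := hX0 a haL
    rcases List.eq_nil_or_concat M with rfl | ⟨M', m, rfl⟩
    · have e : dot u p₀ = dot u a := le_antisymm x0.1 (by simpa using hXm a haL)
      have h1 := x0.2 e
      rw [e, sub_self, mul_zero] at s0
      have := frame_ext hu e (by linarith)
      subst this
      have := h.2.1
      simp at this
      exact this.1 haR
    · rw [List.concat_eq_append] at *
      -- A vertex `a` after `m` is strictly above the chord from `p₀` to `m`. A line through `a`
      -- that supports `P` from below passes below both ends of the chord, hence also below the
      -- chord at the abscissa of `a`.
      have hor := h.ccw p₀ m a (by
        refine List.Sublist.append (l₁ := [p₀, m]) (l₂ := p₀ :: (M' ++ [m])) ?_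
          (List.singleton_sublist.2 haR)
        exact (List.sublist_append_right _ _).cons_cons _)
      have hor' := mul_pos hu hor
      rw [← frame_orient] at hor'
      have sm := hs m (h.isVertex (by simp)).1
      have xm := hXm a haL
      have hgl : (p₀ :: (M' ++ [m])).getLast (by simp) = m := by simp
      rw [hgl] at xm
      have i1 := mul_le_mul_of_nonneg_left s0 (sub_nonneg.2 xm)
      have i2 := mul_le_mul_of_nonneg_left sm (sub_nonneg.2 x0.1)
      nlinarith

section

variable {env : List Val} {N : ℕ} {v : Val} {e₁ e₂ : Expr} {s₁ s₂ : ℕ}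

theorem chain_spec {P : Finset Pt} {L : List Pt} (h : Cyc P L) (H : Rep L v)
    (hN : L.length ≤ N) {u : Pt} (hu : 0 < dot u u) (he₁ : Ev prog env e₁ v s₁)
    (he₂ : Ev prog env e₂ (encodePt u) s₂) :
    ∃ D w, LowerChain P u D ∧ Rep D w ∧ D.length ≤ N ∧
      Ev prog env (mk2 15 e₁ e₂) w (s₁ + s₂ + 200000 * lam N) := by
  have g2 := one_le_lam N
  have hcr : cross u (perp u) = dot u u := by simp only [dot, cross, perp]; ring
  have hcr' : cross (-u) (perp u) = -dot u u := by
    simp only [dot, cross, perp, Prod.fst_neg, Prod.snd_neg]; ring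
  have hz : ((0 : ℤ) : ℝ) - u.2 = -u.2 := by simp
  have hperp : (Val.pair (.num (((0 : ℤ) : ℝ) - u.2)) (.num u.1)) = encodePt (perp u) := by
    rw [hz]; rfl
  have hnegu : (Val.pair (.num (((0 : ℤ) : ℝ) - u.1)) (.num (((0 : ℤ) : ℝ) - u.2))) =
      encodePt (-u) := by simp [encodePt]
  obtain ⟨m, h1, h2, h3⟩ := findLex_spec (env := [.pair v (encodePt u)]) (e₁ := fst (var 0))
    (e₂ := .pair (snd (var 0)) (.pair (.sub (.const 0) (snd (snd (var 0)))) (fst (snd (var 0)))))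
    H h.1 h.2.1 h.ccw hN (f := u) (g := perp u) (by rw [hcr]; exact hu.ne')
    (Ev.pure rfl (t := 10) (by decide))
    (by rw [← hperp]; exact (Ev.pure rfl (t := 20) (by decide)))
  obtain ⟨K, w, k1, k2, k3⟩ := startAt_spec (env := [.pair v (encodePt u)]) (e₁ := fst (var 0))
    H h1 h.ccw hN (Ev.pure rfl (t := 10) (by decide)) h3
  have hK := h.isRotated k1.symm
  have hKN : (m :: K).length ≤ N := by rw [k1.perm.length_eq]; exact hN
  obtain ⟨t, ht, htl, rfl⟩ := k2.exists_tree (by simp)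
  have htf : t.first = m := by
    have := t.head?_toList
    rw [htl] at this
    simpa using this.symm
  obtain ⟨m', h1', h2', h3'⟩ := findLex_spec (env := [t.encode, .pair v (encodePt u)])
    (e₁ := var 0) (e₂ := .pair (negE (snd (var 1)))
      (.pair (.sub (.const 0) (snd (snd (var 1)))) (fst (snd (var 1)))))
    k2 hK.1 hK.2.1 hK.ccw hKN (f := -u) (g := perp u) (by rw [hcr']; exact neg_ne_zero.2 hu.ne')
    (Ev.pure rfl (t := 10) (by decide))
    (by rw [← hperp, ← hnegu]; exact (Ev.pure rfl (t := 30) (by decide)))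
  have hsp : ∃ M K', K = M ++ K' ∧ (m :: M).getLast (by simp) = m' := by
    rcases List.mem_cons.1 h1' with rfl | h
    · exact ⟨[], K, rfl, rfl⟩
    · obtain ⟨M, K', rfl⟩ := List.append_of_mem h
      exact ⟨M ++ [m'], K', by simp, by simp⟩
  obtain ⟨M, K', rfl, hl⟩ := hsp
  rw [← List.cons_append] at hK
  have pf : pev [encodePt m', t.encode, .pair v (encodePt u)] (firstLeaf (var 1)) =
      some (encodePt m) := by
    rw [← htf]; exact pev_firstLeaf rfl
  obtain ⟨w₁, w₂, q1, q2, q3⟩ := splitAfter_spec (N := N) (a := m) (y := m') (M := M) (K := K')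
    (env := [encodePt m', t.encode, .pair v (encodePt u)]) (e₁ := var 1)
    (e₂ := .pair (firstLeaf (var 1)) (var 0)) (v := t.encode)
    (by simpa using k2) hl hK.2.1 hK.ccw (by simpa using hKN)
    (Ev.pure rfl (t := 10) (by decide)) (Ev.pure (pev_pair pf rfl) (t := 50) (by decide))
  refine ⟨m :: M, w₁, hK.lowerChain hu (fun q hq => ?_) (fun q hq => ?_), q1, ?_,
    (Ev.call (f := 15) (Ev.pair he₁ he₂) rfl (Ev.bind k3 (Ev.bind h3' (Ev.fst q3)))).mono
      (by omega)⟩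
  · exact h2 q (k1.mem_iff.1 (by simpa using hq))
  · rw [hl]; exact h2' q (by simpa using hq)
  · simp only [List.length_cons, List.length_append] at hKN ⊢; omega

end

/-! ### The bridge of two chains -/

section

variable {env : List Val} {e₁ e₂ : Expr} {p q : Pt}

theorem pev_rotE (h₁ : pev env e₁ = some (encodePt p)) (h₂ : pev env e₂ = some (encodePt q)) :
    pev env (rotE e₁ e₂) = some (encodePt (dot p q, cross p q)) := by
  simp [rotE, dotE, pev, h₁, h₂, encodePt, dot, cross]

theorem pev_slopeE (h₁ : pev env e₁ = some (encodePt p)) (h₂ : pev env e₂ = some (encodePt q))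
    (h : p.1 ≠ q.1) : pev env (slopeE e₁ e₂) = some (.num ((q.2 - p.2) / (q.1 - p.1))) := by
  have : q.1 - p.1 ≠ 0 := sub_ne_zero.2 h.symm
  simp [slopeE, pev, h₁, h₂, encodePt, this]

end

/-- The comparison of a chord of each chain with the bridge of slope `s` that has the height `Y`
over the separating line. -/
theorem bridge_step {α β sA sB Y s xa xp xq yb yp yq : ℝ} (xp0 : 0 < xp) (xq0 : 0 < xq)
    (xa0 : 0 < xa) (yp0 : 0 < yp) (yb0 : 0 < yb) (hx : xq < xp) (hy : yp < yq)
    (ha : (α - Y) - (sA - s) * xa ≤ 0) (hp : 0 ≤ (α - Y) - (sA - s) * xp)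
    (hq : 0 ≤ (α - Y) - (sA - s) * xq) (hb : (β - Y) + (sB - s) * yb ≤ 0)
    (hp' : 0 ≤ (β - Y) + (sB - s) * yp) (hq' : 0 ≤ (β - Y) + (sB - s) * yq) :
    (sA < sB → α < β → xa < xp) ∧ (sA < sB → ¬ α < β → yb < yq) ∧
    (¬ sA < sB → β < α → xq < xa) ∧
    (¬ sA < sB → ¬ β < α → yb ≤ yp → β - Y + (sB - s) * yq = 0) := by
  refine ⟨fun h1 h2 => ?_, fun h1 h2 => ?_, fun h1 h2 => ?_, fun h1 h2 h3 => ?_⟩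
  · by_contra! h
    -- The chord minus the bridge is affine, nonnegative at `p` and nonpositive at `a`, which
    -- determines the sign of the difference of the slopes. Hence the chord of `A` is at least at
    -- height `Y` over the separating line. The chord of `B`, higher there and steeper, is then
    -- strictly above the bridge at `b`, which is impossible.
    have i1 : 0 ≤ sA - s := by
      by_contra! hc
      nlinarith
    nlinarith
  · by_contra! h
    have i1 : sB - s ≤ 0 := by
      by_contra! hc
      nlinarith
    nlinarith
  · by_contra! h
    have i1 : sA - s ≤ 0 := by
      by_contra! hc
      nlinarith
    nlinarith
  -- Here all comparisons are weak, so the only conclusion is that the chord of `B` lies on the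
  -- bridge. The caller excludes this case by the strictness of hull edges.
  · have i1 : 0 ≤ sB - s := by
      by_contra! hc
      nlinarith
    have i2 : 0 ≤ (sB - s) * yb := by positivity
    have i3 : 0 ≤ (sA - s) * xq := mul_nonneg (by linarith) xq0.le
    have i4 : (sA - s) * xq = 0 := by linarith
    have i5 := (mul_eq_zero.1 i4).resolve_right xq0.ne'
    have i6 : sB - s = 0 := by linarith
    rw [i6] at hb hq' ⊢
    linarith

theorem HullEdge.height_le {P : Finset Pt} {u p q x : Pt} (hu : 0 < dot u u)
    (hpq : dot u p < dot u q) (h : HullEdge P p q) (hx : x ∈ P) :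
    cross u p + (cross u q - cross u p) / (dot u q - dot u p) * (dot u x - dot u p) ≤
      cross u x := by
  have h1 := mul_nonneg hu.le (h.orient_nonneg hx)
  rw [← frame_orient] at h1
  have h2 := sub_pos.2 hpq
  rw [div_mul_eq_mul_div, ← le_sub_iff_add_le', div_le_iff₀ h2]
  linarith

/-- On the line of an edge there are no points beyond its end. -/
theorem HullEdge.false_of_beyond {P : Finset Pt} {u a b x : Pt} (h : HullEdge P a b) (hx : x ∈ P)
    (hab : dot u a < dot u b) (hbx : dot u b < dot u x) (ho : orient a b x = 0) : False := by
  rcases h.2.2 x hx (by rintro rfl; linarith) (by rintro rfl; linarith) with h1 | ⟨_, _, h1⟩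
  · linarith
  · have e := collinear_dot (u := u) ho
    have hne : b ≠ a := by rintro rfl; linarith
    have hpp : 0 < dot (b - a) (b - a) := by simpa [dot] using dot_self_pos hne
    have e1 : dot (x - b) (a - b) = dot (a - b) (x - b) := by simp only [dot]; ring
    rw [e1] at e
    have hd : 0 < dot u (b - a) := by rw [dot_sub]; linarith
    have h2 := mul_pos hd h1
    have h3 : dot u (b - a) - dot u (x - a) < 0 := by rw [dot_sub, dot_sub]; linarith
    have h4 := mul_neg_of_neg_of_pos h3 hpp
    linarith

/-- The chains `A` and `B` are separated by the line `dot u p = c` and have the common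
tangent `a b`. -/
structure BridgeHyp (P Q T : Finset Pt) (u : Pt) (c : ℝ) (a b : Pt) (N : ℕ) (A B : PTree) :
    Prop where
  balA : A.Balanced
  balB : B.Balanced
  subA : ∀ p ∈ A.toList, p ∈ P
  subB : ∀ p ∈ B.toList, p ∈ Q
  memA : a ∈ A.toList
  memB : b ∈ B.toList
  monoA : A.toList.Pairwise (fun p q => dot u p < dot u q)
  monoB : B.toList.Pairwise (fun p q => dot u p < dot u q)
  chainA : A.toList.IsChain (HullEdge P)
  chainB : B.toList.IsChain (HullEdge Q)
  ccwA : Ccw A.toList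
  ccwB : Ccw B.toList
  lenA : A.toList.length ≤ N
  lenB : B.toList.length ≤ N
  ltA : ∀ p ∈ A.toList, dot u p < c
  ltB : ∀ p ∈ B.toList, c < dot u p

section

variable {P Q T : Finset Pt} {u a b : Pt} {c : ℝ} {N : ℕ} {A B A' B' : PTree}

theorem BridgeHyp.left (h : BridgeHyp P Q T u c a b N A B) (hA : A'.toList.Sublist A.toList)
    (hc : A'.toList.IsChain (HullEdge P)) (hb : A'.Balanced) (ha : a ∈ A'.toList) :
    BridgeHyp P Q T u c a b N A' B :=
  { h with
    balA := hb, subA := fun p hp => h.subA p (hA.subset hp), memA := ha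
    monoA := h.monoA.sublist hA, chainA := hc, ccwA := h.ccwA.sublist hA
    lenA := hA.length_le.trans h.lenA, ltA := fun p hp => h.ltA p (hA.subset hp) }

theorem BridgeHyp.right (h : BridgeHyp P Q T u c a b N A B) (hB : B'.toList.Sublist B.toList)
    (hc : B'.toList.IsChain (HullEdge Q)) (hb : B'.Balanced) (ha : b ∈ B'.toList) :
    BridgeHyp P Q T u c a b N A B' :=
  { h with
    balB := hb, subB := fun p hp => h.subB p (hB.subset hp), memB := ha
    monoB := h.monoB.sublist hB, chainB := hc, ccwB := h.ccwB.sublist hB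
    lenB := hB.length_le.trans h.lenB, ltB := fun p hp => h.ltB p (hB.subset hp) }

theorem nodup_of_dot_mono {L : List Pt} (h : L.Pairwise (fun p q => dot u p < dot u q)) :
    L.Nodup := h.imp fun h => by rintro rfl; exact lt_irrefl _ h

theorem PTree.isChain_node {R : Pt → Pt → Prop} {l r : PTree}
    (h : (PTree.node l r).toList.IsChain R) :
    l.toList.IsChain R ∧ r.toList.IsChain R ∧ R l.last r.first := by
  have := List.isChain_append.1 h
  refine ⟨this.1, this.2.1, this.2.2 _ ?_ _ ?_⟩
  · rw [← l.getLast_toList]; exact List.getLast?_eq_some_getLast _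
  · exact r.head?_toList

theorem PTree.le_last {l : PTree} {f : Pt → ℝ} (h : l.toList.Pairwise (fun p q => f p < f q))
    {x : Pt} (hx : x ∈ l.toList) : f x ≤ f l.last := by
  obtain ⟨k, hk⟩ := l.toList_eq_concat
  rw [hk] at h hx
  rcases List.mem_append.1 hx with hx | hx
  · exact ((List.pairwise_append.1 h).2.2 x hx _ (by simp)).le
  · rw [List.mem_singleton.1 hx]

theorem PTree.first_le {l : PTree} {f : Pt → ℝ} (h : l.toList.Pairwise (fun p q => f p < f q))
    {x : Pt} (hx : x ∈ l.toList) : f l.first ≤ f x := by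
  obtain ⟨k, hk⟩ := l.toList_eq_cons
  rw [hk] at h hx
  rcases List.mem_cons.1 hx with rfl | hx
  · rfl
  · exact ((List.pairwise_cons.1 h).1 x hx).le

theorem dot_neg_left (u x : Pt) : dot (-u) x = -dot u x := by
  simp only [dot, Prod.fst_neg, Prod.snd_neg]; ring

/-- Once `a` is known, only a tangent from a point remains: `a b` is still a hull edge of `a`
together with the points of `B`, so `b` is the first of them in the angular order at `a`. -/
theorem BridgeHyp.findR (h : BridgeHyp P Q T u c a b N A B) (hP : P ⊆ T) (hQ : Q ⊆ T)
    (hab : HullEdge T a b) {env : List Val} {e₁ e₂ : Expr} {s₁ s₂ : ℕ}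
    (he₁ : Ev prog env e₁ B.encode s₁) (he₂ : Ev prog env e₂ (encodePt a) s₂) :
    Ev prog env (mk2 10 e₁ e₂) (encodePt b) (s₁ + s₂ + 12000 * lam N) := by
  classical
  have hua : ∀ p ∈ B.toList, dot u a < dot u p := fun p hp =>
    (h.ltA a h.memA).trans (h.ltB p hp)
  obtain ⟨m, h1, h2, h3⟩ := findAngR_spec (PTree.rep h.balB) B.toList_ne_nil
    (nodup_of_dot_mono h.monoB) h.ccwB h.lenB hua he₁ he₂
  suffices m = b by rwa [← this]
  by_contra hne
  have h4 : HullEdge (insert a B.toList.toFinset) a b := hab.mono (fun x hx => by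
    rcases Finset.mem_insert.1 hx with rfl | hx
    · exact hP (h.subA _ h.memA)
    · exact hQ (h.subB _ (List.mem_toFinset.1 hx))) (by simp) (by simp [h.memB])
  have h5 := h4.angKey_lt (u := u) (p := m) (fun p hp hpa => hua p (by simpa [hpa] using hp))
    (by simp [h1]) (by rintro rfl; exact lt_irrefl _ (hua _ h1)) hne
  exact absurd (h2 b h.memB) (not_le.2 h5)

theorem BridgeHyp.findL (h : BridgeHyp P Q T u c a b N A B) (hP : P ⊆ T) (hQ : Q ⊆ T)
    (hab : HullEdge T a b) {env : List Val} {e₁ e₂ : Expr} {s₁ s₂ : ℕ}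
    (he₁ : Ev prog env e₁ A.encode s₁) (he₂ : Ev prog env e₂ (encodePt b) s₂) :
    Ev prog env (mk2 11 e₁ e₂) (encodePt a) (s₁ + s₂ + 12000 * lam N) := by
  classical
  have hua : ∀ p ∈ A.toList, dot (-u) b < dot (-u) p := fun p hp => by
    rw [dot_neg_left, dot_neg_left]
    linarith [h.ltA p hp, h.ltB b h.memB]
  obtain ⟨m, h1, h2, h3⟩ := findAngL_spec (PTree.rep h.balA) A.toList_ne_nil
    (nodup_of_dot_mono h.monoA) h.ccwA h.lenA hua he₁ he₂
  suffices m = a by rwa [← this]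
  by_contra hne
  have h4 : HullEdge (insert b A.toList.toFinset) a b := hab.mono (fun x hx => by
    rcases Finset.mem_insert.1 hx with rfl | hx
    · exact hQ (h.subB _ h.memB)
    · exact hP (h.subA _ (List.mem_toFinset.1 hx))) (by simp [h.memA]) (by simp)
  have h5 := h4.angKey_lt' (u := -u) (p := m) (fun p hp hpa => hua p (by simpa [hpa] using hp))
    (by simp [h1]) (by rintro rfl; exact lt_irrefl _ (hua _ h1)) hne
  exact absurd (h2 a h.memA) (not_le.2 h5)

/-- The slope of the line through `p` and `q` in the frame `u`. -/
noncomputable def slope (u p q : Pt) : ℝ := (cross u q - cross u p) / (dot u q - dot u p)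

/-- The height of the line through `p` and `q` over the line `dot u x = c`. -/
noncomputable def heightAt (u p q : Pt) (c : ℝ) : ℝ := cross u p + (c - dot u p) * slope u p q

theorem slope_mul {u p q : Pt} (h : dot u p < dot u q) :
    slope u p q * (dot u q - dot u p) = cross u q - cross u p :=
  div_mul_cancel₀ _ (sub_pos.2 h).ne'

/-- Translates `bridge_step` into trees. The middle edge of each chain supports its set from below,
the bridge supports both sets, and the abscissas are measured from the separating line. -/
theorem BridgeHyp.step {l r l' r' : PTree} (hu : 0 < dot u u)
    (h : BridgeHyp P Q T u c a b N (.node l r) (.node l' r')) (hP : P ⊆ T) (hQ : Q ⊆ T)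
    (hab : HullEdge T a b) :
    dot u l.last < dot u r.first ∧ dot u l'.last < dot u r'.first ∧
    (slope u l.last r.first < slope u l'.last r'.first →
      heightAt u l.last r.first c < heightAt u l'.last r'.first c → a ∈ r.toList) ∧
    (slope u l.last r.first < slope u l'.last r'.first →
      ¬ heightAt u l.last r.first c < heightAt u l'.last r'.first c → b ∈ l'.toList) ∧
    (¬ slope u l.last r.first < slope u l'.last r'.first →
      heightAt u l'.last r'.first c < heightAt u l.last r.first c → a ∈ l.toList) ∧
    (¬ slope u l.last r.first < slope u l'.last r'.first →
      ¬ heightAt u l'.last r'.first c < heightAt u l.last r.first c → b ∈ r'.toList) := by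
  have mA := List.pairwise_append.1 h.monoA
  have mB := List.pairwise_append.1 h.monoB
  have hpq := mA.2.2 _ l.last_mem _ r.first_mem
  have hpq' := mB.2.2 _ l'.last_mem _ r'.first_mem
  have hA : ∀ x ∈ l.toList ++ r.toList, dot u x < c := h.ltA
  have hB : ∀ x ∈ l'.toList ++ r'.toList, c < dot u x := h.ltB
  have hac := h.ltA a h.memA
  have hbc := h.ltB b h.memB
  have hpc := hA l.last (by simp [l.last_mem])
  have hqc := hA r.first (by simp [r.first_mem])
  have hpc' := hB l'.last (by simp [l'.last_mem])
  have hqc' := hB r'.first (by simp [r'.first_mem])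
  have hXab := hac.trans hbc
  have eA := (PTree.isChain_node h.chainA).2.2
  have eB := (PTree.isChain_node h.chainB).2.2
  have lowA : ∀ x ∈ P, heightAt u l.last r.first c + slope u l.last r.first * (dot u x - c) ≤
      cross u x := fun x hx => by
    have := eA.height_le hu hpq hx
    rw [heightAt, slope]
    linarith
  have lowB : ∀ x ∈ Q, heightAt u l'.last r'.first c + slope u l'.last r'.first * (dot u x - c) ≤
      cross u x := fun x hx => by
    have := eB.height_le hu hpq' hx
    rw [heightAt, slope]
    linarith
  have lowT : ∀ x ∈ T, heightAt u a b c + slope u a b * (dot u x - c) ≤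
      cross u x := fun x hx => by
    have := hab.height_le hu hXab hx
    rw [heightAt, slope]
    linarith
  have onA : ∀ p q : Pt, heightAt u p q c + slope u p q * (dot u p - c) = cross u p :=
    fun p q => by rw [heightAt]; ring
  have onA' : ∀ p q : Pt, dot u p < dot u q →
      heightAt u p q c + slope u p q * (dot u q - c) = cross u q :=
    fun p q h => by have := slope_mul h; rw [heightAt]; linarith
  have memP : ∀ x ∈ l.toList ++ r.toList, x ∈ P := h.subA
  have memQ : ∀ x ∈ l'.toList ++ r'.toList, x ∈ Q := h.subB
  have ta := lowA a (h.subA _ h.memA)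
  have tb := lowB b (h.subB _ h.memB)
  have tp := lowT l.last (hP (memP _ (by simp [l.last_mem])))
  have tq := lowT r.first (hP (memP _ (by simp [r.first_mem])))
  have tp' := lowT l'.last (hQ (memQ _ (by simp [l'.last_mem])))
  have tq' := lowT r'.first (hQ (memQ _ (by simp [r'.first_mem])))
  rw [← onA a b] at ta
  rw [← onA' a b hXab] at tb
  rw [← onA l.last r.first] at tp
  rw [← onA' l.last r.first hpq] at tq
  rw [← onA l'.last r'.first] at tp'
  rw [← onA' l'.last r'.first hpq'] at tq'
  obtain ⟨s1, s2, s3, s4⟩ := bridge_step (α := heightAt u l.last r.first c)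
    (β := heightAt u l'.last r'.first c) (sA := slope u l.last r.first)
    (sB := slope u l'.last r'.first) (Y := heightAt u a b c) (s := slope u a b)
    (xa := c - dot u a) (xp := c - dot u l.last) (xq := c - dot u r.first)
    (yb := dot u b - c) (yp := dot u l'.last - c) (yq := dot u r'.first - c)
    (by linarith) (by linarith) (by linarith) (by linarith) (by linarith) (by linarith)
    (by linarith) (by linarith) (by linarith) (by linarith) (by linarith) (by linarith)
    (by linarith)
  have ma : a ∈ l.toList ++ r.toList := h.memA
  have mb : b ∈ l'.toList ++ r'.toList := h.memB
  refine ⟨hpq, hpq', fun i1 i2 => ?_, fun i1 i2 => ?_, fun i1 i2 => ?_, fun i1 i2 => ?_⟩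
  · have := s1 i1 i2
    refine (List.mem_append.1 ma).resolve_left fun hm => ?_
    linarith [PTree.le_last mA.1 hm]
  · have := s2 i1 i2
    refine (List.mem_append.1 mb).resolve_right fun hm => ?_
    linarith [PTree.first_le mB.2.1 hm]
  · have := s3 i1 i2
    refine (List.mem_append.1 ma).resolve_right fun hm => ?_
    linarith [PTree.first_le mA.2.1 hm]
  -- If `b` were in `l'`, then `r'.first` would be on the line of the bridge beyond `b`.
  · refine (List.mem_append.1 mb).resolve_left fun hm => ?_
    have hle := PTree.le_last mB.1 hm
    have z := s4 i1 i2 (by linarith)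
    refine hab.false_of_beyond (hQ (memQ _ (by simp [r'.first_mem]))) hXab
      (hle.trans_lt hpq') ?_
    have e1 := onA' l'.last r'.first hpq'
    have e2 := onA a b
    have e3 := slope_mul hXab
    have e4 := frame_orient u a b r'.first
    rw [← e3, show cross u r'.first - cross u a =
      slope u a b * (dot u r'.first - dot u a) by linarith] at e4
    have z' : dot u u * orient a b r'.first = 0 := by rw [← e4]; ring
    exact (mul_eq_zero.1 z').resolve_left hu.ne'

/-- Every round replaces one of the trees by a subtree that still contains its end of the bridge, so
the heights bound the number of rounds. As soon as one tree is a leaf, a single tangent search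
finishes. -/
theorem bridgeBody_spec (hu : 0 < dot u u) (hP : P ⊆ T) (hQ : Q ⊆ T) (hab : HullEdge T a b)
    (h : BridgeHyp P Q T u c a b N A B) :
    Ev prog [.pair A.encode (.pair B.encode (.pair (encodePt u) (.num c)))] bridgeBody
      (.pair (encodePt a) (encodePt b)) (1000 * (A.height + B.height) + 13000 * lam N) := by
  have hlam := one_le_lam N
  induction hn : A.height + B.height using Nat.strong_induction_on generalizing A B with
  | _ n ih =>
  subst hn
  cases A with
  | leaf p =>
    obtain rfl : a = p := by simpa [PTree.toList] using h.memA
    have p0 : pev [.pair (PTree.leaf a).encode (.pair B.encode (.pair (encodePt u) (.num c)))]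
      (snd (fst (var 0))) = some (encodePt a) := rfl
    exact (Ev.ifPair_nil (Ev.pure rfl (t := 10) (by decide))
      (Ev.pair (Ev.pure p0 (t := 10) (by decide)) (h.findR hP hQ hab
      (Ev.pure rfl (t := 10) (by decide)) (Ev.pure p0 (t := 10) (by decide))))).mono (by omega)
  | node l r =>
  cases B with
  | leaf p =>
    obtain rfl : b = p := by simpa [PTree.toList] using h.memB
    have p0 : pev [.pair (PTree.node l r).encode (.pair (PTree.leaf b).encode
      (.pair (encodePt u) (.num c)))] (snd (fst (snd (var 0)))) = some (encodePt b) := rfl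
    exact (Ev.ifPair_pos (Ev.pure rfl (t := 10) (by decide)) (Ev.ifPair_nil
      (Ev.pure rfl (t := 10) (by decide)) (Ev.pair (h.findL hP hQ hab
      (Ev.pure rfl (t := 10) (by decide)) (Ev.pure p0 (t := 10) (by decide)))
      (Ev.pure p0 (t := 10) (by decide))))).mono (by omega)
  | node l' r' =>
  obtain ⟨hpq, hpq', k1, k2, k3, k4⟩ := h.step hu hP hQ hab
  have cA := PTree.isChain_node h.chainA
  have cB := PTree.isChain_node h.chainB
  have bA := h.balA
  have bB := h.balB
  simp only [PTree.height]
  simp only [PTree.height] at ih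
  have m1 : l.height ≤ max l.height r.height := le_max_left _ _
  have m2 : r.height ≤ max l.height r.height := le_max_right _ _
  have m1' : l'.height ≤ max l'.height r'.height := le_max_left _ _
  have m2' : r'.height ≤ max l'.height r'.height := le_max_right _ _
  set inp : Val := .pair (PTree.node l r).encode
    (.pair (PTree.node l' r').encode (.pair (encodePt u) (.num c))) with hinp
  set rot : Pt → Pt := fun p => (dot u p, cross u p) with hrot
  have q1 : pev [inp] (rotE (fst (snd (snd (var 0)))) (lastLeaf (left (fst (var 0))))) =
    some (encodePt (rot l.last)) := pev_rotE rfl (pev_lastLeaf (pev_left rfl))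
  have q2 : pev [encodePt (rot l.last), inp] (rotE (fst (snd (snd (var 1))))
    (firstLeaf (right (fst (var 1))))) = some (encodePt (rot r.first)) :=
    pev_rotE rfl (pev_firstLeaf (pev_right rfl))
  have q3 : pev [encodePt (rot r.first), encodePt (rot l.last), inp]
    (rotE (fst (snd (snd (var 2)))) (lastLeaf (left (fst (snd (var 2)))))) =
    some (encodePt (rot l'.last)) := pev_rotE rfl (pev_lastLeaf (pev_left rfl))
  have q4 : pev [encodePt (rot l'.last), encodePt (rot r.first), encodePt (rot l.last), inp]
    (rotE (fst (snd (snd (var 3)))) (firstLeaf (right (fst (snd (var 3)))))) =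
    some (encodePt (rot r'.first)) := pev_rotE rfl (pev_firstLeaf (pev_right rfl))
  have q5 : pev [encodePt (rot r'.first), encodePt (rot l'.last), encodePt (rot r.first),
    encodePt (rot l.last), inp] (slopeE (var 3) (var 2)) =
    some (.num (slope u l.last r.first)) := pev_slopeE (p := rot l.last) (q := rot r.first) rfl rfl hpq.ne
  have q6 : pev [.num (slope u l.last r.first), encodePt (rot r'.first), encodePt (rot l'.last),
    encodePt (rot r.first), encodePt (rot l.last), inp] (slopeE (var 2) (var 1)) =
    some (.num (slope u l'.last r'.first)) := pev_slopeE (p := rot l'.last) (q := rot r'.first) rfl rfl hpq'.ne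
  set env : List Val := [.num (slope u l'.last r'.first), .num (slope u l.last r.first),
    encodePt (rot r'.first), encodePt (rot l'.last), encodePt (rot r.first),
    encodePt (rot l.last), inp] with henv
  have w1 : pev env (var 1) = some (.num (slope u l.last r.first)) := rfl
  have w2 : pev env (var 0) = some (.num (slope u l'.last r'.first)) := rfl
  have w3 : pev env (.add (snd (var 5)) (.mul (.sub (snd (snd (snd (var 6)))) (fst (var 5)))
    (var 1))) = some (.num (heightAt u l.last r.first c)) := rfl
  have w4 : pev env (.add (snd (var 3)) (.mul (.sub (snd (snd (snd (var 6)))) (fst (var 3)))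
    (var 0))) = some (.num (heightAt u l'.last r'.first c)) := rfl
  have fin : ∀ {e : Expr} {t : ℕ}, Ev prog env e (.pair (encodePt a) (encodePt b)) t → ∀ {m : ℕ},
      t + 800 ≤ m → Ev prog [inp] (.ifPair (fst (fst (var 0))) (.ifPair (fst (fst (snd (var 0))))
        (.bind (rotE (fst (snd (snd (var 0)))) (lastLeaf (left (fst (var 0)))))
        (.bind (rotE (fst (snd (snd (var 1)))) (firstLeaf (right (fst (var 1)))))
        (.bind (rotE (fst (snd (snd (var 2)))) (lastLeaf (left (fst (snd (var 2))))))
        (.bind (rotE (fst (snd (snd (var 3)))) (firstLeaf (right (fst (snd (var 3))))))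
        (.bind (slopeE (var 3) (var 2)) (.bind (slopeE (var 2) (var 1)) e))))))
        (.pair (mk2 11 (fst (var 0)) (snd (fst (snd (var 0))))) (snd (fst (snd (var 0))))))
        (.pair (snd (fst (var 0))) (mk2 10 (fst (snd (var 0))) (snd (fst (var 0))))))
        (.pair (encodePt a) (encodePt b)) m := fun he m hm =>
    (Ev.ifPair_pos (Ev.pure rfl (t := 10) (by decide)) (Ev.ifPair_pos
      (Ev.pure rfl (t := 10) (by decide))
      (Ev.bind (Ev.pure q1 (t := 120) (by decide)) (Ev.bind (Ev.pure q2 (t := 120) (by decide))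
      (Ev.bind (Ev.pure q3 (t := 120) (by decide)) (Ev.bind (Ev.pure q4 (t := 120) (by decide))
      (Ev.bind (Ev.pure q5 (t := 70) (by decide))
      (Ev.bind (Ev.pure q6 (t := 70) (by decide)) he)))))))).mono (by omega)
  have z1 := Ev.pure (F := prog) w1 (t := 10) (by decide)
  have z2 := Ev.pure (F := prog) w2 (t := 10) (by decide)
  have z3 := Ev.pure (F := prog) w3 (t := 30) (by decide)
  have z4 := Ev.pure (F := prog) w4 (t := 30) (by decide)
  have pA : pev env (fst (var 6)) = some (PTree.node l r).encode := rfl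
  have pB : pev env (fst (snd (var 6))) = some (PTree.node l' r').encode := rfl
  have pu : pev env (snd (snd (var 6))) = some (.pair (encodePt u) (.num c)) := rfl
  by_cases i1 : slope u l.last r.first < slope u l'.last r'.first
  · by_cases i2 : heightAt u l.last r.first c < heightAt u l'.last r'.first c
    · have h' := h.left (A' := r) (List.sublist_append_right _ _) cA.2.1 bA.2.1 (k1 i1 i2)
      exact fin (Ev.ifLt_pos z1 z2 i1 (Ev.ifLt_pos z3 z4 i2 (Ev.call (f := 16) (Ev.pure
        (pev_pair (pev_right pA) (pev_pair pB pu)) (t := 30) (by decide)) rfl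
        (ih _ (by simp only [PTree.height]; omega) h' rfl))))
        (by simp only [PTree.height]; omega)
    · have h' := h.right (B' := l') (List.sublist_append_left _ _) cB.1 bB.1 (k2 i1 i2)
      exact fin (Ev.ifLt_pos z1 z2 i1 (Ev.ifLt_neg z3 z4 i2 (Ev.call (f := 16) (Ev.pure
        (pev_pair pA (pev_pair (pev_left pB) pu)) (t := 30) (by decide)) rfl
        (ih _ (by simp only [PTree.height]; omega) h' rfl))))
        (by simp only [PTree.height]; omega)
  · by_cases i2 : heightAt u l'.last r'.first c < heightAt u l.last r.first c
    · have h' := h.left (A' := l) (List.sublist_append_left _ _) cA.1 bA.1 (k3 i1 i2)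
      exact fin (Ev.ifLt_neg z1 z2 i1 (Ev.ifLt_pos z4 z3 i2 (Ev.call (f := 16) (Ev.pure
        (pev_pair (pev_left pA) (pev_pair pB pu)) (t := 30) (by decide)) rfl
        (ih _ (by simp only [PTree.height]; omega) h' rfl))))
        (by simp only [PTree.height]; omega)
    · have h' := h.right (B' := r') (List.sublist_append_right _ _) cB.2.1 bB.2.1 (k4 i1 i2)
      exact fin (Ev.ifLt_neg z1 z2 i1 (Ev.ifLt_neg z4 z3 i2 (Ev.call (f := 16) (Ev.pure
        (pev_pair pA (pev_pair (pev_right pB) pu)) (t := 30) (by decide)) rfl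
        (ih _ (by simp only [PTree.height]; omega) h' rfl))))
        (by simp only [PTree.height]; omega)

end

/-! ### Existence of the common tangent -/

/-- Exchanging one end of a segment across the line `dot u p = c` raises its crossing point iff the
new end is to the left of `a b`. Thus a segment with the lowest crossing point is a tangent. -/
theorem heightAt_sub_left {u a b x : Pt} {c : ℝ} (ha : dot u a < dot u b)
    (hx : dot u x < dot u b) : (heightAt u x b c - heightAt u a b c) *
      ((dot u b - dot u a) * (dot u b - dot u x)) = (dot u b - c) * (dot u u * orient a b x) := by
  have h1 := slope_mul ha
  have h2 := slope_mul hx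
  rw [← frame_orient, heightAt, heightAt]
  linear_combination ((c - dot u x) * (dot u b - dot u a)) * h2 -
    ((c - dot u a) * (dot u b - dot u x)) * h1

theorem heightAt_sub_right {u a b x : Pt} {c : ℝ} (ha : dot u a < dot u b)
    (hx : dot u a < dot u x) : (heightAt u a x c - heightAt u a b c) *
      ((dot u b - dot u a) * (dot u x - dot u a)) = (c - dot u a) * (dot u u * orient a b x) := by
  have h1 := slope_mul ha
  have h2 := slope_mul hx
  rw [← frame_orient, heightAt, heightAt]
  linear_combination ((c - dot u a) * (dot u b - dot u a)) * h2 -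
    ((c - dot u a) * (dot u x - dot u a)) * h1

theorem between_of_dot_lt {u a b x : Pt} (h : orient a b x = 0) (h1 : dot u a < dot u x)
    (h2 : dot u x < dot u b) : 0 < dot (b - a) (x - a) ∧ 0 < dot (a - b) (x - b) := by
  refine ⟨same_side (h1.trans h2) h1 h, same_side (u := -u) ?_ ?_ ?_⟩
  · rw [dot_neg_left, dot_neg_left]; linarith
  · rw [dot_neg_left, dot_neg_left]; linarith
  · have : orient b a x = -orient a b x := by simp only [orient]; ring
    rw [this, h, neg_zero]

theorem eq_of_dot_eq_of_orient {u a b x : Pt} (hu : 0 < dot u u) (hab : dot u a ≠ dot u b)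
    (h : orient a b x = 0) (hx : dot u x = dot u a) : x = a := by
  refine frame_ext hu hx ?_
  have e := frame_orient u a b x
  rw [h, hx, sub_self, mul_zero, mul_zero, sub_zero] at e
  linarith [(mul_eq_zero.1 e).resolve_left (sub_ne_zero.2 hab.symm)]

open Classical in
/-- Two sets on different sides of a line have a common tangent. -/
theorem exists_bridge {P Q : Finset Pt} {u : Pt} {c : ℝ} (hP : P.Nonempty) (hQ : Q.Nonempty)
    (hPc : ∀ p ∈ P, dot u p < c) (hQc : ∀ q ∈ Q, c < dot u q) :
    ∃ a ∈ P, ∃ b ∈ Q, HullEdge (P ∪ Q) a b := by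
  -- The lowest crossing of the line; among equal ones the second component selects the longest
  -- segment, so that all points on its line are between its ends.
  obtain ⟨⟨a, b⟩, hab, hmin⟩ := Finset.exists_min_image (P ×ˢ Q)
    (fun z : Pt × Pt => (toLex (heightAt u z.1 z.2 c, dot u z.1 - dot u z.2) : ℝ ×ₗ ℝ))
    (hP.product hQ)
  rw [Finset.mem_product] at hab
  obtain ⟨ha, hb⟩ := hab
  simp only at ha hb
  have hac := hPc a ha
  have hbc := hQc b hb
  have hX := hac.trans hbc
  have hu := dot_self_pos_of_ne hX
  have hmin' : ∀ p ∈ P, ∀ q ∈ Q, 0 ≤ heightAt u p q c - heightAt u a b c ∧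
      (heightAt u p q c - heightAt u a b c = 0 → dot u a - dot u b ≤ dot u p - dot u q) := by
    intro p hp q hq
    have := hmin (p, q) (Finset.mem_product.2 ⟨hp, hq⟩)
    rw [← not_lt, toLex_lt_toLex', not_or, not_lt] at this
    refine ⟨sub_nonneg.2 this.1, fun e => ?_⟩
    by_contra hc
    exact this.2 ⟨sub_eq_zero.1 e, not_le.1 hc⟩
  refine ⟨a, ha, b, hb, by simp [ha], by simp [hb], fun x hx hxa hxb => ?_⟩
  have fin : ∀ {k : ℝ}, 0 < k → 0 ≤ k * (dot u u * orient a b x) →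
      (k * (dot u u * orient a b x) = 0 → dot u a ≤ dot u x ∧ dot u x ≤ dot u b) →
      0 < orient a b x ∨ (orient a b x = 0 ∧ 0 < dot (b - a) (x - a) ∧
        0 < dot (a - b) (x - b)) := by
    intro k hk h1 h2
    have h3 := nonneg_of_mul_nonneg_right (nonneg_of_mul_nonneg_right h1 hk) hu
    rcases h3.lt_or_eq with h | h
    · exact Or.inl h
    · rw [← h] at h2
      simp only [mul_zero, forall_true_left] at h2
      have n1 : dot u x ≠ dot u a := fun e => hxa (eq_of_dot_eq_of_orient hu hX.ne h.symm e)
      have n2 : dot u x ≠ dot u b := fun e => hxb (eq_of_dot_eq_of_orient hu hX.ne'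
        (by rw [show orient b a x = -orient a b x by simp only [orient]; ring, ← h, neg_zero]) e)
      exact Or.inr ⟨h.symm, between_of_dot_lt h.symm (h2.1.lt_of_ne n1.symm) (h2.2.lt_of_ne n2)⟩
  rcases Finset.mem_union.1 hx with hx | hx
  · have hxX := (hPc x hx).trans hbc
    have e := heightAt_sub_left (c := c) hX hxX
    have hpos := mul_pos (sub_pos.2 hX) (sub_pos.2 hxX)
    obtain ⟨m1, m2⟩ := hmin' x hx b hb
    refine fin (sub_pos.2 hbc) (by rw [← e]; exact mul_nonneg m1 hpos.le) fun h0 => ?_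
    rw [← e] at h0
    exact ⟨by linarith [m2 ((mul_eq_zero.1 h0).resolve_right hpos.ne')], hxX.le⟩
  · have hxX := hac.trans (hQc x hx)
    have e := heightAt_sub_right (c := c) hX hxX
    have hpos := mul_pos (sub_pos.2 hX) (sub_pos.2 hxX)
    obtain ⟨m1, m2⟩ := hmin' a ha x hx
    refine fin (sub_pos.2 hac) (by rw [← e]; exact mul_nonneg m1 hpos.le) fun h0 => ?_
    rw [← e] at h0
    exact ⟨hxX.le, by linarith [m2 ((mul_eq_zero.1 h0).resolve_right hpos.ne')]⟩

-- The line of the bridge supports both sets from below with a finite slope, so its ends belong to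
-- the extracted lower chains. This is the purpose of the field `LowerChain.mem`.
open Classical in
theorem bridge_spec {P Q : Finset Pt} {L L' : List Pt} {v w : Val} {N : ℕ} {u : Pt} {c : ℝ}
    (h : Cyc P L) (h' : Cyc Q L') (H : Rep L v) (H' : Rep L' w) (hN : L.length ≤ N)
    (hN' : L'.length ≤ N) (hPc : ∀ p ∈ P, dot u p < c) (hQc : ∀ q ∈ Q, c < dot u q)
    {env : List Val} {e₁ e₂ e₃ e₄ : Expr} {s₁ s₂ s₃ s₄ : ℕ} (he₁ : Ev prog env e₁ v s₁)
    (he₂ : Ev prog env e₂ w s₂) (he₃ : Ev prog env e₃ (encodePt u) s₃)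
    (he₄ : Ev prog env e₄ (.pair (encodePt u) (.num c)) s₄) :
    ∃ a ∈ P, ∃ b ∈ Q, HullEdge (P ∪ Q) a b ∧
      Ev prog env (mk2 16 (mk2 15 e₁ e₃) (.pair (mk2 15 e₂ e₃) e₄))
        (.pair (encodePt a) (encodePt b)) (s₁ + s₂ + 2 * s₃ + s₄ + 430000 * lam N) := by
  have hlam := one_le_lam N
  obtain ⟨p, hp⟩ := List.exists_mem_of_ne_nil L h.1
  obtain ⟨q, hq⟩ := List.exists_mem_of_ne_nil L' h'.1
  have hp := (h.isVertex hp).1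
  have hq := (h'.isVertex hq).1
  have hu := dot_self_pos_of_ne ((hPc p hp).trans (hQc q hq))
  obtain ⟨a, ha, b, hb, hab⟩ := exists_bridge ⟨p, hp⟩ ⟨q, hq⟩ hPc hQc
  refine ⟨a, ha, b, hb, hab, ?_⟩
  obtain ⟨D, d, d1, d2, d3, d4⟩ := chain_spec h H hN hu he₁ he₃
  obtain ⟨E, e, f1, f2, f3, f4⟩ := chain_spec h' H' hN' hu he₂ he₃
  obtain ⟨A, A1, rfl, rfl⟩ := d2.exists_tree d1.ne
  obtain ⟨B, B1, rfl, rfl⟩ := f2.exists_tree f1.ne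
  have hX := (hPc a ha).trans (hQc b hb)
  have hsl := slope_mul hX
  have hle : ∀ x ∈ P ∪ Q, cross u a + slope u a b * (dot u x - dot u a) ≤ cross u x :=
    fun x hx => hab.height_le hu hX hx
  have hyp : BridgeHyp P Q (P ∪ Q) u c a b N A B :=
    { balA := A1, balB := B1
      subA := fun p hp => (d1.isVertex p hp).1
      subB := fun p hp => (f1.isVertex p hp).1
      memA := d1.mem a (hab.isVertex_left.mono Finset.subset_union_left ha)
        ⟨slope u a b, fun x hx => by linarith [hle x (Finset.mem_union_left _ hx)]⟩
      memB := f1.mem b (hab.isVertex_right.mono Finset.subset_union_right hb)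
        ⟨slope u a b, fun x hx => by linarith [hle x (Finset.mem_union_right _ hx)]⟩
      monoA := d1.mono, monoB := f1.mono, chainA := d1.chain, chainB := f1.chain
      ccwA := d1.ccw, ccwB := f1.ccw, lenA := d3, lenB := f3
      ltA := fun p hp => hPc p (d1.isVertex p hp).1
      ltB := fun p hp => hQc p (f1.isVertex p hp).1 }
  have := bridgeBody_spec hu Finset.subset_union_left Finset.subset_union_right hab hyp
  have g1 := PTree.height_lt A1 d3
  have g2 := PTree.height_lt B1 f3
  rw [show Nat.log 2 N + 1 = lam N from rfl] at g1 g2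
  exact (Ev.call (f := 16) (Ev.pair d4 (Ev.pair f4 he₄)) rfl this).mono (by omega)

/-! ### The vertical gap between two chains -/

/-- The height of `p` over the line of slope `s` through the origin. -/
def gap (s : ℝ) (p : Pt) : ℝ := p.2 - s * p.1

/-- The line of slope `s` through `a` supports `P` from below (`σ = 1`) or above (`σ = -1`). -/
def OptAt (σ : ℝ) (P : Finset Pt) (s : ℝ) (a : Pt) : Prop :=
  a ∈ P ∧ ∀ p ∈ P, σ * gap s a ≤ σ * gap s p

noncomputable def secant (p q : Pt) : ℝ := (q.2 - p.2) / (q.1 - p.1)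

theorem gap_shift (s s' : ℝ) (p : Pt) : gap s' p = gap s p + (s - s') * p.1 := by
  simp only [gap]; ring

section

variable {σ s s' : ℝ} {P Q : Finset Pt} {p q x y : Pt}

theorem HullEdge.optAt (hσ : σ = 1 ∨ σ = -1) (h : HullEdge P p q) (hlt : σ * p.1 < σ * q.1) :
    OptAt σ P (secant p q) p ∧ OptAt σ P (secant p q) q := by
  have hne : q.1 - p.1 ≠ 0 := by
    intro e
    rw [sub_eq_zero.1 e] at hlt
    exact lt_irrefl _ hlt
  have hm : secant p q * (q.1 - p.1) = q.2 - p.2 := div_mul_cancel₀ _ hne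
  have hq : gap (secant p q) q = gap (secant p q) p := by simp only [gap]; linarith
  have key : ∀ x ∈ P, σ * gap (secant p q) p ≤ σ * gap (secant p q) x := by
    intro x hx
    have h1 := h.orient_nonneg hx
    have e : orient p q x = (q.1 - p.1) * (gap (secant p q) x - gap (secant p q) p) := by
      simp only [orient, gap]
      linear_combination (x.1 - p.1) * hm
    rw [e] at h1
    rcases hσ with rfl | rfl
    · have := nonneg_of_mul_nonneg_right h1 (by linarith)
      linarith
    · have := nonneg_of_mul_nonneg_right (a := p.1 - q.1)
        (b := gap (secant p q) p - gap (secant p q) x) (by linarith) (by linarith)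
      linarith
  exact ⟨⟨h.1, key⟩, h.2.1, by rwa [hq]⟩

/-- Adding the two optimality inequalities leaves the product of the differences of slopes and
abscissas. This monotonicity of supporting points drives the whole search. -/
theorem OptAt.le (h : OptAt σ P s x) (h' : OptAt σ P s' y) (hs : s < s') :
    σ * x.1 ≤ σ * y.1 := by
  have h1 := h.2 y h'.1
  have h2 := h'.2 x h.1
  rw [gap_shift s s' x, gap_shift s s' y] at h2
  have : (s' - s) * (σ * x.1) ≤ (s' - s) * (σ * y.1) := by linarith
  exact le_of_mul_le_mul_left this (sub_pos.2 hs)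

theorem exists_optAt (hP : P.Nonempty) (σ s : ℝ) : ∃ a, OptAt σ P s a :=
  Finset.exists_min_image P (fun p => σ * gap s p) hP

theorem OptAt.exists_ge (h : OptAt σ P s x) (hs : s ≤ s') :
    ∃ y, OptAt σ P s' y ∧ σ * x.1 ≤ σ * y.1 := by
  rcases hs.eq_or_lt with rfl | hs
  · exact ⟨x, h, le_rfl⟩
  · obtain ⟨y, hy⟩ := exists_optAt ⟨x, h.1⟩ σ s'
    exact ⟨y, hy, h.le hy hs⟩

theorem OptAt.exists_le (h : OptAt σ P s x) (hs : s' ≤ s) :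
    ∃ y, OptAt σ P s' y ∧ σ * y.1 ≤ σ * x.1 := by
  rcases hs.eq_or_lt with rfl | hs
  · exact ⟨x, h, le_rfl⟩
  · obtain ⟨y, hy⟩ := exists_optAt ⟨x, h.1⟩ σ s'
    exact ⟨y, hy, hy.le h hs⟩

end

/-- The gap increases to the right of the slope `s`. -/
def LoAt (P Q : Finset Pt) (s : ℝ) : Prop :=
  ∃ a b, OptAt 1 P s a ∧ OptAt (-1) Q s b ∧ a.1 < b.1

/-- The gap does not increase to the right of the slope `s`. -/
def HiAt (P Q : Finset Pt) (s : ℝ) : Prop :=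
  ∃ a b, OptAt 1 P s a ∧ OptAt (-1) Q s b ∧ b.1 ≤ a.1

theorem LoAt.le {P Q : Finset Pt} {l h : ℝ} (hl : LoAt P Q l) (hh : HiAt P Q h) : l ≤ h := by
  obtain ⟨a, b, h1, h2, h3⟩ := hl
  obtain ⟨a', b', h1', h2', h3'⟩ := hh
  by_contra! hc
  have := h1'.le h1 hc
  have := h2'.le h2 hc
  linarith

noncomputable def raise (lo : Option ℝ) (s : ℝ) : ℝ := lo.elim s (max s)

noncomputable def lower (hi : Option ℝ) (s : ℝ) : ℝ := hi.elim s (min s)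

theorem le_raise {lo : Option ℝ} {s : ℝ} : s ≤ raise lo s ∧ ∀ l ∈ lo, l ≤ raise lo s := by
  cases lo <;> simp [raise]

theorem raise_eq (lo : Option ℝ) (s : ℝ) :
    raise lo s ∈ lo ∨ (raise lo s = s ∧ ∀ l ∈ lo, l ≤ s) := by
  cases lo with
  | none => simp [raise]
  | some l =>
    rcases le_total l s with h | h
    · right; simp [raise, h]
    · left; simp [raise, h]

theorem lower_le {hi : Option ℝ} {s : ℝ} : lower hi s ≤ s ∧ ∀ l ∈ hi, lower hi s ≤ l := by
  cases hi <;> simp [lower]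

theorem lower_eq (hi : Option ℝ) (s : ℝ) :
    lower hi s ∈ hi ∨ (lower hi s = s ∧ ∀ l ∈ hi, s ≤ l) := by
  cases hi with
  | none => simp [lower]
  | some l =>
    rcases le_total l s with h | h
    · left; simp [lower, h]
    · right; simp [lower, h]

/-- A part of the lower (`σ = 1`) or upper (`σ = -1`) chain of `P` that contains the supporting
points for all slopes from `lo` to `hi`. -/
structure SubChain (σ : ℝ) (P : Finset Pt) (lo hi : Option ℝ) (t : PTree) : Prop where
  mem : ∀ p ∈ t.toList, p ∈ P
  mono : t.toList.Pairwise (fun p q => σ * p.1 < σ * q.1)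
  chain : t.toList.IsChain (HullEdge P)
  low : ∀ s, (∀ l ∈ lo, l ≤ s) → ∀ p ∈ P, σ * p.1 ≤ σ * t.first.1 →
    σ * gap s t.first ≤ σ * gap s p
  high : ∀ s, (∀ l ∈ hi, s ≤ l) → ∀ p ∈ P, σ * t.last.1 ≤ σ * p.1 →
    σ * gap s t.last ≤ σ * gap s p
  lowEnd : lo = none → ∀ p ∈ P, σ * t.first.1 ≤ σ * p.1
  highEnd : hi = none → ∀ p ∈ P, σ * p.1 ≤ σ * t.last.1

section

variable {σ : ℝ} {P : Finset Pt} {lo hi : Option ℝ} {t l r : PTree}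

theorem SubChain.raise (h : SubChain σ P lo hi t) (m : ℝ) :
    SubChain σ P (some (raise lo m)) hi t :=
  { h with
    low := fun s hs => h.low s fun l hl => (le_raise.2 l hl).trans (hs _ rfl)
    lowEnd := fun h => by simp at h }

theorem SubChain.lower (h : SubChain σ P lo hi t) (m : ℝ) :
    SubChain σ P lo (some (lower hi m)) t :=
  { h with
    high := fun s hs => h.high s fun l hl => (hs _ rfl).trans (lower_le.2 l hl)
    highEnd := fun h => by simp at h }

theorem SubChain.edge (hσ : σ = 1 ∨ σ = -1) (h : SubChain σ P lo hi (.node l r)) :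
    σ * l.last.1 < σ * r.first.1 ∧ OptAt σ P (secant l.last r.first) l.last ∧
      OptAt σ P (secant l.last r.first) r.first := by
  have hlt := (List.pairwise_append.1 h.mono).2.2 _ l.last_mem _ r.first_mem
  exact ⟨hlt, (PTree.isChain_node h.chain).2.2.optAt hσ hlt⟩

/-- The point `r.first` is optimal at the slope of the middle edge. For greater slopes it only gains
over the points before it, so they may be forgotten as long as the slope is not less than the raised
bound. -/
theorem SubChain.goRight (hσ : σ = 1 ∨ σ = -1) (h : SubChain σ P lo hi (.node l r)) :
    SubChain σ P (some (OnionUnion.raise lo (secant l.last r.first))) hi r where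
  mem p hp := h.mem p (List.mem_append_right _ hp)
  mono := (List.pairwise_append.1 h.mono).2.1
  chain := (PTree.isChain_node h.chain).2.1
  low s hs p hp hX := by
    have h1 := (h.edge hσ).2.2.2 p hp
    have h2 : secant l.last r.first ≤ s := le_raise.1.trans (hs _ rfl)
    have h3 := mul_le_mul_of_nonneg_left hX (sub_nonneg.2 h2)
    rw [gap_shift (secant l.last r.first) s p, gap_shift (secant l.last r.first) s r.first]
    linarith
  high := h.high
  lowEnd h := by simp at h
  highEnd := h.highEnd

theorem SubChain.goLeft (hσ : σ = 1 ∨ σ = -1) (h : SubChain σ P lo hi (.node l r)) :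
    SubChain σ P lo (some (OnionUnion.lower hi (secant l.last r.first))) l where
  mem p hp := h.mem p (List.mem_append_left _ hp)
  mono := (List.pairwise_append.1 h.mono).1
  chain := (PTree.isChain_node h.chain).1
  high s hs p hp hX := by
    have h1 := (h.edge hσ).2.1.2 p hp
    have h2 : s ≤ secant l.last r.first := (hs _ rfl).trans lower_le.1
    have h3 := mul_le_mul_of_nonneg_left hX (sub_nonneg.2 h2)
    rw [gap_shift (secant l.last r.first) s p, gap_shift (secant l.last r.first) s l.last]
    linarith
  low := h.low
  highEnd h := by simp at h
  lowEnd := h.lowEnd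

theorem SubChain.optAt_leaf {p : Pt} (h : SubChain σ P lo hi (.leaf p)) {s : ℝ}
    (hl : ∀ l ∈ lo, l ≤ s) (hh : ∀ l ∈ hi, s ≤ l) : OptAt σ P s p := by
  refine ⟨h.mem p (by simp [PTree.toList]), fun q hq => ?_⟩
  rcases le_total (σ * q.1) (σ * p.1) with hX | hX
  · exact h.low s hl q hq hX
  · exact h.high s hh q hq hX

end

/-- The upper chain is the lower chain in the frame `(-1, 0)`, listed from right to left. In this
order slopes increase along both kinds of chains, so that one treatment covers both. -/
theorem LowerChain.subChain {σ : ℝ} (hσ : σ = 1 ∨ σ = -1) {P : Finset Pt} {t : PTree}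
    (h : LowerChain P (σ, 0) t.toList) : SubChain σ P none none t := by
  have hd : ∀ p : Pt, dot (σ, 0) p = σ * p.1 := fun p => by simp [dot]
  have hc : ∀ p : Pt, cross (σ, 0) p = σ * p.2 := fun p => by simp [cross]
  have hf : t.toList.head h.ne = t.first := t.head_toList
  have hl : t.toList.getLast h.ne = t.last := t.getLast_toList
  have mono : t.toList.Pairwise (fun p q => σ * p.1 < σ * q.1) := by
    have := h.mono
    simpa only [hd] using this
  have hfl : ∀ p ∈ P, σ * t.first.1 ≤ σ * p.1 := fun p hp => by
    have := h.first_le p hp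
    rwa [hf, hd, hd] at this
  have hll : ∀ p ∈ P, σ * p.1 ≤ σ * t.last.1 := fun p hp => by
    have := h.le_last p hp
    rwa [hl, hd, hd] at this
  -- Without bounds for the slope the end points of the chain must be optimal even on vertical sides
  -- of the hull: they are extreme on their vertical lines, by the adjacent edge or, for a single
  -- point, by `LowerChain.single`.
  have ends : (∀ p ∈ P, p.1 = t.first.1 → σ * t.first.2 ≤ σ * p.2) ∧
      (∀ p ∈ P, p.1 = t.last.1 → σ * t.last.2 ≤ σ * p.2) := by
    cases t with
    | leaf a =>
      have := h.single a rfl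
      simp only [hc] at this
      exact ⟨fun p hp _ => this p hp, fun p hp _ => this p hp⟩
    | node l r =>
      have key : ∀ {a b p : Pt}, HullEdge P a b → σ * a.1 < σ * b.1 → p ∈ P →
          (p.1 = a.1 → σ * a.2 ≤ σ * p.2) ∧ (p.1 = b.1 → σ * b.2 ≤ σ * p.2) := by
        intro a b p hab hlt hp
        have h1 := (hab.optAt hσ hlt).1.2 p hp
        have h2 := (hab.optAt hσ hlt).2.2 p hp
        simp only [gap] at h1 h2
        refine ⟨fun e => ?_, fun e => ?_⟩
        · rw [e] at h1; linarith
        · rw [e] at h2; linarith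
      constructor
      · intro p hp hX
        obtain ⟨k, hk⟩ := (PTree.node l r).toList_eq_cons
        cases k with
        | nil =>
          have := congrArg List.length hk
          have h1 := List.length_pos_of_ne_nil l.toList_ne_nil
          have h2 := List.length_pos_of_ne_nil r.toList_ne_nil
          simp [PTree.toList] at this
          omega
        | cons b k =>
          have c1 := h.chain
          rw [hk] at c1 mono
          exact (key c1.rel ((List.pairwise_cons.1 mono).1 b (by simp)) hp).1 hX
      · intro p hp hX
        obtain ⟨k, hk⟩ := (PTree.node l r).toList_eq_concat
        rcases List.eq_nil_or_concat k with rfl | ⟨k', c, rfl⟩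
        · have := congrArg List.length hk
          have h1 := List.length_pos_of_ne_nil l.toList_ne_nil
          have h2 := List.length_pos_of_ne_nil r.toList_ne_nil
          simp [PTree.toList] at this
          omega
        · have c1 := h.chain
          rw [hk, List.concat_eq_append, List.append_assoc] at c1 mono
          exact (key (List.isChain_append.1 c1).2.1.rel
            ((List.pairwise_append.1 mono).2.1.rel_of_mem_take_of_mem_drop (i := 1)
              (by simp) (by simp)) hp).2 hX
  have inj : ∀ {x y : ℝ}, σ * x = σ * y → x = y := by
    rcases hσ with rfl | rfl <;> intro x y h <;> linarith
  exact {
    mem := fun p hp => (h.isVertex p hp).1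
    mono := mono
    chain := h.chain
    low := fun s _ p hp hX => by
      have e := inj (le_antisymm hX (hfl p hp))
      have := ends.1 p hp e
      simp only [gap]; rw [e]; linarith
    high := fun s _ p hp hX => by
      have e := inj (le_antisymm (hll p hp) hX)
      have := ends.2 p hp e
      simp only [gap]; rw [e]; linarith
    lowEnd := fun _ => hfl
    highEnd := fun _ => hll }

noncomputable def encodeOption : Option ℝ → Val
  | none => .nil
  | some x => .pair (.num x) .nil

section

variable {env : List Val} {lo hi : Option ℝ} {s : ℝ} {e₁ e₂ e₃ e₄ : Expr} {s₁ s₂ : ℕ}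

theorem raise_spec (h₁ : Ev prog env e₁ (encodeOption lo) s₁) (h₂ : Ev prog env e₂ (.num s) s₂) :
    Ev prog env (mk2 17 e₁ e₂) (encodeOption (some (raise lo s))) (s₁ + s₂ + 50) := by
  refine (Ev.call (f := 17) (Ev.pair h₁ h₂) rfl (Ev.pure (t := 40) ?_ (by decide))).mono (by omega)
  cases lo with
  | none => rfl
  | some l =>
    by_cases h : l < s
    · simp [raiseBody, pev, encodeOption, raise, h, h.le]
    · simp [raiseBody, pev, encodeOption, raise, h, not_lt.1 h]

theorem lower_spec (h₁ : Ev prog env e₁ (encodeOption hi) s₁) (h₂ : Ev prog env e₂ (.num s) s₂) :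
    Ev prog env (mk2 18 e₁ e₂) (encodeOption (some (lower hi s))) (s₁ + s₂ + 50) := by
  refine (Ev.call (f := 18) (Ev.pair h₁ h₂) rfl (Ev.pure (t := 40) ?_ (by decide))).mono (by omega)
  cases hi with
  | none => rfl
  | some l =>
    by_cases h : s < l
    · simp [lowerBody, pev, encodeOption, lower, h, h.le]
    · simp [lowerBody, pev, encodeOption, lower, h, not_lt.1 h]

theorem pev_sideE {c : Bool} (h₁ : pev env e₁ = some (encodeOption lo))
    (h₂ : pev env e₂ = some (encodeOption hi)) (h₃ : pev env e₃ = some (.num s))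
    (h₄ : pev env e₄ = some (flag c)) : ∃ d, pev env (sideE e₁ e₂ e₃ e₄) = some (flag d) ∧
      ((∃ l ∈ lo, s ≤ l) ∧ d = true ∨ (∃ l ∈ hi, l ≤ s) ∧ d = false ∨
        (∀ l ∈ lo, l ≤ s) ∧ (∀ l ∈ hi, s ≤ l) ∧ d = c) := by
  have inner : ∃ d, pev env (.ifPair e₂ (.ifLt e₃ e₂.fst e₄ .nil) e₄) = some (flag d) ∧
      ((∃ l ∈ hi, l ≤ s) ∧ d = false ∨ (∀ l ∈ hi, s ≤ l) ∧ d = c) := by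
    cases hi with
    | none => exact ⟨c, by simpa [pev, h₂, encodeOption] using h₄, by simp⟩
    | some l =>
      by_cases h : s < l
      · exact ⟨c, by simp [pev, h₂, h₃, h₄, encodeOption, h], by simp [h.le]⟩
      · exact ⟨false, by simp [pev, h₂, h₃, encodeOption, h, flag], by simp [not_lt.1 h]⟩
  obtain ⟨d, hd, hd'⟩ := inner
  rw [sideE]
  generalize (Expr.ifPair e₂ (.ifLt e₃ e₂.fst e₄ .nil) e₄) = E at hd
  cases lo with
  | none =>
    refine ⟨d, by simpa [pev, h₁, encodeOption] using hd, ?_⟩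
    rcases hd' with h | h
    · exact Or.inr (Or.inl h)
    · exact Or.inr (Or.inr ⟨by simp, h⟩)
  | some l =>
    by_cases h : l < s
    · refine ⟨d, by simp [pev, h₁, h₃, encodeOption, h, hd], ?_⟩
      rcases hd' with h' | h'
      · exact Or.inr (Or.inl h')
      · exact Or.inr (Or.inr ⟨by simp [h.le], h'⟩)
    · exact ⟨true, by simp [pev, h₁, h₃, encodeOption, h, flag, yes],
        Or.inl ⟨by simp [not_lt.1 h], rfl⟩⟩

end

/-- The chains `A` and `B` contain supporting points for a slope with greatest gap. -/
structure SepHyp (P Q : Finset Pt) (lo hi : Option ℝ) (A B : PTree) : Prop where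
  subA : SubChain 1 P lo hi A
  subB : SubChain (-1) Q lo hi B
  lo_at : ∀ l ∈ lo, LoAt P Q l
  hi_at : ∀ l ∈ hi, HiAt P Q l

/-- The slope `s` has the greatest gap. -/
structure GapOpt (P Q : Finset Pt) (s : ℝ) (a b : Pt) : Prop where
  left : OptAt 1 P s a
  right : OptAt (-1) Q s b
  le : ∃ a b, OptAt 1 P s a ∧ OptAt (-1) Q s b ∧ a.1 ≤ b.1
  ge : ∃ a b, OptAt 1 P s a ∧ OptAt (-1) Q s b ∧ b.1 ≤ a.1

section

variable {P Q : Finset Pt} {lo hi : Option ℝ} {A B l r l' r' : PTree}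

theorem loAt_raise (h : ∀ l ∈ lo, LoAt P Q l) {m : ℝ}
    (hm : (∃ l ∈ lo, m ≤ l) ∨ LoAt P Q m) : ∀ l ∈ some (raise lo m), LoAt P Q l := by
  intro x hx
  obtain rfl : raise lo m = x := by simpa using hx
  rcases raise_eq lo m with h1 | ⟨h1, h2⟩
  · exact h _ h1
  · rcases hm with ⟨l, hl, hml⟩ | hm
    · rw [h1, le_antisymm hml (h2 l hl)]; exact h l hl
    · rwa [h1]

theorem hiAt_lower (h : ∀ l ∈ hi, HiAt P Q l) {m : ℝ}
    (hm : (∃ l ∈ hi, l ≤ m) ∨ HiAt P Q m) : ∀ l ∈ some (lower hi m), HiAt P Q l := by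
  intro x hx
  obtain rfl : lower hi m = x := by simpa using hx
  rcases lower_eq hi m with h1 | ⟨h1, h2⟩
  · exact h _ h1
  · rcases hm with ⟨l, hl, hml⟩ | hm
    · rw [h1, ← le_antisymm hml (h2 l hl)]; exact h l hl
    · rwa [h1]

theorem SepHyp.rightA (h : SepHyp P Q lo hi (.node l r) B)
    (hm : (∃ x ∈ lo, secant l.last r.first ≤ x) ∨ LoAt P Q (secant l.last r.first)) :
    SepHyp P Q (some (raise lo (secant l.last r.first))) hi r B :=
  ⟨h.subA.goRight (Or.inl rfl), h.subB.raise _, loAt_raise h.lo_at hm, h.hi_at⟩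

theorem SepHyp.leftA (h : SepHyp P Q lo hi (.node l r) B)
    (hm : (∃ x ∈ hi, x ≤ secant l.last r.first) ∨ HiAt P Q (secant l.last r.first)) :
    SepHyp P Q lo (some (lower hi (secant l.last r.first))) l B :=
  ⟨h.subA.goLeft (Or.inl rfl), h.subB.lower _, h.lo_at, hiAt_lower h.hi_at hm⟩

theorem SepHyp.rightB (h : SepHyp P Q lo hi A (.node l r))
    (hm : (∃ x ∈ lo, secant l.last r.first ≤ x) ∨ LoAt P Q (secant l.last r.first)) :
    SepHyp P Q (some (raise lo (secant l.last r.first))) hi A r :=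
  ⟨h.subA.raise _, h.subB.goRight (Or.inr rfl), loAt_raise h.lo_at hm, h.hi_at⟩

theorem SepHyp.leftB (h : SepHyp P Q lo hi A (.node l r))
    (hm : (∃ x ∈ hi, x ≤ secant l.last r.first) ∨ HiAt P Q (secant l.last r.first)) :
    SepHyp P Q lo (some (lower hi (secant l.last r.first))) A l :=
  ⟨h.subA.lower _, h.subB.goLeft (Or.inr rfl), h.lo_at, hiAt_lower h.hi_at hm⟩

/-- At the slope of a middle edge both of its ends are optimal for its own set. By monotonicity, an
optimal point of the other set is located relative to the middle edge of that set, since the two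
slopes are comparable. Comparing the abscissas `r.first.1` and `r'.first.1` then shows on which side
of one of the two slopes the gap grows. -/
theorem SepHyp.step (h : SepHyp P Q lo hi (.node l r) (.node l' r')) :
    (secant l.last r.first < secant l'.last r'.first → r.first.1 < r'.first.1 →
      LoAt P Q (secant l.last r.first)) ∧
    (secant l.last r.first < secant l'.last r'.first → ¬ r.first.1 < r'.first.1 →
      HiAt P Q (secant l'.last r'.first)) ∧
    (¬ secant l.last r.first < secant l'.last r'.first → r'.first.1 < r.first.1 →
      HiAt P Q (secant l.last r.first)) ∧
    (¬ secant l.last r.first < secant l'.last r'.first → ¬ r'.first.1 < r.first.1 →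
      LoAt P Q (secant l'.last r'.first)) := by
  obtain ⟨x1, x2, x3⟩ := h.subA.edge (Or.inl rfl)
  obtain ⟨y1, y2, y3⟩ := h.subB.edge (Or.inr rfl)
  refine ⟨fun i1 i2 => ?_, fun i1 i2 => ?_, fun i1 i2 => ?_, fun i1 i2 => ?_⟩
  · obtain ⟨b, b1, b2⟩ := y2.exists_le i1.le
    exact ⟨_, b, x3, b1, by linarith⟩
  · obtain ⟨a, a1, a2⟩ := x3.exists_ge i1.le
    exact ⟨a, _, a1, y3, by linarith⟩
  · obtain ⟨b, b1, b2⟩ := y3.exists_ge (not_lt.1 i1)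
    exact ⟨_, b, x3, b1, by linarith⟩
  · obtain ⟨a, a1, a2⟩ := x2.exists_le (not_lt.1 i1)
    exact ⟨a, _, a1, y2, by linarith⟩

theorem SepHyp.step_leaf_right {b : Pt} (h : SepHyp P Q lo hi (.node l r) (.leaf b))
    (hl : ∀ x ∈ lo, x ≤ secant l.last r.first) (hh : ∀ x ∈ hi, secant l.last r.first ≤ x) :
    (r.first.1 < b.1 → LoAt P Q (secant l.last r.first)) ∧
      (¬ r.first.1 < b.1 → HiAt P Q (secant l.last r.first)) := by
  obtain ⟨x1, x2, x3⟩ := h.subA.edge (Or.inl rfl)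
  have hb := h.subB.optAt_leaf hl hh
  exact ⟨fun i => ⟨_, b, x3, hb, i⟩, fun i => ⟨_, b, x3, hb, not_lt.1 i⟩⟩

theorem SepHyp.step_leaf_left {a : Pt} (h : SepHyp P Q lo hi (.leaf a) (.node l r))
    (hl : ∀ x ∈ lo, x ≤ secant l.last r.first) (hh : ∀ x ∈ hi, secant l.last r.first ≤ x) :
    (¬ r.first.1 < a.1 → LoAt P Q (secant l.last r.first)) ∧
      (r.first.1 < a.1 → HiAt P Q (secant l.last r.first)) := by
  obtain ⟨x1, x2, x3⟩ := h.subB.edge (Or.inr rfl)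
  have ha := h.subA.optAt_leaf hl hh
  exact ⟨fun i => ⟨a, _, ha, x2, by linarith⟩, fun i => ⟨a, _, ha, x3, i.le⟩⟩

/-- The final slope. -/
theorem SepHyp.leaf {a b : Pt} (h : SepHyp P Q lo hi (.leaf a) (.leaf b))
    (ov₁ : ∃ p ∈ P, ∃ q ∈ Q, p.1 ≤ q.1) (ov₂ : ∃ p ∈ P, ∃ q ∈ Q, q.1 ≤ p.1) :
    (a.1 < b.1 → ∃ s, hi = some s ∧ GapOpt P Q s a b) ∧
    (¬ a.1 < b.1 → (∃ s, lo = some s ∧ GapOpt P Q s a b) ∨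
      (lo = none ∧ ∃ s, hi = some s ∧ GapOpt P Q s a b) ∨
      (lo = none ∧ hi = none ∧ GapOpt P Q 0 a b)) := by
  have opt : ∀ s, (∀ l ∈ lo, l ≤ s) → (∀ l ∈ hi, s ≤ l) → OptAt 1 P s a ∧ OptAt (-1) Q s b :=
    fun s h1 h2 => ⟨h.subA.optAt_leaf h1 h2, h.subB.optAt_leaf h1 h2⟩
  have order : ∀ l ∈ lo, ∀ l' ∈ hi, l ≤ l' := fun l hl l' hl' => (h.lo_at l hl).le (h.hi_at l' hl')
  constructor
  · intro hab
    cases hi with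
    | none =>
      -- Without an upper bound, `a` is a rightmost point of `P` and `b` a leftmost point of `Q`, so
      -- `P` would be entirely to the left of `Q`.
      exfalso
      obtain ⟨p, hp, q, hq, hpq⟩ := ov₂
      have h1 := h.subA.highEnd rfl p hp
      have h2 := h.subB.highEnd rfl q hq
      simp only [PTree.last] at h1 h2
      linarith
    | some s =>
      obtain ⟨o1, o2⟩ := opt s (fun l hl => order l hl s rfl) (by simp)
      exact ⟨s, rfl, o1, o2, ⟨a, b, o1, o2, hab.le⟩, h.hi_at s rfl⟩
  · intro hab
    cases lo with
    | some s =>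
      left
      obtain ⟨o1, o2⟩ := opt s (by simp) (fun l hl => order s rfl l hl)
      obtain ⟨a', b', h1, h2, h3⟩ := h.lo_at s rfl
      exact ⟨s, rfl, o1, o2, ⟨a', b', h1, h2, h3.le⟩, ⟨a, b, o1, o2, not_lt.1 hab⟩⟩
    | none =>
      right
      obtain ⟨p, hp, q, hq, hpq⟩ := ov₁
      have h1 := h.subA.lowEnd rfl p hp
      have h2 := h.subB.lowEnd rfl q hq
      simp only [PTree.first] at h1 h2
      -- Without a lower bound, `a` is a leftmost point of `P` and `b` a rightmost point of `Q`; by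
      -- the overlap `a.1 ≤ b.1`.
      have e : a.1 = b.1 := by linarith
      cases hi with
      | none =>
        obtain ⟨o1, o2⟩ := opt 0 (by simp) (by simp)
        exact Or.inr ⟨rfl, rfl, o1, o2, ⟨a, b, o1, o2, e.le⟩, ⟨a, b, o1, o2, e.ge⟩⟩
      | some s =>
        obtain ⟨o1, o2⟩ := opt s (by simp) (by simp)
        exact Or.inl ⟨rfl, s, rfl, o1, o2, ⟨a, b, o1, o2, e.le⟩, ⟨a, b, o1, o2, e.ge⟩⟩

open Classical in
theorem pev_ltFlag {env : List Val} {e₁ e₂ : Expr} {x y : ℝ} (h₁ : pev env e₁ = some (.num x))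
    (h₂ : pev env e₂ = some (.num y)) :
    pev env (.ifLt e₁ e₂ yes .nil) = some (flag (decide (x < y))) ∧
      pev env (.ifLt e₁ e₂ .nil yes) = some (flag (decide (¬ x < y))) := by
  by_cases h : x < y <;> simp [pev, h₁, h₂, h, yes, flag]

theorem fst_encodePt {env : List Val} {e : Expr} {p : Pt} (h : pev env e = some (encodePt p)) :
    pev env e.fst = some (.num p.1) := by simp [pev, h, encodePt]

/-- Every round halves one chain and tightens one bound for the slope. A leaf is known to be optimal
only for slopes between the bounds. Against a leaf, `sideE` therefore compares the slope of the
middle edge with the bounds first: outside of them the edge is discarded without a geometric test,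
inside the leaf gives the direction of growth of the gap. -/
theorem sepSearchBody_spec (ov₁ : ∃ p ∈ P, ∃ q ∈ Q, p.1 ≤ q.1) (ov₂ : ∃ p ∈ P, ∃ q ∈ Q, q.1 ≤ p.1)
    (h : SepHyp P Q lo hi A B) : ∃ s a b, GapOpt P Q s a b ∧
      Ev prog [.pair A.encode (.pair B.encode (.pair (encodeOption lo) (encodeOption hi)))]
        sepSearchBody (.pair (.num s) (.pair (encodePt a) (encodePt b)))
        (2000 * (A.height + B.height) + 1000) := by
  classical
  induction hn : A.height + B.height using Nat.strong_induction_on generalizing A B lo hi with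
  | _ n ih =>
  subst hn
  set inp : Val := .pair A.encode (.pair B.encode
    (.pair (encodeOption lo) (encodeOption hi))) with hinp
  have pA : pev [inp] (fst (var 0)) = some A.encode := rfl
  have pB : pev [inp] (fst (snd (var 0))) = some B.encode := rfl
  have plo : pev [inp] (fst (snd (snd (var 0)))) = some (encodeOption lo) := rfl
  have phi : pev [inp] (snd (snd (snd (var 0)))) = some (encodeOption hi) := rfl
  clear_value inp
  have zlo := Ev.pure (F := prog) plo (t := 250) (by decide)
  have zhi := Ev.pure (F := prog) phi (t := 250) (by decide)
  have go : ∀ {A' B' : PTree} {lo' hi' : Option ℝ} {eA eB elo ehi : Expr},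
      SepHyp P Q lo' hi' A' B' → A'.height + B'.height < A.height + B.height →
      pev [inp] eA = some A'.encode → eA.size ≤ 10 → pev [inp] eB = some B'.encode →
      eB.size ≤ 10 → Ev prog [inp] elo (encodeOption lo') 250 →
      Ev prog [inp] ehi (encodeOption hi') 250 → ∃ s a b, GapOpt P Q s a b ∧
      Ev prog [inp] (.call 19 (.pair eA (.pair eB (.pair elo ehi))))
        (.pair (.num s) (.pair (encodePt a) (encodePt b)))
        (2000 * (A.height + B.height)) := by
    intro A' B' lo' hi' eA eB elo ehi h' hlt p1 s1 p2 s2 p3 p4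
    obtain ⟨s, a, b, k1, k2⟩ := ih _ hlt h' rfl
    exact ⟨s, a, b, k1, (Ev.call (f := 19) (Ev.pair (Ev.pure p1 s1) (Ev.pair (Ev.pure p2 s2)
      (Ev.pair p3 p4))) rfl k2).mono (by omega)⟩
  clear ih
  cases A with
  | leaf a =>
    have pa : pev [inp] (snd (fst (var 0))) = some (encodePt a) := by
      simp [pev] at pA ⊢; simp [pA, PTree.encode]
    have pA0 : pev [inp] (fst (fst (var 0))) = some .nil := by
      simp [pev] at pA ⊢; simp [pA, PTree.encode]
    cases B with
    | leaf b =>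
      obtain ⟨k1, k2⟩ := h.leaf ov₁ ov₂
      have pb : pev [inp] (snd (fst (snd (var 0)))) = some (encodePt b) := by
        simp [pev] at pB ⊢; simp [pB, PTree.encode]
      have pB0 : pev [inp] (fst (fst (snd (var 0)))) = some .nil := by
        simp [pev] at pB ⊢; simp [pB, PTree.encode]
      have zpa := Ev.pure (F := prog) (fst_encodePt pa) (t := 10) (by decide)
      have zpb := Ev.pure (F := prog) (fst_encodePt pb) (t := 10) (by decide)
      have main : ∃ s, GapOpt P Q s a b ∧ Ev prog [inp]
          (.ifLt (fst (snd (fst (var 0)))) (fst (snd (fst (snd (var 0)))))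
          (fst (snd (snd (snd (var 0))))) (.ifPair (fst (snd (snd (var 0))))
          (fst (fst (snd (snd (var 0))))) (.ifPair (snd (snd (snd (var 0))))
          (fst (snd (snd (snd (var 0))))) (.const 0)))) (.num s) 800 := by
        by_cases hab : a.1 < b.1
        · obtain ⟨s, rfl, hs⟩ := k1 hab
          exact ⟨s, hs, (Ev.ifLt_pos zpa zpb hab (Ev.fst zhi)).mono (by omega)⟩
        · rcases k2 hab with ⟨s, rfl, hs⟩ | ⟨rfl, s, rfl, hs⟩ | ⟨rfl, rfl, hs⟩
          · exact ⟨s, hs, (Ev.ifLt_neg zpa zpb hab (Ev.ifPair_pos zlo (Ev.fst zlo))).mono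
              (by omega)⟩
          · exact ⟨s, hs, (Ev.ifLt_neg zpa zpb hab (Ev.ifPair_nil zlo (Ev.ifPair_pos zhi
              (Ev.fst zhi)))).mono (by omega)⟩
          · refine ⟨0, hs, (Ev.ifLt_neg zpa zpb hab (Ev.ifPair_nil zlo (Ev.ifPair_nil zhi
              (Ev.pure (t := 1) ?_ (by decide))))).mono (by omega)⟩
            simp [pev]
      obtain ⟨s, hs, hs'⟩ := main
      exact ⟨s, a, b, hs, (Ev.ifPair_nil (Ev.pure pA0 (t := 10) (by decide)) (Ev.ifPair_nil
        (Ev.pure pB0 (t := 10) (by decide)) (Ev.pair hs'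
        (Ev.pair (Ev.pure pa (t := 10) (by decide)) (Ev.pure pb (t := 10) (by decide)))))).mono
        (by omega)⟩
    | node l r =>
      obtain ⟨y1, -, -⟩ := h.subB.edge (Or.inr rfl)
      have ps := pev_slopeE (pev_lastLeaf (pev_left pB)) (pev_firstLeaf (pev_right pB))
        (by intro e; rw [e] at y1; exact lt_irrefl _ y1)
      change _ = some (Val.num (secant l.last r.first)) at ps
      have pβ := fst_encodePt (pev_firstLeaf (pev_right pB))
      obtain ⟨d, hd, hd'⟩ := pev_sideE plo phi ps (pev_ltFlag pβ (fst_encodePt pa)).2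
      have zd := Ev.pure (F := prog) hd (t := 700) (by decide)
      have zs := Ev.pure (F := prog) ps (t := 150) (by decide)
      have pB0 : ∃ x y, pev [inp] (fst (fst (snd (var 0)))) = some (.pair x y) := by
        simp only [pev] at pB ⊢; simp only [pB, PTree.encode]; exact ⟨_, _, rfl⟩
      obtain ⟨_, _, pB0⟩ := pB0
      have m1 : l.height ≤ max l.height r.height := le_max_left _ _
      have m2 : r.height ≤ max l.height r.height := le_max_right _ _
      have kr : (∃ x ∈ lo, secant l.last r.first ≤ x) ∨ LoAt P Q (secant l.last r.first) →
          d = true → ∃ s x y, GapOpt P Q s x y ∧ Ev prog [inp]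
          sepSearchBody (.pair (.num s) (.pair (encodePt x) (encodePt y)))
          (2000 * ((PTree.leaf a).height + (PTree.node l r).height) + 1000) := by
        intro hm hdt
        subst hdt
        obtain ⟨s, a', b', g1, g2⟩ := go (h.rightB hm) (by simp only [PTree.height]; omega)
          pA (by decide) (pev_right pB) (by decide) ((raise_spec (Ev.pure plo (t := 10)
          (by decide)) zs).mono (by omega : _ ≤ 250)) zhi
        exact ⟨s, a', b', g1, (Ev.ifPair_nil (Ev.pure pA0 (t := 10) (by decide)) (Ev.ifPair_pos
          (Ev.pure pB0 (t := 10) (by decide)) (Ev.ifPair_pos zd g2))).mono (by omega)⟩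
      have kl : (∃ x ∈ hi, x ≤ secant l.last r.first) ∨ HiAt P Q (secant l.last r.first) →
          d = false → ∃ s x y, GapOpt P Q s x y ∧ Ev prog [inp]
          sepSearchBody (.pair (.num s) (.pair (encodePt x) (encodePt y)))
          (2000 * ((PTree.leaf a).height + (PTree.node l r).height) + 1000) := by
        intro hm hdt
        subst hdt
        obtain ⟨s, a', b', g1, g2⟩ := go (h.leftB hm) (by simp only [PTree.height]; omega)
          pA (by decide) (pev_left pB) (by decide) zlo
          ((lower_spec (Ev.pure phi (t := 10) (by decide)) zs).mono
          (by omega : _ ≤ 250))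
        exact ⟨s, a', b', g1, (Ev.ifPair_nil (Ev.pure pA0 (t := 10) (by decide)) (Ev.ifPair_pos
          (Ev.pure pB0 (t := 10) (by decide)) (Ev.ifPair_nil zd g2))).mono (by omega)⟩
      rcases hd' with ⟨h1, h2⟩ | ⟨h1, h2⟩ | ⟨h1, h2, h3⟩
      · exact kr (Or.inl h1) h2
      · exact kl (Or.inl h1) h2
      · have := h.step_leaf_left h1 h2
        by_cases hc : r.first.1 < a.1
        · exact kl (Or.inr (this.2 hc)) (by simpa [hc] using h3)
        · exact kr (Or.inr (this.1 hc)) (by simpa [hc] using h3)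
  | node l r =>
    obtain ⟨x1, -, -⟩ := h.subA.edge (Or.inl rfl)
    have ps := pev_slopeE (pev_lastLeaf (pev_left pA)) (pev_firstLeaf (pev_right pA))
      (by intro e; rw [e] at x1; exact lt_irrefl _ x1)
    change _ = some (Val.num (secant l.last r.first)) at ps
    have pα := fst_encodePt (pev_firstLeaf (pev_right pA))
    have zs := Ev.pure (F := prog) ps (t := 150) (by decide)
    have pA0 : ∃ x y, pev [inp] (fst (fst (var 0))) = some (.pair x y) := by
      simp only [pev] at pA ⊢; simp only [pA, PTree.encode]; exact ⟨_, _, rfl⟩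
    obtain ⟨_, _, pA0⟩ := pA0
    have zA := Ev.pure (F := prog) pA0 (t := 10) (by decide)
    have m1 : l.height ≤ max l.height r.height := le_max_left _ _
    have m2 : r.height ≤ max l.height r.height := le_max_right _ _
    have gr := fun hm => go (h.rightA hm) (by simp only [PTree.height]; omega)
      (pev_right pA) (by decide) pB (by decide)
      ((raise_spec (Ev.pure plo (t := 10) (by decide)) zs).mono
          (by omega : _ ≤ 250)) zhi
    have gl := fun hm => go (h.leftA hm) (by simp only [PTree.height]; omega)
      (pev_left pA) (by decide) pB (by decide) zlo
      ((lower_spec (Ev.pure phi (t := 10) (by decide)) zs).mono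
          (by omega : _ ≤ 250))
    cases B with
    | leaf b =>
      have pb : pev [inp] (snd (fst (snd (var 0)))) = some (encodePt b) := by
        simp [pev] at pB ⊢; simp [pB, PTree.encode]
      have pB0 : pev [inp] (fst (fst (snd (var 0)))) = some .nil := by
        simp [pev] at pB ⊢; simp [pB, PTree.encode]
      have zB := Ev.pure (F := prog) pB0 (t := 10) (by decide)
      obtain ⟨d, hd, hd'⟩ := pev_sideE plo phi ps (pev_ltFlag pα (fst_encodePt pb)).1
      have zd := Ev.pure (F := prog) hd (t := 700) (by decide)
      have kr : (∃ x ∈ lo, secant l.last r.first ≤ x) ∨ LoAt P Q (secant l.last r.first) →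
          d = true → ∃ s x y, GapOpt P Q s x y ∧ Ev prog [inp]
          sepSearchBody (.pair (.num s) (.pair (encodePt x) (encodePt y)))
          (2000 * ((PTree.node l r).height + (PTree.leaf b).height) + 1000) := by
        intro hm hdt
        subst hdt
        obtain ⟨s, a', b', g1, g2⟩ := gr hm
        exact ⟨s, a', b', g1, (Ev.ifPair_pos zA (Ev.ifPair_nil zB (Ev.ifPair_pos zd g2))).mono
          (by omega)⟩
      have kl : (∃ x ∈ hi, x ≤ secant l.last r.first) ∨ HiAt P Q (secant l.last r.first) →
          d = false → ∃ s x y, GapOpt P Q s x y ∧ Ev prog [inp]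
          sepSearchBody (.pair (.num s) (.pair (encodePt x) (encodePt y)))
          (2000 * ((PTree.node l r).height + (PTree.leaf b).height) + 1000) := by
        intro hm hdt
        subst hdt
        obtain ⟨s, a', b', g1, g2⟩ := gl hm
        exact ⟨s, a', b', g1, (Ev.ifPair_pos zA (Ev.ifPair_nil zB (Ev.ifPair_nil zd g2))).mono
          (by omega)⟩
      rcases hd' with ⟨h1, h2⟩ | ⟨h1, h2⟩ | ⟨h1, h2, h3⟩
      · exact kr (Or.inl h1) h2
      · exact kl (Or.inl h1) h2
      · have := h.step_leaf_right h1 h2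
        by_cases hc : r.first.1 < b.1
        · exact kr (Or.inr (this.1 hc)) (by simpa [hc] using h3)
        · exact kl (Or.inr (this.2 hc)) (by simpa [hc] using h3)
    | node l' r' =>
      obtain ⟨y1, -, -⟩ := h.subB.edge (Or.inr rfl)
      have ps' := pev_slopeE (pev_lastLeaf (pev_left pB)) (pev_firstLeaf (pev_right pB))
        (by intro e; rw [e] at y1; exact lt_irrefl _ y1)
      change _ = some (Val.num (secant l'.last r'.first)) at ps'
      have pβ := fst_encodePt (pev_firstLeaf (pev_right pB))
      have zs' := Ev.pure (F := prog) ps' (t := 150) (by decide)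
      have pB0 : ∃ x y, pev [inp] (fst (fst (snd (var 0)))) = some (.pair x y) := by
        simp only [pev] at pB ⊢; simp only [pB, PTree.encode]; exact ⟨_, _, rfl⟩
      obtain ⟨_, _, pB0⟩ := pB0
      have zB := Ev.pure (F := prog) pB0 (t := 10) (by decide)
      have zα := Ev.pure (F := prog) pα (t := 50) (by decide)
      have zβ := Ev.pure (F := prog) pβ (t := 50) (by decide)
      have m1' : l'.height ≤ max l'.height r'.height := le_max_left _ _
      have m2' : r'.height ≤ max l'.height r'.height := le_max_right _ _
      obtain ⟨k1, k2, k3, k4⟩ := h.step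
      by_cases i1 : secant l.last r.first < secant l'.last r'.first
      · by_cases i2 : r.first.1 < r'.first.1
        · obtain ⟨s, a', b', g1, g2⟩ := gr (Or.inr (k1 i1 i2))
          exact ⟨s, a', b', g1, (Ev.ifPair_pos zA (Ev.ifPair_pos zB (Ev.ifLt_pos zs zs' i1
            (Ev.ifLt_pos zα zβ i2 g2)))).mono (by omega)⟩
        · obtain ⟨s, a', b', g1, g2⟩ := go (h.leftB (Or.inr (k2 i1 i2)))
            (by simp only [PTree.height]; omega) pA (by decide) (pev_left pB) (by decide) zlo
            ((lower_spec (Ev.pure phi (t := 10) (by decide)) zs').mono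
          (by omega : _ ≤ 250))
          exact ⟨s, a', b', g1, (Ev.ifPair_pos zA (Ev.ifPair_pos zB (Ev.ifLt_pos zs zs' i1
            (Ev.ifLt_neg zα zβ i2 g2)))).mono (by omega)⟩
      · by_cases i2 : r'.first.1 < r.first.1
        · obtain ⟨s, a', b', g1, g2⟩ := gl (Or.inr (k3 i1 i2))
          exact ⟨s, a', b', g1, (Ev.ifPair_pos zA (Ev.ifPair_pos zB (Ev.ifLt_neg zs zs' i1
            (Ev.ifLt_pos zβ zα i2 g2)))).mono (by omega)⟩
        · obtain ⟨s, a', b', g1, g2⟩ := go (h.rightB (Or.inr (k4 i1 i2)))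
            (by simp only [PTree.height]; omega) pA (by decide) (pev_right pB) (by decide)
            ((raise_spec (Ev.pure plo (t := 10) (by decide)) zs').mono
          (by omega : _ ≤ 250)) zhi
          exact ⟨s, a', b', g1, (Ev.ifPair_pos zA (Ev.ifPair_pos zB (Ev.ifLt_neg zs zs' i1
            (Ev.ifLt_neg zβ zα i2 g2)))).mono (by omega)⟩

end

/-- The gap at the computed slope is positive if there is a slope with positive gap. -/
theorem GapOpt.pos {P Q : Finset Pt} {s s' : ℝ} {a b : Pt} (h : GapOpt P Q s a b)
    (hs : ∀ p ∈ P, ∀ q ∈ Q, gap s' q < gap s' p) : gap s b < gap s a := by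
  have key : ∀ a' b', OptAt 1 P s a' → OptAt (-1) Q s b' → (s - s') * (a'.1 - b'.1) ≤ 0 →
      gap s b < gap s a := by
    intro a' b' h1 h2 h3
    have h4 := hs a' h1.1 b' h2.1
    rw [gap_shift s s' a', gap_shift s s' b'] at h4
    have h5 := h1.2 a h.left.1
    have h6 := h2.2 b h.right.1
    have h7 := h.left.2 a' h1.1
    have h8 := h.right.2 b' h2.1
    linarith
  -- The gap of a fixed pair is affine in the slope. Since optimal pairs of both directions exist at
  -- `s`, one can be chosen whose gap does not grow from `s` to `s'`.
  rcases le_total s' s with hle | hle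
  · obtain ⟨a', b', h1, h2, h3⟩ := h.le
    exact key a' b' h1 h2 (mul_nonpos_of_nonneg_of_nonpos (by linarith) (by linarith))
  · obtain ⟨a', b', h1, h2, h3⟩ := h.ge
    exact key a' b' h1 h2 (mul_nonpos_of_nonpos_of_nonneg (by linarith) (by linarith))

/-! ### Construction of a separating line -/

theorem exists_separating {P Q : Finset Pt}
    (h : Disjoint (convexHull ℝ (P : Set Pt)) (convexHull ℝ (Q : Set Pt))) :
    ∃ u c, (∀ p ∈ P, dot u p < c) ∧ ∀ q ∈ Q, c < dot u q := by
  obtain ⟨f, x, y, h1, h2, h3⟩ := geometric_hahn_banach_compact_closed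
    (convex_convexHull ℝ (P : Set Pt)) (P.finite_toSet.isCompact_convexHull (𝕜 := ℝ))
    (convex_convexHull ℝ (Q : Set Pt)) (Q.finite_toSet.isClosed_convexHull ℝ) h
  obtain ⟨u, hu⟩ := exists_dot_eq f
  refine ⟨u, x, fun p hp => ?_, fun q hq => ?_⟩
  · rw [← hu]; exact h1 p (subset_convexHull ℝ _ hp)
  · rw [← hu]; exact h2.trans (h3 q (subset_convexHull ℝ _ hq))

/-- Sets with disjoint hulls that overlap horizontally lie above each other. -/
theorem exists_gap {P Q : Finset Pt}
    (h : Disjoint (convexHull ℝ (P : Set Pt)) (convexHull ℝ (Q : Set Pt)))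
    (ov₁ : ∃ p ∈ P, ∃ q ∈ Q, p.1 ≤ q.1) (ov₂ : ∃ p ∈ P, ∃ q ∈ Q, q.1 ≤ p.1) :
    (∃ s, ∀ p ∈ P, ∀ q ∈ Q, gap s q < gap s p) ∨ ∃ s, ∀ q ∈ Q, ∀ p ∈ P, gap s p < gap s q := by
  obtain ⟨u, c, h1, h2⟩ := exists_separating h
  have e : u.2 ≠ 0 → ∀ p, dot u p = u.2 * gap (-u.1 / u.2) p := fun h0 p => by
    simp only [dot, gap]; field_simp; ring
  rcases lt_trichotomy u.2 0 with h0 | h0 | h0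
  · refine Or.inl ⟨-u.1 / u.2, fun p hp q hq => ?_⟩
    have := (h1 p hp).trans (h2 q hq)
    rw [e h0.ne, e h0.ne] at this
    exact (mul_lt_mul_left_of_neg h0).1 this
  · exfalso
    obtain ⟨p, hp, q, hq, hpq⟩ := ov₁
    obtain ⟨p', hp', q', hq', hpq'⟩ := ov₂
    have i1 := (h1 p hp).trans (h2 q hq)
    have i2 := (h1 p' hp').trans (h2 q' hq')
    simp only [dot, h0, zero_mul, add_zero] at i1 i2
    rcases le_total 0 u.1 with h3 | h3 <;> nlinarith
  · refine Or.inr ⟨-u.1 / u.2, fun q hq p hp => ?_⟩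
    have := (h1 p hp).trans (h2 q hq)
    rw [e h0.ne', e h0.ne'] at this
    exact (mul_lt_mul_iff_right₀ h0).1 this

section

variable {P Q : Finset Pt} {L L' : List Pt} {v w : Val} {N : ℕ} {env : List Val}
  {e₁ e₂ : Expr} {s₁ s₂ : ℕ}

theorem sepSearch_spec (h : Cyc P L) (h' : Cyc Q L') (H : Rep L v) (H' : Rep L' w)
    (hN : L.length ≤ N) (hN' : L'.length ≤ N)
    (ov₁ : ∃ p ∈ P, ∃ q ∈ Q, p.1 ≤ q.1) (ov₂ : ∃ p ∈ P, ∃ q ∈ Q, q.1 ≤ p.1)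
    (he₁ : Ev prog env e₁ v s₁) (he₂ : Ev prog env e₂ w s₂) :
    ∃ s a b, GapOpt P Q s a b ∧
      Ev prog env (.call 19 (.pair (mk2 15 e₁ (.pair (.const 1) (.const 0)))
        (.pair (mk2 15 e₂ (.pair (.const (-1)) (.const 0))) (.pair .nil .nil))))
        (.pair (.num s) (.pair (encodePt a) (encodePt b))) (s₁ + s₂ + 410000 * lam N) := by
  have hlam := one_le_lam N
  obtain ⟨D, d, d1, d2, d3, d4⟩ := chain_spec h H hN (u := (1, 0)) (by simp [dot]) he₁
    (e₂ := .pair (.const 1) (.const 0)) (Ev.pure (t := 10) (by simp [pev, encodePt]) (by decide))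
  obtain ⟨E, e, f1, f2, f3, f4⟩ := chain_spec h' H' hN' (u := (-1, 0)) (by simp [dot]) he₂
    (e₂ := .pair (.const (-1)) (.const 0))
    (Ev.pure (t := 10) (by simp [pev, encodePt]) (by decide))
  obtain ⟨A, A1, rfl, rfl⟩ := d2.exists_tree d1.ne
  obtain ⟨B, B1, rfl, rfl⟩ := f2.exists_tree f1.ne
  obtain ⟨s, a, b, k1, k2⟩ := sepSearchBody_spec (lo := none) (hi := none) ov₁ ov₂
    ⟨d1.subChain (Or.inl rfl), f1.subChain (Or.inr rfl), by simp, by simp⟩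
  have g1 := PTree.height_lt A1 d3
  have g2 := PTree.height_lt B1 f3
  rw [show Nat.log 2 N + 1 = lam N from rfl] at g1 g2
  exact ⟨s, a, b, k1, (Ev.call (f := 19) (Ev.pair d4 (Ev.pair f4
    (Ev.pure (t := 10) (v := .pair .nil .nil) rfl (by decide)))) rfl k2).mono (by omega)⟩

theorem pev_halfE {x y : ℝ} (h₁ : pev env e₁ = some (.num x)) (h₂ : pev env e₂ = some (.num y)) :
    pev env (halfE e₁ e₂) = some (.num ((x + y) / 2)) := by
  simp [halfE, pev, h₁, h₂]

theorem pev_zero_sub {e : Expr} {x : ℝ} (h : pev env e = some (.num x)) :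
    pev env (.sub (.const 0) e) = some (.num (-x)) := by
  simp [pev, h]

/-- The leftmost vertex comes first. -/
theorem IsBoundaryList.first_le {t : PTree} (h : IsBoundaryList (hullVertices P) t.toList) :
    ∀ p ∈ P, t.first.1 ≤ p.1 := by
  intro p hp
  have hc := h.cyc t.toList_ne_nil
  have := hc.dot_le (u := (1, 0)) (c := t.first.1) (fun q hq => by
    have h1 := h.start t.first (by rw [t.head?_toList]; rfl) q (hc.mem_iff.1 hq)
    have : t.first.1 ≤ q.1 := Prod.Lex.monotone_fst _ _ h1
    simpa [dot] using this) hp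
  simpa [dot] using this

theorem findRight_spec (h : Cyc P L) (H : Rep L v) (hN : L.length ≤ N)
    (he₁ : Ev prog env e₁ v s₁) : ∃ m ∈ P, (∀ p ∈ P, p.1 ≤ m.1) ∧
      Ev prog env (mk2 9 e₁ (.pair (.pair (.const (-1)) (.const 0))
        (.pair (.const 0) (.const 1)))) (encodePt m) (s₁ + 13000 * lam N) := by
  have hlam := one_le_lam N
  obtain ⟨m, h1, h2, h3⟩ := findLex_spec H h.1 h.2.1 h.ccw hN
    (e₂ := .pair (.pair (.const (-1)) (.const 0)) (.pair (.const 0) (.const 1)))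
    (f := (((-1 : ℤ) : ℝ), ((0 : ℤ) : ℝ))) (g := (((0 : ℤ) : ℝ), ((1 : ℤ) : ℝ)))
    (by simp [cross]) he₁ (Ev.pure rfl (t := 20) (by decide))
  refine ⟨m, (h.isVertex h1).1, fun p hp => ?_, h3.mono (by omega)⟩
  have := h.dot_le (u := (-1, 0)) (c := -m.1) (fun q hq => by
    have := (lex_le (h2 q hq)).1
    simpa [dot] using this) hp
  simpa [dot] using this

/-- Vertical lines are tried first. If they fail, the horizontal extents overlap, and a nonvertical
line separates the disjoint hulls with one of the sets on top. If `P` is on top, then the slope of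
greatest gap leaves a positive gap; otherwise the search with exchanged roles must succeed. The line
is placed in the middle of the gap. -/
theorem separate_spec (h : IsBoundaryList (hullVertices P) L)
    (h' : IsBoundaryList (hullVertices Q) L') (hL : L ≠ []) (hL' : L' ≠ []) (H : Rep L v)
    (H' : Rep L' w) (hN : L.length ≤ N) (hN' : L'.length ≤ N)
    (hd : Disjoint (convexHull ℝ (P : Set Pt)) (convexHull ℝ (Q : Set Pt)))
    (he₁ : Ev prog env e₁ v s₁) (he₂ : Ev prog env e₂ w s₂) :
    ∃ u c, (∀ p ∈ P, dot u p < c) ∧ (∀ q ∈ Q, c < dot u q) ∧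
      Ev prog env (mk2 20 e₁ e₂) (.pair (encodePt u) (.num c))
        (s₁ + s₂ + 1000000 * lam N) := by
  have hlam := one_le_lam N
  have hc := h.cyc hL
  have hc' := h'.cyc hL'
  obtain ⟨A, A1, rfl, rfl⟩ := H.exists_tree hL
  obtain ⟨B, B1, rfl, rfl⟩ := H'.exists_tree hL'
  have fA := h.first_le
  have fB := h'.first_le
  obtain ⟨m, m1, m2, m3⟩ := findRight_spec (env := [.pair A.encode B.encode]) (e₁ := fst (var 0))
    hc H hN (Ev.pure rfl (t := 10) (by decide))
  obtain ⟨m', m1', m2', m3'⟩ := findRight_spec (env := [encodePt m, .pair A.encode B.encode])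
    (e₁ := snd (var 1)) hc' H' hN' (Ev.pure rfl (t := 10) (by decide))
  have pA : pev [encodePt m', encodePt m, .pair A.encode B.encode] (fst (var 2)) =
    some A.encode := rfl
  have pB : pev [encodePt m', encodePt m, .pair A.encode B.encode] (snd (var 2)) =
    some B.encode := rfl
  have pm : pev [encodePt m', encodePt m, .pair A.encode B.encode] (fst (var 1)) =
    some (.num m.1) := rfl
  have pm' : pev [encodePt m', encodePt m, .pair A.encode B.encode] (fst (var 0)) =
    some (.num m'.1) := rfl
  have pfA := fst_encodePt (pev_firstLeaf pA)
  have pfB := fst_encodePt (pev_firstLeaf pB)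
  have zm := Ev.pure (F := prog) pm (t := 10) (by decide)
  have zm' := Ev.pure (F := prog) pm' (t := 10) (by decide)
  have zfA := Ev.pure (F := prog) pfA (t := 50) (by decide)
  have zfB := Ev.pure (F := prog) pfB (t := 50) (by decide)
  suffices hs : ∃ u c, (∀ p ∈ P, dot u p < c) ∧ (∀ q ∈ Q, c < dot u q) ∧
      ∃ e, separateBody = .bind (mk2 9 (fst (var 0)) (.pair (.pair (.const (-1)) (.const 0))
        (.pair (.const 0) (.const 1)))) (.bind (mk2 9 (snd (var 1)) (.pair (.pair (.const (-1))
        (.const 0)) (.pair (.const 0) (.const 1)))) e) ∧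
      Ev prog [encodePt m', encodePt m, .pair A.encode B.encode] e (.pair (encodePt u) (.num c))
        (900000 * lam N) by
    obtain ⟨u, c, k1, k2, e, he, k3⟩ := hs
    refine ⟨u, c, k1, k2, (Ev.call (f := 20) (Ev.pair he₁ he₂)
      (show prog[20]? = some separateBody from rfl)
      (t := 26000 * lam N + 900000 * lam N + 100) ?_).mono (by omega)⟩
    rw [he]
    exact (Ev.bind m3 (Ev.bind m3' k3)).mono (by omega)
  by_cases i1 : m.1 < B.first.1
  · refine ⟨(1, 0), (m.1 + B.first.1) / 2, fun p hp => ?_, fun q hq => ?_, _, rfl,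
      (Ev.ifLt_pos zm zfB i1 (Ev.pure (pev_pair (x := encodePt (1, 0)) ?_ (pev_halfE pm pfB))
        (t := 100) (by decide))).mono (by omega)⟩
    · have := m2 p hp; simp only [dot]; linarith
    · have := fB q hq; simp only [dot]; linarith
    · simp [pev, encodePt]
  by_cases i2 : m'.1 < A.first.1
  · have q1 := pev_halfE pm' pfA
    refine ⟨(-1, 0), -((m'.1 + A.first.1) / 2), fun p hp => ?_, fun q hq => ?_, _, rfl,
      (Ev.ifLt_neg zm zfB i1 (Ev.ifLt_pos zm' zfA i2 (Ev.pure (pev_pair (x := encodePt (-1, 0)) ?_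
        (y := .num (-((m'.1 + A.first.1) / 2))) ?_) (t := 100) (by decide)))).mono (by omega)⟩
    · have := fA p hp; simp only [dot]; linarith
    · have := m2' q hq; simp only [dot]; linarith
    · simp [pev, encodePt]
    · exact pev_zero_sub q1
  have ov₁ : ∃ p ∈ P, ∃ q ∈ Q, p.1 ≤ q.1 :=
    ⟨A.first, (hc.isVertex A.first_mem).1, m', m1', not_lt.1 i2⟩
  have ov₂ : ∃ p ∈ P, ∃ q ∈ Q, q.1 ≤ p.1 :=
    ⟨m, m1, B.first, (hc'.isVertex B.first_mem).1, not_lt.1 i1⟩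
  obtain ⟨s, a, b, k1, k2⟩ := sepSearch_spec hc hc' H H' hN hN' ov₁ ov₂
    (Ev.pure (F := prog) pA (t := 10) (by decide)) (Ev.pure (F := prog) pB (t := 10) (by decide))
  set env₁ : List Val := [.pair (.num s) (.pair (encodePt a) (encodePt b)), encodePt m',
    encodePt m, .pair A.encode B.encode] with henv₁
  have g1 : pev env₁ (gapE (fst (var 0)) (snd (snd (var 0)))) = some (.num (gap s b)) := rfl
  have g2 : pev env₁ (gapE (fst (var 0)) (fst (snd (var 0)))) = some (.num (gap s a)) := rfl
  have z1 := Ev.pure (F := prog) g1 (t := 20) (by decide)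
  have z2 := Ev.pure (F := prog) g2 (t := 20) (by decide)
  by_cases i3 : gap s b < gap s a
  · have q1 := pev_halfE g2 g1
    refine ⟨(s, -1), -((gap s a + gap s b) / 2), fun p hp => ?_, fun q hq => ?_, _, rfl,
      (Ev.ifLt_neg zm zfB i1 (Ev.ifLt_neg zm' zfA i2 (Ev.bind k2 (Ev.ifLt_pos z1 z2 i3
      (Ev.pure (pev_pair (x := encodePt (s, -1)) ?_
        (y := .num (-((gap s a + gap s b) / 2))) ?_) (t := 100) (by decide)))))).mono (by omega)⟩
    · have := k1.left.2 p hp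
      simp only [dot, gap] at *; linarith
    · have := k1.right.2 q hq
      simp only [dot, gap] at *; linarith
    · simp [pev, encodePt]
    · exact pev_zero_sub q1
  · have hgap : ∃ s, ∀ q ∈ Q, ∀ p ∈ P, gap s p < gap s q :=
      (exists_gap hd ov₁ ov₂).resolve_left fun ⟨s', hs'⟩ => i3 (k1.pos hs')
    obtain ⟨p₁, hp₁, q₁, hq₁, hpq₁⟩ := ov₁
    obtain ⟨p₂, hp₂, q₂, hq₂, hpq₂⟩ := ov₂
    obtain ⟨s', b', a', k1', k2'⟩ := sepSearch_spec (env := env₁) (e₁ := snd (var 3))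
      (e₂ := fst (var 3)) hc' hc H' H hN' hN
      ⟨q₂, hq₂, p₂, hp₂, hpq₂⟩ ⟨q₁, hq₁, p₁, hp₁, hpq₁⟩
      (Ev.pure rfl (t := 10) (by decide)) (Ev.pure rfl (t := 10) (by decide))
    obtain ⟨s₀, hs₀⟩ := hgap
    have hpos := k1'.pos hs₀
    set env₂ : List Val := .pair (.num s') (.pair (encodePt b') (encodePt a')) :: env₁ with henv₂
    have g1' : pev env₂ (gapE (fst (var 0)) (snd (snd (var 0)))) = some (.num (gap s' a')) := rfl
    have g2' : pev env₂ (gapE (fst (var 0)) (fst (snd (var 0)))) = some (.num (gap s' b')) := rfl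
    refine ⟨(-s', 1), (gap s' b' + gap s' a') / 2, fun p hp => ?_, fun q hq => ?_, _, rfl,
      (Ev.ifLt_neg zm zfB i1 (Ev.ifLt_neg zm' zfA i2 (Ev.bind k2 (Ev.ifLt_neg z1 z2 i3
      (Ev.bind k2' (Ev.pure (pev_pair (x := encodePt (-s', 1)) ?_ (pev_halfE g2' g1'))
        (t := 100) (by decide))))))).mono (by omega)⟩
    · have := k1'.right.2 p hp
      simp only [dot, gap] at *; linarith
    · have := k1'.left.2 q hq
      simp only [dot, gap] at *; linarith
    · simp [pev, encodePt]

end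

/-! ### Onions and their representations -/

theorem onion_empty : onion ∅ = [] := by rw [onion]; simp

theorem onion_cons {P : Finset Pt} (h : P.Nonempty) :
    onion P = hullVertices P :: onion (P \ hullVertices P) := by
  rw [onion, dif_neg h.ne_empty]

/-- A vertex of `R` that belongs to `P` is a vertex of `P`, so the inclusion persists when the
outermost layers are removed from both sets. -/
theorem onion_length_mono {P R : Finset Pt} (h : P ⊆ R) :
    (onion P).length ≤ (onion R).length := by
  induction hn : R.card using Nat.strong_induction_on generalizing P R with
  | _ n ih =>
  subst hn
  rcases P.eq_empty_or_nonempty with rfl | hP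
  · simp [onion_empty]
  have hR := hP.mono h
  rw [onion_cons hP, onion_cons hR, List.length_cons, List.length_cons]
  refine Nat.succ_le_succ (ih _ (card_sdiff_hullVertices_lt hR.ne_empty) (fun x hx => ?_) rfl)
  rw [Finset.mem_sdiff] at hx ⊢
  exact ⟨h hx.1, fun hv => hx.2 (mem_hullVertices.2 ((mem_hullVertices.1 hv).mono h hx.1))⟩

theorem RepresentsOnion.cons {P : Finset Pt} {t : PTree} {v : Val} (hb : t.Balanced)
    (h : IsBoundaryList (hullVertices P) t.toList) (hv : RepresentsOnion (P \ hullVertices P) v) :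
    RepresentsOnion P (.pair t.encode v) := by
  obtain ⟨Ts, h1, rfl⟩ := hv
  have hP : P.Nonempty :=
    ⟨t.first, hullVertices_subset P ((h.mem_iff _).1 t.first_mem)⟩
  exact ⟨t :: Ts, by rw [onion_cons hP]; exact List.Forall₂.cons ⟨hb, h⟩ h1, rfl⟩

theorem RepresentsOnion.cases {P : Finset Pt} {v : Val} (h : RepresentsOnion P v) :
    (P = ∅ ∧ v = .nil) ∨ ∃ (t : PTree) (w : Val), v = .pair t.encode w ∧ t.Balanced ∧
      IsBoundaryList (hullVertices P) t.toList ∧ Cyc P t.toList ∧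
      RepresentsOnion (P \ hullVertices P) w := by
  obtain ⟨Ts, h1, rfl⟩ := h
  rcases P.eq_empty_or_nonempty with rfl | hP
  · rw [onion_empty] at h1
    cases h1
    exact Or.inl ⟨rfl, rfl⟩
  · rw [onion_cons hP] at h1
    cases h1 with
    | cons h2 h3 =>
      exact Or.inr ⟨_, _, rfl, h2.1, h2.2, h2.2.cyc (PTree.toList_ne_nil _), _, h3, rfl⟩

theorem RepresentsOnion.of_rep {P : Finset Pt} {L : List Pt} {v w : Val}
    (h : IsBoundaryList (hullVertices P) L) (hL : L ≠ []) (H : Rep L w)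
    (hv : RepresentsOnion (P \ hullVertices P) v) : RepresentsOnion P (.pair w v) := by
  obtain ⟨t, h1, rfl, rfl⟩ := H.exists_tree hL
  exact .cons h1 h hv

/-! ### Paths -/

theorem exists_next_of_isChain {R : Pt → Pt → Prop} {l : List Pt} (h : l.IsChain R)
    (hnd : l.Nodup) (hl : l ≠ []) {p : Pt} (hp : p ∈ l) (hpl : p ≠ l.getLast hl) :
    ∃ q ∈ l, q ≠ l.head hl ∧ R p q := by
  obtain ⟨l₁, l₂, rfl⟩ := List.append_of_mem hp
  cases l₂ with
  | nil => simp at hpl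
  | cons q l₂ =>
    refine ⟨q, by simp, ?_, (List.isChain_append.1 h).2.1.rel⟩
    rintro e
    cases l₁ with
    | nil => simp at e; simp [e] at hnd
    | cons x l₁ => simp at e; simp [e] at hnd

theorem exists_prev_of_isChain {R : Pt → Pt → Prop} {l : List Pt} (h : l.IsChain R)
    (hnd : l.Nodup) (hl : l ≠ []) {p : Pt} (hp : p ∈ l) (hpl : p ≠ l.head hl) :
    ∃ q ∈ l, q ≠ l.getLast hl ∧ R q p := by
  obtain ⟨l₁, l₂, rfl⟩ := List.append_of_mem hp
  rcases List.eq_nil_or_concat l₁ with rfl | ⟨l₁, q, rfl⟩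
  · simp at hpl
  · rw [List.concat_eq_append, List.append_assoc] at h
    refine ⟨q, by simp, ?_, (List.isChain_append.1 h).2.1.rel⟩
    rintro e
    have hm : q ∈ p :: l₂ := by
      rw [e]
      simp only [List.concat_eq_append]
      rw [List.getLast_append_of_ne_nil _ (by simp)]
      exact List.getLast_mem _
    rw [List.concat_eq_append] at hnd
    exact List.disjoint_of_nodup_append hnd (by simp) hm

open Classical in
/-- A cycle is composed from a path `C` of edges of `T` and a path of edges of the polygon of
`S`. -/
theorem cyc_append {S T : Finset Pt} {C R : List Pt} {a b r₁ r₂ : Pt} {M K : List Pt}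
    (hT : ∀ x ∈ T, x ∈ C ∨ x ∈ S) (hST : S ⊆ T) (hCS : ∀ x ∈ C, x ∉ S) (hC : C ≠ [])
    (hnd : C.Nodup) (hch : C.IsChain (HullEdge T)) (ha : C.head hC = a) (hb : C.getLast hC = b)
    (hR : Cyc S R) (hrot : (r₁ :: M ++ K) ~r R) (hlast : (r₁ :: M).getLast (by simp) = r₂)
    (h₁ : HullEdge T b r₁) (h₂ : HullEdge T r₂ a) : Cyc T (C ++ (r₁ :: M)) := by
  have hR' := hR.isRotated hrot.symm
  have hMS : ∀ x ∈ r₁ :: M, x ∈ S := fun x hx => (hR'.isVertex (List.mem_append_left _ hx)).1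
  have hndM : (r₁ :: M).Nodup := hR'.2.1.sublist (List.sublist_append_left _ _)
  have hM : (r₁ :: M).IsChain (HullEdge T) := by
    have hc : (r₁ :: M).IsChain (HullEdge S) := (List.isChain_append.1 hR'.isChain).1
    have e : (r₁ :: M).dropLast ++ [r₂] = r₁ :: M := by
      rw [← hlast]; exact List.dropLast_append_getLast (by simp)
    rw [← e] at hc ⊢
    refine isChain_of_next_mem hST hc (fun p hp => ?_) (fun p hp hv => ?_)
    · rw [e] at hp
      simp only [List.head?_cons, Option.mem_def, Option.some.injEq] at hp
      subst hp
      exact h₁.isVertex_right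
    · obtain ⟨q, hq⟩ := hv.exists_next
      refine ⟨q, (hT q hq.2.1).resolve_left fun hqC => ?_, hq⟩
      have hpS := hMS p (List.mem_of_mem_dropLast hp)
      -- Each point of `C` other than `a` has its predecessor in `C`, and the predecessor of `a` is
      -- `r₂`. So before `r₂` is reached no edge leads from the path into `C`.
      by_cases hqa : q = a
      · subst hqa
        have hpr := hq.left_unique h₂
        subst hpr
        rw [← e] at hndM
        exact List.disjoint_of_nodup_append hndM hp (by simp)
      · obtain ⟨c, hc1, _, hc2⟩ := exists_prev_of_isChain hch hnd hC hqC (by rwa [ha])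
        have := hq.left_unique hc2
        subst this
        exact hCS _ hc1 hpS
  refine ⟨by simp [hC], hnd.append hndM fun x hx hx' => hCS x hx (hMS x hx'), ?_⟩
  obtain ⟨C', rfl⟩ : ∃ C', C = a :: C' := ⟨C.tail, by rw [← ha, List.cons_head_tail]⟩
  rw [List.cons_append, Cycle.chain_coe_cons, ← List.cons_append, ← List.cons_append,
    List.append_assoc]
  refine List.isChain_append.2 ⟨hch, List.isChain_append.2 ⟨hM, by simp, fun x hx y hy => ?_⟩,
    fun x hx y hy => ?_⟩
  · rw [List.getLast?_eq_some_getLast (by simp), hlast] at hx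
    simp only [Option.mem_def, Option.some.injEq, List.head?_cons] at hx hy
    subst hx; subst hy
    exact h₂
  · rw [List.getLast?_eq_some_getLast (by simp), hb] at hx
    simp only [Option.mem_def, Option.some.injEq, List.head?_cons, List.cons_append] at hx hy
    subst hx; subst hy
    exact h₁

section

variable {P S T : Finset Pt} {C X R : List Pt} {N : ℕ}

/-- A chain that spans all vertices is closed by an edge. -/
theorem cyc_of_isChain {a b : Pt} (hC : C ≠ []) (hnd : C.Nodup) (hch : C.IsChain (HullEdge T))
    (ha : C.head hC = a) (hb : C.getLast hC = b) (h : HullEdge T b a) : Cyc T C := by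
  refine ⟨hC, hnd, ?_⟩
  obtain ⟨C', rfl⟩ : ∃ C', C = a :: C' := ⟨C.tail, by rw [← ha, List.cons_head_tail]⟩
  rw [Cycle.chain_coe_cons, ← List.cons_append]
  refine List.isChain_append.2 ⟨hch, by simp, fun x hx y hy => ?_⟩
  rw [List.getLast?_eq_some_getLast (by simp), hb] at hx
  simp only [Option.mem_def, Option.some.injEq, List.head?_cons] at hx hy
  subst hx; subst hy
  exact h

/-- An edge to a chain of edges ends at its head or starts inside. -/
theorem eq_head_of_edge {p q : Pt} (hC : C ≠ []) (hnd : C.Nodup)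
    (hch : C.IsChain (HullEdge T)) (hp : HullEdge T p q) (hq : q ∈ C)
    (hp' : p ∈ C → p = C.getLast hC) : q = C.head hC := by
  by_contra hne
  obtain ⟨c, h1, h2, h3⟩ := exists_prev_of_isChain hch hnd hC hq hne
  have := hp.left_unique h3
  subst this
  exact h2 (hp' h1)

theorem eq_last_of_edge {p q : Pt} (hC : C ≠ []) (hnd : C.Nodup)
    (hch : C.IsChain (HullEdge T)) (hp : HullEdge T p q) (hq : p ∈ C)
    (hp' : q ∈ C → q = C.head hC) : p = C.getLast hC := by
  by_contra hne
  obtain ⟨c, h1, h2, h3⟩ := exists_next_of_isChain hch hnd hC hq hne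
  have := hp.right_unique h3
  subst this
  exact h2 (hp' h1)

theorem union_sdiff_union [DecidableEq Pt] {A B D : Finset Pt} (h : Disjoint A B) :
    (A ∪ B) \ (A ∪ D) = B \ D := by
  ext x
  simp only [Finset.mem_sdiff, Finset.mem_union, not_or]
  constructor
  · rintro ⟨h1, h2, h3⟩
    exact ⟨h1.resolve_left h2, h3⟩
  · rintro ⟨h1, h2⟩
    exact ⟨Or.inr h1, fun hA => Finset.disjoint_left.1 h hA h1, h2⟩

theorem Cyc.hullVertices_eq [DecidableEq Pt] {L : List Pt} (h : Cyc P L) :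
    hullVertices P = L.toFinset := by
  ext x
  rw [List.mem_toFinset, h.mem_iff]

-- Here `X` is the removed part of the outermost layer, `C` the remaining path and `S` the set of
-- points inside. The edges along `C` stay edges of the hull of the rest `T`, so only the
-- continuation from its last point `b` to its first point `a` is unknown. It is the edge `b a`, or
-- it goes through a path of the next layer; then the remainder of that layer takes the place of `C`
-- one layer deeper.
open Classical in
theorem repair_spec {vC vR : Val} (h : Cyc P (C ++ X)) (hX : X ≠ [])
    (H : Rep C vC) (hR : RepresentsOnion (P \ hullVertices P) vR) (hN : P.card ≤ N) :
    ∃ w, RepresentsOnion (P \ X.toFinset) w ∧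
      Ev prog [.pair vC vR] repairBody w (600000 * lam N * (onion P).length) := by
  induction hn : P.card using Nat.strong_induction_on generalizing P C X vC vR with
  | _ n ih =>
  subst hn
  have hlam := one_le_lam N
  obtain ⟨x₀, X', hx₀⟩ := List.exists_cons_of_ne_nil hX
  have hPne : P.Nonempty := ⟨x₀, (h.isVertex (p := x₀) (by simp [hx₀])).1⟩
  set S := P \ hullVertices P with hS
  have hlen : (onion P).length = (onion S).length + 1 := by rw [onion_cons hPne]; rfl
  rw [hlen]
  by_cases hC : C = []
  · subst hC
    have hv : vC = .nil := by
      obtain ⟨_, ⟨_, rfl, _⟩ | ⟨t, _, h2, _⟩⟩ := H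
      · rfl
      · exact absurd h2 t.toList_ne_nil
    subst hv
    refine ⟨vR, ?_, (Ev.ifPair_nil (Ev.pure rfl (t := 10) (by decide))
      (Ev.pure rfl (t := 10) (by decide))).mono (by nlinarith)⟩
    rw [List.nil_append] at h
    rw [← h.hullVertices_eq]
    exact hR
  obtain ⟨tC, hbC, rfl, rfl⟩ := H.exists_tree hC
  set a := tC.first with ha'
  set b := tC.last with hb'
  have ha : tC.toList.head hC = a := tC.head_toList
  have hb : tC.toList.getLast hC = b := tC.getLast_toList
  have haC : a ∈ tC.toList := tC.first_mem
  have hbC' : b ∈ tC.toList := tC.last_mem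
  have hndC : tC.toList.Nodup := h.2.1.sublist (List.sublist_append_left _ _)
  set T := P \ X.toFinset with hTdef
  have hTP : T ⊆ P := Finset.sdiff_subset
  have hCT : ∀ x ∈ tC.toList, x ∈ T := fun x hx => by
    rw [hTdef, Finset.mem_sdiff, List.mem_toFinset]
    exact ⟨(h.isVertex (List.mem_append_left _ hx)).1,
      fun hxX => List.disjoint_of_nodup_append h.2.1 hx hxX⟩
  have hST : S ⊆ T := fun x hx => by
    rw [hS, Finset.mem_sdiff, h.hullVertices_eq, List.mem_toFinset, List.mem_append, not_or] at hx
    rw [hTdef, Finset.mem_sdiff, List.mem_toFinset]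
    exact ⟨hx.1, hx.2.2⟩
  have hCS : ∀ x ∈ tC.toList, x ∉ S := fun x hx hxS => by
    rw [hS, Finset.mem_sdiff, h.hullVertices_eq, List.mem_toFinset] at hxS
    exact hxS.2 (List.mem_append_left _ hx)
  have hT : ∀ x ∈ T, x ∈ tC.toList ∨ x ∈ S := fun x hx => by
    rw [hTdef, Finset.mem_sdiff, List.mem_toFinset] at hx
    by_cases hxC : x ∈ tC.toList
    · exact Or.inl hxC
    · right
      rw [hS, Finset.mem_sdiff, h.hullVertices_eq, List.mem_toFinset, List.mem_append, not_or]
      exact ⟨hx.1, hxC, hx.2⟩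
  have hTeq : T = tC.toList.toFinset ∪ S := by
    ext x
    rw [Finset.mem_union, List.mem_toFinset]
    exact ⟨hT x, fun hx => hx.elim (hCT x) (fun hx => hST hx)⟩
  have hdisj : Disjoint tC.toList.toFinset S :=
    Finset.disjoint_left.2 fun x hx => hCS x (List.mem_toFinset.1 hx)
  have hvC : ∀ x ∈ tC.toList, IsVertex T x := fun x hx =>
    (h.isVertex (List.mem_append_left _ hx)).mono hTP (hCT x hx)
  have hch : tC.toList.IsChain (HullEdge T) :=
    ((List.isChain_append.1 h.isChain).1).imp_of_mem_imp
      fun x y hx hy hxy => hxy.mono hTP (hCT x hx) (hCT y hy)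
  have hlenC : tC.toList.length ≤ N := by
    have := h.length_le
    rw [List.length_append] at this
    omega
  have hSN : S.card ≤ N := (Finset.card_le_card Finset.sdiff_subset).trans hN
  have direct : ∀ {env : List Val} {e : Expr} {t : ℕ} {v : Val}, HullEdge T b a →
      Ev prog env e tC.encode t → RepresentsOnion S v → ∃ w, RepresentsOnion T (.pair w v) ∧
      Ev prog env (.call 14 e) w (t + 100000 * lam N) := by
    intro env e t v hba he hv
    have hcyc := cyc_of_isChain hC hndC hch ha hb hba
    obtain ⟨L', w, n1, n2, n3, n4⟩ := normalize_spec hcyc H hlenC he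
    refine ⟨w, .of_rep n1 n2 n3 ?_, n4⟩
    rw [hcyc.hullVertices_eq, hTeq]
    have := union_sdiff_union (D := ∅) hdisj
    rw [Finset.union_empty, Finset.sdiff_empty] at this
    rwa [this]
  obtain ⟨q, hq⟩ := (hvC b hbC').exists_next
  have hqa : q ∈ tC.toList → q = a := fun hqC => by
    rw [← ha]; exact eq_head_of_edge hC hndC hch hq hqC fun _ => hb.symm
  rw [mul_add, mul_one]
  generalize hk : 600000 * lam N * (onion S).length = k at *
  set inp : Val := .pair tC.encode vR with hinp
  have pC : pev [inp] (fst (var 0)) = some tC.encode := rfl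
  obtain ⟨c₁, c₂, hc⟩ := tC.encode_eq_pair
  have zC : Ev prog [inp] (fst (var 0)) (.pair c₁ c₂) 10 := by
    rw [← hc]; exact Ev.pure pC (by decide)
  rcases hR.cases with ⟨hSe, rfl⟩ | ⟨tR, vR', rfl, hbR, hbd, hcR, hR'⟩
  · have hba : HullEdge T b a := by
      rw [← hqa ((hT q hq.2.1).resolve_right fun h => by simp [hSe] at h)]; exact hq
    obtain ⟨w, k1, k2⟩ := direct hba (Ev.pure (F := prog) pC (t := 10) (by decide)) hR
    exact ⟨_, k1, (Ev.ifPair_pos zC (Ev.ifPair_nil (Ev.pure rfl (t := 10) (by decide))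
      (Ev.pair k2 (Ev.pure rfl (t := 10) (by decide))))).mono (by omega)⟩
  have hRN : tR.toList.length ≤ N := hcR.length_le.trans hSN
  have hRS : ∀ x ∈ tR.toList, x ∈ S := fun x hx => (hcR.isVertex hx).1
  have hHR : Rep tR.toList tR.encode := PTree.rep hbR
  have hSP : ∀ x ∈ S, x ∈ P := fun x hx => hTP (hST hx)
  have zR : Ev prog [inp] (snd (var 0)) (.pair tR.encode vR') 10 := Ev.pure rfl (by decide)
  -- The direction is taken from the full set `P`, so that it serves for the angular order on the
  -- next layer and on all of `T`.
  obtain ⟨-, u, hu⟩ := h.isVertex (List.mem_append_left X hbC')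
  obtain ⟨r₁, m1, m2, m3⟩ := findAngR_spec (env := [inp]) (e₁ := fst (snd (var 0)))
    (e₂ := lastLeaf (fst (var 0))) hHR hcR.1 hcR.2.1 hcR.ccw hRN (u := u) (x := b)
    (fun p hp => hu p (hSP p (hRS p hp)) (by rintro rfl; exact hCS _ hbC' (hRS _ hp)))
    (Ev.pure rfl (t := 10) (by decide)) (Ev.pure (pev_lastLeaf pC) (t := 30) (by decide))
  have pC2 : pev [encodePt r₁, inp] (fst (var 1)) = some tC.encode := rfl
  have hr₁S := hRS r₁ m1
  by_cases hqC : q ∈ tC.toList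
  · have hba : HullEdge T b a := by rw [← hqa hqC]; exact hq
    obtain ⟨w, k1, k2⟩ := direct hba (Ev.pure (F := prog) pC2 (t := 10) (by decide)) hR
    refine ⟨_, k1, ?_⟩
    -- The program closes the path only if it has at least two points. A single point cannot be the
    -- whole hull of `T` here, because `S` is nonempty.
    cases htC : tC with
    | leaf p =>
      exfalso
      rw [htC] at ha' hb'
      simp only [PTree.first, PTree.last] at ha' hb'
      rw [hb', ← ha'] at hba
      have := hba.eq_of_self (hST hr₁S)
      rw [this] at hr₁S
      exact hCS a haC hr₁S
    | node l r =>
      rw [htC] at hinp pC2 ha' hb'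
      have o := hba.orient_nonneg (hST hr₁S)
      rw [orient_swap] at o
      have po := pev_orientE (pev_lastLeaf pC2) (b := var 0) (q := r₁) rfl (pev_firstLeaf pC2)
      rw [← ha', ← hb'] at po
      exact (Ev.ifPair_pos zC (Ev.ifPair_pos zR (Ev.bind m3 (Ev.ifPair_pos
        (Ev.pure (by rw [hinp]; rfl) (t := 10) (by decide)) (Ev.ifLt_neg
        (Ev.pure (v := .num ((0 : ℤ) : ℝ)) rfl (t := 1) (by decide))
        (Ev.pure po (t := 200) (by decide)) (by simpa using o)
        (Ev.pair k2 (Ev.pure rfl (t := 10) (by decide)))))))).mono (by omega)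
  have hqS : q ∈ S := (hT q hq.2.1).resolve_left hqC
  have hqR : q ∈ tR.toList := hcR.mem_of_isVertex (hq.isVertex_right.mono hST hqS)
  obtain rfl : r₁ = q := by
    by_contra hne
    have := hq.angKey_lt (u := u) (p := r₁) (fun p hp => hu p (hTP hp)) (hST hr₁S)
      (by rintro rfl; exact hCS _ hbC' hr₁S) hne
    exact absurd (m2 q hqR) (not_le.2 this)
  obtain ⟨q', hq'⟩ := (hvC a haC).exists_prev
  have hq'S : q' ∈ S := (hT q' hq'.1).resolve_left fun hq'C => by
    have e := eq_last_of_edge hC hndC hch hq' hq'C fun _ => ha.symm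
    rw [hb] at e
    rw [e] at hq'
    exact hqC (hq'.right_unique hq ▸ haC)
  obtain ⟨-, u', hu'⟩ := h.isVertex (List.mem_append_left X haC)
  obtain ⟨r₂, n1, n2, n3⟩ := findAngL_spec (env := [encodePt r₁, inp])
    (e₁ := fst (snd (var 1))) (e₂ := firstLeaf (fst (var 1))) hHR hcR.1 hcR.2.1 hcR.ccw hRN
    (u := u') (x := a)
    (fun p hp => hu' p (hSP p (hRS p hp)) (by rintro rfl; exact hCS _ haC (hRS _ hp)))
    (Ev.pure rfl (t := 10) (by decide)) (Ev.pure (pev_firstLeaf pC2) (t := 30) (by decide))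
  have hr₂S := hRS r₂ n1
  obtain rfl : r₂ = q' := by
    by_contra hne
    have := hq'.angKey_lt' (u := u') (p := r₂) (fun p hp => hu' p (hTP hp)) (hST hr₂S)
      (by rintro rfl; exact hCS _ haC hr₂S) hne
    exact absurd (n2 q' (hcR.mem_of_isVertex (hq'.isVertex_left.mono hST hq'S))) (not_le.2 this)
  obtain ⟨M, K, w₁, w₂, l1, l2, l3, l4, l5⟩ := cut_spec (env := [encodePt r₂, encodePt r₁, inp])
    (e₁ := fst (snd (var 2))) (e₂ := .pair (var 1) (var 0)) hHR m1 n1 hcR.2.1 hcR.ccw hRN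
    (Ev.pure rfl (t := 10) (by decide)) (Ev.pure rfl (t := 10) (by decide))
  have hcyc := cyc_append hT hST hCS hC hndC hch ha hb hcR l1 l2 hq hq'
  have hcN : (tC.toList ++ (r₁ :: M)).length ≤ N :=
    hcyc.length_le.trans ((Finset.card_le_card hTP).trans hN)
  obtain ⟨w₃, i1, i2⟩ := cat_spec
    (env := [.pair w₁ w₂, encodePt r₂, encodePt r₁, inp]) (e₁ := fst (var 3)) (e₂ := fst (var 0))
    H l3 hcN (Ev.pure rfl (t := 10) (by decide)) (Ev.pure rfl (t := 10) (by decide))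
  obtain ⟨L', w₄, j1, j2, j3, j4⟩ := normalize_spec hcyc i1 hcN i2
  have hcR' : Cyc S (K ++ (r₁ :: M)) :=
    hcR.isRotated (l1.symm.trans (isRotated_append_comm (r₁ :: M) K))
  obtain ⟨w₅, t1, t2⟩ := ih S.card (card_sdiff_hullVertices_lt hPne.ne_empty) hcR' (by simp) l4
    hR' hSN rfl
  rw [hk] at t2
  have hfin : RepresentsOnion T (.pair w₄ w₅) := by
    refine .of_rep j1 j2 j3 ?_
    rw [hcyc.hullVertices_eq, hTeq, List.toFinset_append, union_sdiff_union hdisj]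
    exact t1
  have next := Ev.bind n3 (Ev.bind l5 (Ev.pair j4 (Ev.call (f := 21)
    (e := .pair (snd (var 0)) (snd (snd (var 3)))) (Ev.pure rfl (t := 20) (by decide)) rfl t2)))
  refine ⟨_, hfin, ?_⟩
  cases htC : tC with
  | leaf p =>
    rw [htC] at hinp
    exact (Ev.ifPair_pos zC (Ev.ifPair_pos zR (Ev.bind m3 (Ev.ifPair_nil
      (Ev.pure (by rw [hinp]; rfl) (t := 10) (by decide)) next)))).mono (by omega)
  | node l r =>
    have hab : a ≠ b := by
      intro e
      have hx : r.last ∈ r.toList := r.last_mem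
      rw [htC] at ha' hb' hndC
      have := List.disjoint_of_nodup_append hndC l.first_mem
      simp only [PTree.first, PTree.last] at ha' hb'
      rw [← ha', e, hb'] at this
      exact this hx
    -- The orientation test is conclusive: if `b r₁` is the edge that leaves `b`, then `a` is
    -- strictly to its left; if the edge is `b a`, the sign is not positive.
    have o := hq.orient_pos (hvC a haC) hab (by rintro rfl; exact hCS _ haC hr₁S)
    rw [htC] at hinp pC2 ha' hb'
    have po := pev_orientE (pev_lastLeaf pC2) (b := var 0) (q := r₁) rfl (pev_firstLeaf pC2)
    rw [← ha', ← hb'] at po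
    exact (Ev.ifPair_pos zC (Ev.ifPair_pos zR (Ev.bind m3 (Ev.ifPair_pos
      (Ev.pure (by rw [hinp]; rfl) (t := 10) (by decide)) (Ev.ifLt_pos
      (Ev.pure (v := .num ((0 : ℤ) : ℝ)) rfl (t := 1) (by decide))
      (Ev.pure po (t := 200) (by decide)) (by simpa using o) next))))).mono (by omega)

end

/-! ### The union of two separated onions -/

section

variable {P Q S T : Finset Pt} {N : ℕ}

/-- At most one edge crosses a line from left to right. -/
theorem HullEdge.crossing_unique {u a b a' b' : Pt} {c : ℝ} (h : HullEdge T a b)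
    (h' : HullEdge T a' b') (ha : dot u a < c) (hb : c < dot u b) (ha' : dot u a' < c)
    (hb' : c < dot u b') : a = a' := by
  by_contra hne
  have h1 := h.orient_pos h'.isVertex_left (Ne.symm hne) (by rintro rfl; linarith)
  have h2 := h'.orient_pos h.isVertex_left hne (by rintro rfl; linarith)
  have h3 := h.orient_nonneg h'.2.1
  have h4 := h'.orient_nonneg h.2.1
  -- The first two terms measure, up to a positive factor, how far the crossing point of `a' b'` is
  -- above that of `a b` on the line `dot u p = c`; the last two measure the reverse and cancel
  -- them. But all four terms are nonnegative and two are positive.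
  have e : (dot u b' - c) * orient a b a' + (c - dot u a') * orient a b b' +
      ((dot u b - c) * orient a' b' a + (c - dot u a) * orient a' b' b) = 0 := by
    simp only [dot, orient]; ring
  have := mul_pos (sub_pos.2 hb') h1
  have := mul_pos (sub_pos.2 hb) h2
  have := mul_nonneg (sub_pos.2 ha').le h3
  have := mul_nonneg (sub_pos.2 ha).le h4
  linarith

/-- A path of edges of the polygon of `S` consists of edges of `T` if its first point is a vertex
of `T` and edges leave `S` only from its last point. -/
theorem isChain_path {R M K : List Pt} {x y : Pt} (hST : S ⊆ T) (hR : Cyc S R)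
    (hrot : (x :: M ++ K) ~r R) (hlast : (x :: M).getLast (by simp) = y) (hx : IsVertex T x)
    (hy : ∀ p ∈ S, ∀ q ∈ T, q ∉ S → HullEdge T p q → p = y) :
    (x :: M).IsChain (HullEdge T) := by
  have hR' := hR.isRotated hrot.symm
  have hndM : (x :: M).Nodup := hR'.2.1.sublist (List.sublist_append_left _ _)
  have hc : (x :: M).IsChain (HullEdge S) := (List.isChain_append.1 hR'.isChain).1
  have e : (x :: M).dropLast ++ [y] = x :: M := by
    rw [← hlast]; exact List.dropLast_append_getLast (by simp)
  rw [← e] at hc ⊢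
  refine isChain_of_next_mem hST hc (fun p hp => ?_) (fun p hp hv => ?_)
  · rw [e] at hp
    simp only [List.head?_cons, Option.mem_def, Option.some.injEq] at hp
    exact hp ▸ hx
  · obtain ⟨q, hq⟩ := hv.exists_next
    refine ⟨q, ?_, hq⟩
    by_contra hqS
    have hpS := (hR'.isVertex (List.mem_append_left K (List.mem_of_mem_dropLast hp))).1
    obtain rfl := hy p hpS q hq.2.1 hqS hq
    rw [← e] at hndM
    exact List.disjoint_of_nodup_append hndM hp (by simp)

/-- The polygon of a separated union consists of two paths and two bridges. -/
theorem cyc_union [DecidableEq Pt] {L L' M K M' K' : List Pt} {a₁ a₂ b₁ b₂ u : Pt} {c : ℝ}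
    (hP : ∀ p ∈ P, dot u p < c) (hQ : ∀ q ∈ Q, c < dot u q) (h : Cyc P L) (h' : Cyc Q L')
    (ha₁ : a₁ ∈ P) (ha₂ : a₂ ∈ P) (hb₁ : b₁ ∈ Q) (hb₂ : b₂ ∈ Q)
    (hab : HullEdge (P ∪ Q) a₁ b₁) (hba : HullEdge (P ∪ Q) b₂ a₂)
    (hL : (a₂ :: M ++ K) ~r L) (hM : (a₂ :: M).getLast (by simp) = a₁)
    (hL' : (b₁ :: M' ++ K') ~r L') (hM' : (b₁ :: M').getLast (by simp) = b₂) :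
    Cyc (P ∪ Q) ((a₂ :: M) ++ (b₁ :: M')) := by
  have hneg : ∀ x, dot (-u) x = -dot u x := fun x => by rw [dot_neg_left]
  -- An edge from `P` to `Q` crosses the separating line from left to right, so it starts at the
  -- same point as the bridge, namely `a₁`.
  have c1 := isChain_path (Finset.subset_union_left (s₂ := Q)) h hL hM hba.isVertex_right
    (fun p hp q hq hqP hpq => by
      have hqQ := (Finset.mem_union.1 hq).resolve_left hqP
      exact hpq.crossing_unique hab (hP p hp) (hQ q hqQ) (hP _ ha₁) (hQ _ hb₁))
  have c2 := isChain_path (Finset.subset_union_right (s₁ := P)) h' hL' hM' hab.isVertex_right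
    (fun p hp q hq hqQ hpq => by
      have hqP := (Finset.mem_union.1 hq).resolve_right hqQ
      refine hpq.crossing_unique (u := -u) (c := -c) hba ?_ ?_ ?_ ?_ <;> rw [hneg, neg_lt_neg_iff]
      exacts [hQ p hp, hP q hqP, hQ _ hb₂, hP _ ha₂])
  have n1 := (h.isRotated hL.symm).2.1.sublist (List.sublist_append_left _ _)
  have n2 := (h'.isRotated hL'.symm).2.1.sublist (List.sublist_append_left _ _)
  refine cyc_of_isChain (by simp) (n1.append n2 fun x hx hx' => ?_)
    (List.isChain_append.2 ⟨c1, c2, fun x hx y hy => ?_⟩) (a := a₂) (b := b₂) (by simp) ?_ hba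
  · have h1 := hP x ((h.isRotated hL.symm).isVertex (List.mem_append_left _ hx)).1
    have h2 := hQ x ((h'.isRotated hL'.symm).isVertex (List.mem_append_left _ hx')).1
    linarith
  · rw [List.getLast?_eq_some_getLast (by simp), hM] at hx
    simp only [Option.mem_def, Option.some.injEq, List.head?_cons] at hx hy
    subst hx; subst hy
    exact hab
  · rw [List.getLast_append_of_ne_nil _ (by simp), hM']

theorem union_sdiff_union_comm [DecidableEq Pt] {A B : Finset Pt} (h : Disjoint P Q)
    (hA : A ⊆ P) (hB : B ⊆ Q) : (P ∪ Q) \ (A ∪ B) = (P \ A) ∪ (Q \ B) := by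
  ext x
  have h1 : x ∈ A → x ∈ P := fun hx => hA hx
  have h2 : x ∈ B → x ∈ Q := fun hx => hB hx
  have h3 : x ∈ P → x ∉ Q := fun hx => Finset.disjoint_left.1 h hx
  simp only [Finset.mem_sdiff, Finset.mem_union]
  tauto

theorem pev_negE {env : List Val} {e : Expr} {p : Pt} (h : pev env e = some (encodePt p)) :
    pev env (negE e) = some (encodePt (-p)) := by
  simp [negE, pev, h, encodePt]

-- The second bridge is obtained in the frame `-u` with exchanged roles, where the upper tangent
-- becomes a lower one. The same separating line remains valid in the recursion, as both sets only
-- shrink. Each repair costs at most a logarithmic amount for every layer of the current union, and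
-- the recursion loses one layer.
open Classical in
theorem union_spec {us vs : Val} {u : Pt} {c : ℝ} (h : RepresentsOnion P us)
    (h' : RepresentsOnion Q vs) (hP : ∀ p ∈ P, dot u p < c) (hQ : ∀ q ∈ Q, c < dot u q)
    (hN : (P ∪ Q).card ≤ N) : ∃ w, RepresentsOnion (P ∪ Q) w ∧
      Ev prog [.pair us (.pair vs (.pair (encodePt u) (.num c)))] unionBody w
        (3000000 * lam N * (onion (P ∪ Q)).length ^ 2 + 100) := by
  induction hn : (P ∪ Q).card using Nat.strong_induction_on generalizing P Q us vs with
  | _ n ih =>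
  subst hn
  have hlam := one_le_lam N
  set inp : Val := .pair us (.pair vs (.pair (encodePt u) (.num c))) with hinp
  rcases h.cases with ⟨rfl, rfl⟩ | ⟨A, us', rfl, hbA, -, hcA, hA'⟩
  · rw [Finset.empty_union]
    exact ⟨vs, h', (Ev.ifPair_nil (Ev.pure rfl (t := 10) (by decide))
      (Ev.pure rfl (t := 10) (by decide))).mono (by omega)⟩
  have z1 : Ev prog [inp] (fst (var 0)) (.pair A.encode us') 10 := Ev.pure rfl (by decide)
  rcases h'.cases with ⟨rfl, rfl⟩ | ⟨B, vs', rfl, hbB, -, hcB, hB'⟩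
  · rw [Finset.union_empty]
    exact ⟨_, h, (Ev.ifPair_pos z1 (Ev.ifPair_nil (Ev.pure rfl (t := 10) (by decide))
      (Ev.pure rfl (t := 10) (by decide)))).mono (by omega)⟩
  have z2 : Ev prog [inp] (fst (snd (var 0))) (.pair B.encode vs') 10 := Ev.pure rfl (by decide)
  have hPN : P.card ≤ N := (Finset.card_le_card Finset.subset_union_left).trans hN
  have hQN : Q.card ≤ N := (Finset.card_le_card Finset.subset_union_right).trans hN
  have hAN := hcA.length_le.trans hPN
  have hBN := hcB.length_le.trans hQN
  have HA := PTree.rep hbA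
  have HB := PTree.rep hbB
  have hneg : ∀ x, dot (-u) x = -dot u x := fun x => by rw [dot_neg_left]
  obtain ⟨a₁, ha₁, b₁, hb₁, hab, t1⟩ := bridge_spec (env := [inp]) (e₁ := fst (fst (var 0)))
    (e₂ := fst (fst (snd (var 0)))) (e₃ := fst (snd (snd (var 0)))) (e₄ := snd (snd (var 0)))
    hcA hcB HA HB hAN hBN hP hQ (Ev.pure rfl (t := 10) (by decide))
    (Ev.pure rfl (t := 10) (by decide)) (Ev.pure rfl (t := 10) (by decide))
    (Ev.pure rfl (t := 10) (by decide))
  set v₁ : Val := .pair (encodePt a₁) (encodePt b₁) with hv₁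
  have pu : pev [v₁, inp] (fst (snd (snd (var 1)))) = some (encodePt u) := rfl
  have pc : pev [v₁, inp] (snd (snd (snd (var 1)))) = some (.num c) := rfl
  obtain ⟨b₂, hb₂, a₂, ha₂, hba, t2⟩ := bridge_spec (env := [v₁, inp])
    (e₁ := fst (fst (snd (var 1)))) (e₂ := fst (fst (var 1)))
    (e₃ := negE (fst (snd (snd (var 1)))))
    (e₄ := .pair (negE (fst (snd (snd (var 1))))) (.sub (.const 0) (snd (snd (snd (var 1))))))
    hcB hcA HB HA hBN hAN (u := -u) (c := -c) (fun q hq => by rw [hneg]; linarith [hQ q hq])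
    (fun p hp => by rw [hneg]; linarith [hP p hp]) (Ev.pure rfl (t := 10) (by decide))
    (Ev.pure rfl (t := 10) (by decide)) (Ev.pure (pev_negE pu) (t := 30) (by decide))
    (Ev.pure (pev_pair (pev_negE pu) (pev_zero_sub pc)) (t := 40) (by decide))
  rw [Finset.union_comm] at hba
  set v₂ : Val := .pair (encodePt b₂) (encodePt a₂) with hv₂
  have mA : ∀ {p : Pt}, p ∈ P → IsVertex (P ∪ Q) p → p ∈ A.toList := fun hp hv =>
    hcA.mem_of_isVertex (hv.mono Finset.subset_union_left hp)
  have mB : ∀ {p : Pt}, p ∈ Q → IsVertex (P ∪ Q) p → p ∈ B.toList := fun hp hv =>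
    hcB.mem_of_isVertex (hv.mono Finset.subset_union_right hp)
  obtain ⟨M, K, w₁, w₂, l1, l2, l3, l4, l5⟩ := cut_spec (env := [v₂, v₁, inp])
    (e₁ := fst (fst (var 2))) (e₂ := .pair (snd (var 0)) (fst (var 1))) HA
    (mA ha₂ hba.isVertex_right) (mA ha₁ hab.isVertex_left) hcA.2.1 hcA.ccw hAN
    (Ev.pure rfl (t := 10) (by decide)) (Ev.pure rfl (t := 10) (by decide))
  obtain ⟨M', K', w₁', w₂', l1', l2', l3', l4', l5'⟩ := cut_spec
    (env := [.pair w₁ w₂, v₂, v₁, inp])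
    (e₁ := fst (fst (snd (var 3)))) (e₂ := .pair (snd (var 2)) (fst (var 1))) HB
    (mB hb₁ hab.isVertex_right) (mB hb₂ hba.isVertex_left) hcB.2.1 hcB.ccw hBN
    (Ev.pure rfl (t := 10) (by decide)) (Ev.pure rfl (t := 10) (by decide))
  have hcyc := cyc_union hP hQ hcA hcB ha₁ ha₂ hb₁ hb₂ hab hba l1 l2 l1' l2'
  have hcN := hcyc.length_le.trans hN
  set env : List Val := [.pair w₁' w₂', .pair w₁ w₂, v₂, v₁, inp] with henv
  obtain ⟨w₃, i1, i2⟩ := cat_spec (env := env) (e₁ := fst (var 1)) (e₂ := fst (var 0))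
    l3 l3' hcN (Ev.pure rfl (t := 10) (by decide)) (Ev.pure rfl (t := 10) (by decide))
  obtain ⟨L, w₄, j1, j2, j3, j4⟩ := normalize_spec hcyc i1 hcN i2
  have hcA' := hcA.isRotated (l1.symm.trans (isRotated_append_comm (a₂ :: M) K))
  have hcB' := hcB.isRotated (l1'.symm.trans (isRotated_append_comm (b₁ :: M') K'))
  obtain ⟨w₅, r1, r2⟩ := repair_spec hcA' (by simp) l4 hA' hPN
  obtain ⟨w₆, s1, s2⟩ := repair_spec hcB' (by simp) l4' hB' hQN
  have hPne : (P ∪ Q).Nonempty := ⟨a₁, hab.1⟩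
  have heq : (P ∪ Q) \ hullVertices (P ∪ Q) =
      (P \ (a₂ :: M).toFinset) ∪ (Q \ (b₁ :: M').toFinset) := by
    rw [hcyc.hullVertices_eq, List.toFinset_append]
    refine union_sdiff_union_comm (Finset.disjoint_left.2 fun x hx hx' => ?_)
      (fun x hx => ?_) (fun x hx => ?_)
    · linarith [hP x hx, hQ x hx']
    · exact (hcA'.isVertex (List.mem_append_right _ (List.mem_toFinset.1 hx))).1
    · exact (hcB'.isVertex (List.mem_append_right _ (List.mem_toFinset.1 hx))).1
  have hlt := card_sdiff_hullVertices_lt hPne.ne_empty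
  have hlen := onion_cons hPne
  rw [heq] at hlt hlen
  obtain ⟨w, k1, k2⟩ := ih _ hlt r1 s1 (fun p hp => hP p (Finset.mem_sdiff.1 hp).1)
    (fun q hq => hQ q (Finset.mem_sdiff.1 hq).1) (hlt.le.trans hN) rfl
  refine ⟨.pair w₄ w, .of_rep j1 j2 j3 (by rw [heq]; exact k1), ?_⟩
  have m1 := onion_length_mono (Finset.subset_union_left (s₁ := P) (s₂ := Q))
  have m2 := onion_length_mono (Finset.subset_union_right (s₁ := P) (s₂ := Q))
  have m1' := Nat.mul_le_mul_left (600000 * lam N) m1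
  have m2' := Nat.mul_le_mul_left (600000 * lam N) m2
  rw [hlen, List.length_cons] at m1' m2' ⊢
  refine (Ev.ifPair_pos z1 (Ev.ifPair_pos z2 (Ev.bind t1 (Ev.bind t2 (Ev.bind l5 (Ev.bind l5'
    (Ev.pair j4 (Ev.call (f := 22) (Ev.pair
      (Ev.call (f := 21) (Ev.pure rfl (t := 20) (by decide)) rfl r2)
      (Ev.pair (Ev.call (f := 21) (Ev.pure rfl (t := 20) (by decide)) rfl s2)
        (Ev.pure rfl (t := 10) (by decide)))) rfl k2)))))))).mono ?_
  generalize (onion (P \ (a₂ :: M).toFinset ∪ Q \ (b₁ :: M').toFinset)).length = k at *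
  generalize 600000 * lam N * (onion P).length = x at *
  generalize 600000 * lam N * (onion Q).length = y at *
  have e1 : 600000 * lam N * (k + 1) = 600000 * (lam N * k) + 600000 * lam N := by ring
  -- The increment of the square, which is linear in `k`, pays for the two repairs; the constant
  -- part covers the bridges, the cuts and the new layer.
  have e2 : 3000000 * lam N * (k + 1) ^ 2 =
      3000000 * lam N * k ^ 2 + 6000000 * (lam N * k) + 3000000 * lam N := by ring
  rw [e1] at m1' m2'
  rw [e2]
  omega

end

/-! ### The whole program and its running time -/

open Classical in
theorem onionUnion_spec {P Q : Finset Pt} {us vs : Val}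
    (hd : Disjoint (convexHull ℝ (P : Set Pt)) (convexHull ℝ (Q : Set Pt)))
    (h : RepresentsOnion P us) (h' : RepresentsOnion Q vs) :
    ∃ w, RepresentsOnion (P ∪ Q) w ∧ Ev prog [.pair us vs] onionUnion.main w
      (lam (P.card + Q.card) * (3000000 * (onion (P ∪ Q)).length ^ 2 + 1000200)) := by
  have hlam := one_le_lam (P.card + Q.card)
  rcases h.cases with ⟨rfl, rfl⟩ | ⟨A, us', rfl, hbA, hlA, hcA, -⟩
  · rw [Finset.empty_union]
    exact ⟨vs, h', (Ev.ifPair_nil (Ev.pure rfl (t := 10) (by decide))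
      (Ev.pure rfl (t := 10) (by decide))).mono (by nlinarith)⟩
  rcases h'.cases with ⟨rfl, rfl⟩ | ⟨B, vs', rfl, hbB, hlB, hcB, -⟩
  · rw [Finset.union_empty]
    exact ⟨_, h, (Ev.ifPair_pos (Ev.pure rfl (t := 10) (by decide)) (Ev.ifPair_nil
      (Ev.pure rfl (t := 10) (by decide)) (Ev.pure rfl (t := 10) (by decide)))).mono
      (by nlinarith)⟩
  obtain ⟨u, c, hP, hQ, t1⟩ := separate_spec (N := P.card + Q.card)
    (env := [.pair (.pair A.encode us') (.pair B.encode vs')])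
    (e₁ := fst (fst (var 0))) (e₂ := fst (snd (var 0))) hlA hlB A.toList_ne_nil B.toList_ne_nil
    (PTree.rep hbA) (PTree.rep hbB) (hcA.length_le.trans (Nat.le_add_right _ _))
    (hcB.length_le.trans (Nat.le_add_left _ _)) hd (Ev.pure rfl (t := 10) (by decide))
    (Ev.pure rfl (t := 10) (by decide))
  obtain ⟨w, k1, k2⟩ := union_spec h h' hP hQ (Finset.card_union_le P Q)
  refine ⟨w, k1, (Ev.ifPair_pos (Ev.pure rfl (t := 10) (by decide))
    (Ev.ifPair_pos (Ev.pure rfl (t := 10) (by decide)) (Ev.call (f := 22)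
      (Ev.pair (Ev.pure rfl (t := 10) (by decide)) (Ev.pair (Ev.pure rfl (t := 10) (by decide))
        t1)) rfl k2))).mono ?_⟩
  nlinarith

/-- For `n ≥ 2` the logarithm is at least one, so it absorbs the additive one in `lam`. -/
theorem lam_le_logb {n : ℕ} (hn : 2 ≤ n) : (lam n : ℝ) ≤ 2 * Real.logb 2 n := by
  have h1 : ((Nat.log 2 n : ℕ) : ℝ) ≤ Real.logb 2 n := by
    simpa using Real.natLog_le_logb n 2
  have h2 : (1 : ℝ) ≤ Real.logb 2 n := by
    rw [Real.le_logb_iff_rpow_le (by norm_num) (by positivity), Real.rpow_one]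
    exact_mod_cast hn
  rw [lam]
  push_cast
  linarith

end OnionUnion

open OnionUnion in
theorem mainTheorem2 :
    ∃ (M : Program) (C : ℝ), ∀ (P Q : Finset Pt) (u v : Val),
      Disjoint (convexHull ℝ (P : Set Pt)) (convexHull ℝ (Q : Set Pt)) →
      RepresentsOnion P u → RepresentsOnion Q v →
      ∃ (w : Val) (t : ℕ), M.Run (.pair u v) w t ∧ RepresentsOnion (P ∪ Q) w ∧
        (2 ≤ P.card + Q.card →
          (t : ℝ) ≤ C * ((onion (P ∪ Q)).length : ℝ) ^ 2
            * Real.logb 2 ((P.card + Q.card : ℕ) : ℝ)) := by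
  refine ⟨onionUnion, 10000000, fun P Q u v hd hP hQ => ?_⟩
  obtain ⟨w, h1, t, ht, h2⟩ := onionUnion_spec hd hP hQ
  refine ⟨w, t, h2, h1, fun hn => ?_⟩
  have hlog := lam_le_logb hn
  have hne : (P ∪ Q).Nonempty := by
    rw [Finset.nonempty_iff_ne_empty, Ne, Finset.union_eq_empty]
    rintro ⟨rfl, rfl⟩
    simp at hn
  have hk : 1 ≤ (onion (P ∪ Q)).length ^ 2 :=
    Nat.one_le_pow _ _ (by rw [onion_cons hne]; simp)
  -- Since there is at least one layer, the cost of the separation is absorbed by the quadratic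
  -- term. The factor two of `lam_le_logb` leads to the final constant.
  have ht' : t ≤ 5000000 * (onion (P ∪ Q)).length ^ 2 * lam (P.card + Q.card) :=
    ht.trans (by rw [mul_comm]; exact Nat.mul_le_mul_right _ (by omega))
  calc (t : ℝ) ≤ 5000000 * ((onion (P ∪ Q)).length : ℝ) ^ 2 * lam (P.card + Q.card) := by
        exact_mod_cast ht'
    _ ≤ 5000000 * ((onion (P ∪ Q)).length : ℝ) ^ 2 *
        (2 * Real.logb 2 ((P.card + Q.card : ℕ) : ℝ)) :=
        mul_le_mul_of_nonneg_left hlog (by positivity)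
    _ = _ := by ring
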